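/- All graphs are finite, simple and undirected. For a graph $G$ let $\nu(G)$ be the maximum size of a matching of $G$, let $\beta(G)$ be the minimum size of an (inclusion-wise) maximal matching of $G$, and let $\mu(G)=\nu(G)-\beta(G)$ be the matching gap of $G$. Let $D(G)$ be the set of vertices of $G$ that are left exposed by at least one maximum matching, and let $A(G)$ be the set of vertices of $V(G)\setminus D(G)$ that have at least one neighbour in $D(G)$. $\textsc{MatchingGap}$ is the decision problem that, given a graph $G$ and a non-negative integer $k$, asks whether $\mu(G)\ge k$. **Theorem.** There is an $\mathsf{XP}$ algorithm for $\textsc{MatchingGap}$ parameterized by $\mu(G)+|A(G)|$. More precisely, there are a deterministic algorithm and a constant $c$ such that on every input $(G,k)$, where $G$ is given by its adjacency matrix and $k$ in binary, the algorithm halts, answers correctly whether $\mu(G)\ge k$, and runs in time at most $$\bigl(|V(G)|+\ell(k)+2\bigr)^{c\,(\mu(G)+|A(G)|+1)},$$ where $\ell(k)$ is the number of binary digits of $k$ (with $\ell(0)=0$). Here an algorithm is a program of a while language over binary trees (identity, the constant empty tree, left subtree, right subtree, pairing, sequential composition, if-then-else, while loop), in which each elementary operation is charged the size of the tree that it reads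 and building a tree is charged the size of the tree built; this time measure agrees with Turing machine time up to a polynomial. -/

import Mathlib

namespace MatchingGap

/-! ### Matchings, matching gap, Gallai-Edmonds set -/

section Graphs

variable {V : Type*} (G : SimpleGraph V)

/-- The matching number `ν(G)`: the maximum number of edges of a matching of `G`
(for a graph on finitely many vertices). -/
noncomputable def matchingNumber : ℕ :=
  sSup {m | ∃ M : G.Subgraph, M.IsMatching ∧ M.edgeSet.ncard = m}

/-- A maximal matching: one that is not properly contained in another matching. (The vertex set
of a matching is the set of ends of its edges, so containment is containment of edge sets.) -/
def IsMaximalMatching {G : SimpleGraph V} (M : G.Subgraph) : Prop :=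
  Maximal (fun M' : G.Subgraph => M'.IsMatching) M

/-- The MMM number `β(G)`: the minimum number of edges of a maximal matching of `G`. -/
noncomputable def minMaximalMatchingNumber : ℕ :=
  sInf {m | ∃ M : G.Subgraph, IsMaximalMatching M ∧ M.edgeSet.ncard = m}

/-- The matching gap `μ(G) = ν(G) - β(G)`. (No truncation occurs on a finite graph, since a
maximal matching is a matching, so `β(G) ≤ ν(G)`.) -/
noncomputable def matchingGap : ℕ :=
  matchingNumber G - minMaximalMatchingNumber G

/-- A maximum matching: a matching with `ν(G)` edges. -/
def IsMaximumMatching {G : SimpleGraph V} (M : G.Subgraph) : Prop :=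
  M.IsMatching ∧ M.edgeSet.ncard = matchingNumber G

/-- The set `D(G)` of the vertices that some maximum matching leaves exposed. -/
def gallaiEdmondsD : Set V :=
  {v | ∃ M : G.Subgraph, IsMaximumMatching M ∧ v ∉ M.verts}

/-- The set `A(G)` of the vertices outside `D(G)` that have a neighbour in `D(G)`. -/
def gallaiEdmondsA : Set V :=
  {v | v ∉ gallaiEdmondsD G ∧ ∃ w ∈ gallaiEdmondsD G, G.Adj v w}

end Graphs

/-! ### The machine model

A while language over binary trees (pure LISP data). Every elementary operation is charged the
size of the tree that it reads, and building a tree is charged the size of the tree that is built,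
as if all data were copied. Time is therefore never less than the size of any tree that occurs
in the computation, and it agrees with time on a multi-tape Turing machine up to a polynomial. -/

/-- Binary trees. -/
inductive Data : Type
  | nil : Data
  | cons : Data → Data → Data

namespace Data

/-- The number of nodes, leaves included. -/
def size : Data → ℕ
  | nil => 1
  | cons a b => size a + size b + 1

/-- The left subtree, with `nil` as the left subtree of `nil`. -/
def head : Data → Data
  | nil => nil
  | cons a _ => a

/-- The right subtree, with `nil` as the right subtree of `nil`. -/
def tail : Data → Data
  | nil => nil
  | cons _ b => b

end Data

/-- Programs. Each one has a single tree as its input and, if it halts, a single tree as its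
output. -/
inductive Prog : Type
  /-- return the input -/
  | id : Prog
  /-- return `nil` -/
  | nil : Prog
  /-- return the left subtree of the input -/
  | head : Prog
  /-- return the right subtree of the input -/
  | tail : Prog
  /-- run both programs on the input and return the tree made of the two results -/
  | cons : Prog → Prog → Prog
  /-- run the first program on the input and the second one on its result -/
  | seq : Prog → Prog → Prog
  /-- run the first program on the input; run the second one on the input if the result is not
  `nil`, and the third one otherwise -/
  | ite : Prog → Prog → Prog → Prog
  /-- as long as the first program maps the current tree to a tree other than `nil`, replace the
  current tree by its image under the second program -/
  | loop : Prog → Prog → Prog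

/-- `Run p x y t`: on input `x`, the program `p` halts after time `t` with output `y`. -/
inductive Run : Prog → Data → Data → ℕ → Prop
  | id (x : Data) : Run .id x x x.size
  | nil (x : Data) : Run .nil x .nil x.size
  | head (x : Data) : Run .head x x.head x.size
  | tail (x : Data) : Run .tail x x.tail x.size
  | cons {p q : Prog} {x y z : Data} {s t : ℕ} :
      Run p x y s → Run q x z t → Run (.cons p q) x (.cons y z) (s + t + (Data.cons y z).size)
  | seq {p q : Prog} {x y z : Data} {s t : ℕ} :
      Run p x y s → Run q y z t → Run (.seq p q) x z (s + t + 1)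
  | ite_true {c p q : Prog} {x b y : Data} {s t : ℕ} :
      Run c x b s → b ≠ .nil → Run p x y t → Run (.ite c p q) x y (s + t + 1)
  | ite_false {c p q : Prog} {x b y : Data} {s t : ℕ} :
      Run c x b s → b = .nil → Run q x y t → Run (.ite c p q) x y (s + t + 1)
  | loop_step {c p : Prog} {x b y z : Data} {r s t : ℕ} :
      Run c x b r → b ≠ .nil → Run p x y s → Run (.loop c p) y z t →
        Run (.loop c p) x z (r + s + t + 1)
  | loop_stop {c p : Prog} {x b : Data} {r : ℕ} :
      Run c x b r → b = .nil → Run (.loop c p) x x (r + 1)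

/-- Programs are deterministic: output and time are determined by the input. -/
theorem Run.unique {p : Prog} {x y y' : Data} {t t' : ℕ} (h : Run p x y t)
    (h' : Run p x y' t') : y = y' ∧ t = t' := by
  induction h generalizing y' t' with
  | id | nil | head | tail => cases h'; exact ⟨rfl, rfl⟩
  | cons _ _ ih₁ ih₂ =>
    cases h' with
    | cons k₁ k₂ =>
      obtain ⟨rfl, rfl⟩ := ih₁ k₁
      obtain ⟨rfl, rfl⟩ := ih₂ k₂
      exact ⟨rfl, rfl⟩
  | seq _ _ ih₁ ih₂ =>
    cases h' with
    | seq k₁ k₂ =>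
      obtain ⟨rfl, rfl⟩ := ih₁ k₁
      obtain ⟨rfl, rfl⟩ := ih₂ k₂
      exact ⟨rfl, rfl⟩
  | ite_true _ hb _ ih₁ ih₂ =>
    cases h' with
    | ite_true k₁ _ k₂ =>
      obtain ⟨rfl, rfl⟩ := ih₁ k₁
      obtain ⟨rfl, rfl⟩ := ih₂ k₂
      exact ⟨rfl, rfl⟩
    | ite_false k₁ kb _ => exact absurd ((ih₁ k₁).1.trans kb) hb
  | ite_false _ hb _ ih₁ ih₂ =>
    cases h' with
    | ite_true k₁ kb _ => exact absurd ((ih₁ k₁).1.symm.trans hb) kb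
    | ite_false k₁ _ k₂ =>
      obtain ⟨rfl, rfl⟩ := ih₁ k₁
      obtain ⟨rfl, rfl⟩ := ih₂ k₂
      exact ⟨rfl, rfl⟩
  | loop_step _ hb _ _ ih₁ ih₂ ih₃ =>
    cases h' with
    | loop_step k₁ _ k₂ k₃ =>
      obtain ⟨rfl, rfl⟩ := ih₁ k₁
      obtain ⟨rfl, rfl⟩ := ih₂ k₂
      obtain ⟨rfl, rfl⟩ := ih₃ k₃
      exact ⟨rfl, rfl⟩
    | loop_stop k₁ kb => exact absurd ((ih₁ k₁).1.trans kb) hb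
  | loop_stop _ hb ih₁ =>
    cases h' with
    | loop_step k₁ kb _ _ => exact absurd ((ih₁ k₁).1.symm.trans hb) kb
    | loop_stop k₁ _ =>
      obtain ⟨rfl, rfl⟩ := ih₁ k₁
      exact ⟨rfl, rfl⟩

/-! ### Encoding of the instances -/

/-- Truth values. -/
def encodeBool : Bool → Data
  | false => .nil
  | true => .cons .nil .nil

/-- Lists, given an encoding of the entries. -/
def encodeList {α : Type*} (e : α → Data) : List α → Data
  | [] => .nil
  | a :: l => .cons (e a) (encodeList e l)

/-- Natural numbers: the list of the binary digits, least significant digit first. -/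
def encodeNat (k : ℕ) : Data :=
  encodeList encodeBool k.bits

open Classical in
/-- Graphs on the vertices `0, …, n - 1`: the adjacency matrix, as the list of its rows. -/
noncomputable def encodeGraph {n : ℕ} (G : SimpleGraph (Fin n)) : Data :=
  encodeList (encodeList encodeBool)
    (List.ofFn fun i : Fin n => List.ofFn fun j : Fin n => decide (G.Adj i j))

/-- An instance of the decision problem: a graph and a number. -/
noncomputable def encodeInstance {n : ℕ} (G : SimpleGraph (Fin n)) (k : ℕ) : Data :=
  .cons (encodeGraph G) (encodeNat k)

open Classical in
/-- `DecidesWithin p T`: on every instance, a graph `G` and a number `k`, the program `p` halts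
within time `T G k` and answers correctly whether the matching gap of `G` is at least `k`. -/
def DecidesWithin (p : Prog) (T : ∀ {n : ℕ}, SimpleGraph (Fin n) → ℕ → ℕ) : Prop :=
  ∀ (n : ℕ) (G : SimpleGraph (Fin n)) (k : ℕ), ∃ t ≤ T G k,
    Run p (encodeInstance G k) (encodeBool (decide (k ≤ matchingGap G))) t

end MatchingGap

namespace MatchingGap

/-! ### Polynomial time on encoded data -/

/-! A matching is maximal iff the set of vertices it leaves exposed is independent. Let `d` be the
least number of exposed vertices of a matching. Then `μ(G) ≥ j` iff some matching has an independent
exposed set of at least `d + 2j` vertices (`le_matchingGap_iff`), and by `exists_isMat_card_exposed`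
equality may be assumed.

Let `m` be a maximum matching with a certificate `Wit` in the style of Gallai and Edmonds: a set `D`
that contains the exposed vertices, such that each component of `D` has at most one base (a vertex
exposed or matched out of `D`) and the set `N` of outside neighbours of `D` is matched into `D`.
There are `d + |N|` bases (`Wit.card_bases`). By parity, in each component with a base every
matching `n` exposes a vertex or matches one out of `D` (`Wit.exists_base`). The latter happens in
at most `|N|` components, so at least `d` components contain exposed vertices of `n` and no vertex
that `n` matches out of `D`. If `n` exposes `d + 2j` vertices, a count shows that all but at most
`4j` of them are the only exposed vertex of such a component (`Searched.complete`).

So a set `T` of at most `4j` exposed vertices is guessed. What remains is to choose `d + 2j - |T|`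
vertices without neighbours in `T`, in distinct components of `D` disjoint from `T`, so that the
rest of the graph has a perfect matching. Independence is then automatic, since there are no edges
between components, and the choice is a perfect matching problem in an auxiliary graph (`gadgetV`,
`gadgetE`, `Searched.sound`).

There are `n ^ O(j)` guesses. The value `j` is raised from 1 until the test fails or the threshold
is reached, hence never exceeds `μ(G) + 1`. The time is therefore polynomial in `s ^ (μ(G) + 1)`,
where `s` is the base of the bound; this is within the claim, as `|A(G)|` only adds to the exponent.

A maximum matching comes from a test for maximality alone. A greedy search builds the smallest
possible candidate for `D`; it yields a certificate iff one exists (`isMaxL_iff`), and by Tutte's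
theorem one exists for every maximum matching (`exists_wit`). If the test fails, edges are deleted
as long as it keeps failing; the surviving edges determine a larger matching (`augL_spec`).

All of this is written with list operations, and `PT` is closed under composition, bounded folds and
bounded iteration, so that polynomial time is mostly checked by `fun_prop`. -/

theorem Data.size_pos (x : Data) : 0 < x.size := by
  cases x <;> simp [Data.size]

theorem Run.input_size_le {p : Prog} {x y : Data} {t : ℕ} (h : Run p x y t) : x.size ≤ t := by
  induction h <;> omega

theorem Run.output_size_le {p : Prog} {x y : Data} {t : ℕ} (h : Run p x y t) : y.size ≤ t := by
  induction h with
  | id x => exact le_rfl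
  | nil x => exact x.size_pos
  | head x => cases x <;> simp [Data.head, Data.size]; omega
  | tail x => cases x <;> simp [Data.tail, Data.size]; omega
  | cons => omega
  | seq => omega
  | ite_true => omega
  | ite_false => omega
  | loop_step => omega
  | loop_stop h _ _ => exact h.input_size_le.trans (Nat.le_succ _)

/-- A loop that runs through the states `s 0, …, s m`, each turn in time at most `2 * B + 1`. -/
theorem Run.loop_iterate {c p : Prog} (s : ℕ → Data) (m B : ℕ)
    (hc : ∀ i < m, ∃ b r, b ≠ Data.nil ∧ r ≤ B ∧ Run c (s i) b r)
    (hp : ∀ i < m, ∃ t ≤ B, Run p (s i) (s (i + 1)) t)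
    (hm : ∃ r ≤ B, Run c (s m) .nil r) :
    ∃ t ≤ (m + 1) * (2 * B + 1), Run (.loop c p) (s 0) (s m) t := by
  -- Induction on the number `j` of turns still to come, because `Run.loop_step` prepends a turn.
  suffices H : ∀ j ≤ m, ∃ t ≤ (j + 1) * (2 * B + 1), Run (.loop c p) (s (m - j)) (s m) t by
    simpa using H m le_rfl
  intro j
  induction j with
  | zero =>
    intro _
    obtain ⟨r, hr, h⟩ := hm
    exact ⟨r + 1, by omega, Run.loop_stop h rfl⟩
  | succ j ih =>
    intro hj
    obtain ⟨t, ht, h⟩ := ih (by omega)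
    obtain ⟨b, r, hb, hr, h₁⟩ := hc (m - (j + 1)) (by omega)
    obtain ⟨t', ht', h₂⟩ := hp (m - (j + 1)) (by omega)
    rw [show m - (j + 1) + 1 = m - j by omega] at h₂
    refine ⟨r + t' + t + 1, ?_, .loop_step h₁ hb h₂ h⟩
    rw [Nat.succ_mul]
    omega

/-- Types whose elements are encoded as binary trees. -/
class Enc (α : Type*) where
  /-- the code of an element -/
  enc : α → Data

open Enc (enc)

instance : Enc Unit := ⟨fun _ => .nil⟩
instance : Enc Bool := ⟨encodeBool⟩
instance {α β : Type*} [Enc α] [Enc β] : Enc (α × β) := ⟨fun x => .cons (enc x.1) (enc x.2)⟩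
instance {α : Type*} [Enc α] : Enc (List α) := ⟨encodeList enc⟩
/-- Natural numbers are encoded in unary here. -/
instance : Enc ℕ := ⟨fun n => enc (List.replicate n ())⟩

section

variable {α β γ δ : Type*} [Enc α] [Enc β] [Enc γ] [Enc δ]

/-- The size of the code of an element. -/
def esize (x : α) : ℕ := (enc x).size

theorem esize_pos (x : α) : 0 < esize x := Data.size_pos _

@[simp] theorem esize_prod (x : α × β) : esize x = esize x.1 + esize x.2 + 1 := rfl
@[simp] theorem esize_nil : esize ([] : List α) = 1 := rfl
@[simp] theorem esize_cons (a : α) (l : List α) : esize (a :: l) = esize a + esize l + 1 := rfl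
@[simp] theorem esize_unit (x : Unit) : esize x = 1 := rfl

theorem esize_bool_le (b : Bool) : esize b ≤ 3 := by cases b <;> decide

theorem esize_list (l : List α) : esize l = (l.map fun a => esize a + 1).sum + 1 := by
  induction l with
  | nil => rfl
  | cons a l ih => rw [esize_cons, ih, List.map_cons, List.sum_cons]; omega

@[simp] theorem esize_nat (n : ℕ) : esize n = 2 * n + 1 := by
  change esize (List.replicate n ()) = _
  rw [esize_list]
  simp [mul_comm]

theorem length_lt_esize (l : List α) : l.length < esize l := by
  induction l with
  | nil => simp
  | cons a l ih => simp only [esize_cons, List.length_cons]; omega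

theorem esize_le_of_mem {a : α} {l : List α} (h : a ∈ l) : esize a < esize l := by
  induction l with
  | nil => simp at h
  | cons b l ih =>
    rcases List.mem_cons.1 h with rfl | h
    · simp only [esize_cons]; omega
    · have := ih h; simp only [esize_cons]; omega

theorem esize_append (l l' : List α) : esize (l ++ l') + 1 = esize l + esize l' := by
  simp only [esize_list, List.map_append, List.sum_append]; omega

theorem esize_reverse (l : List α) : esize l.reverse = esize l := by
  simp only [esize_list, List.map_reverse, List.sum_reverse]

theorem esize_sublist {l l' : List α} (h : l.Sublist l') : esize l ≤ esize l' := by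
  rw [esize_list, esize_list]
  exact Nat.succ_le_succ ((h.map _).sum_le_sum (by simp))

theorem esize_le_of_forall {l : List α} {B : ℕ} (h : ∀ a ∈ l, esize a ≤ B) :
    esize l ≤ l.length * (B + 1) + 1 := by
  induction l with
  | nil => simp
  | cons a l ih =>
    have h₁ := h a (by simp)
    have h₂ := ih fun b hb => h b (by simp [hb])
    simp only [esize_cons, List.length_cons, Nat.succ_mul]
    omega

/-- Functions into `ℕ` that are bounded by a polynomial in the size of the argument. -/
@[fun_prop]
def PolyBd (f : α → ℕ) : Prop := ∃ c, ∀ x, f x ≤ (esize x + 1) ^ c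

theorem PolyBd.mono {f g : α → ℕ} (hg : PolyBd g) (h : ∀ x, f x ≤ g x) : PolyBd f :=
  hg.imp fun _ hc x => (h x).trans (hc x)

/-- The reason for the `+ 1` in `PolyBd`: with a base of at least 2, constants and sums are absorbed
by the exponent. -/
theorem two_le_esize_succ (x : α) : 2 ≤ esize x + 1 := Nat.succ_le_succ (esize_pos x)

@[fun_prop]
theorem PolyBd.const (n : ℕ) : PolyBd fun _ : α => n :=
  ⟨n, fun x => (Nat.lt_pow_self (a := 2) (by norm_num)).le.trans
    (Nat.pow_le_pow_left (two_le_esize_succ x) n)⟩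

@[fun_prop]
theorem PolyBd.esize : PolyBd fun x : α => esize x := ⟨1, fun x => by simp⟩

@[fun_prop]
theorem PolyBd.mul {f g : α → ℕ} (hf : PolyBd f) (hg : PolyBd g) :
    PolyBd fun x => f x * g x := by
  obtain ⟨c, hc⟩ := hf
  obtain ⟨d, hd⟩ := hg
  exact ⟨c + d, fun x => by rw [pow_add]; exact Nat.mul_le_mul (hc x) (hd x)⟩

@[fun_prop]
theorem PolyBd.add {f g : α → ℕ} (hf : PolyBd f) (hg : PolyBd g) :
    PolyBd fun x => f x + g x := by
  obtain ⟨c, hc⟩ := hf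
  obtain ⟨d, hd⟩ := hg
  refine ⟨c + d + 1, fun x => ?_⟩
  have h1 : (MatchingGap.esize x + 1) ^ c ≤ (MatchingGap.esize x + 1) ^ (c + d) :=
    Nat.pow_le_pow_right (by omega) (by omega)
  have h2 : (MatchingGap.esize x + 1) ^ d ≤ (MatchingGap.esize x + 1) ^ (c + d) :=
    Nat.pow_le_pow_right (by omega) (by omega)
  have := hc x
  have := hd x
  calc f x + g x ≤ (MatchingGap.esize x + 1) ^ (c + d) * 2 := by omega
    _ ≤ _ := by rw [pow_succ]; exact Nat.mul_le_mul_left _ (two_le_esize_succ x)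

@[fun_prop]
theorem PolyBd.pow {f : α → ℕ} (hf : PolyBd f) (n : ℕ) : PolyBd fun x => f x ^ n := by
  obtain ⟨c, hc⟩ := hf
  exact ⟨c * n, fun x => by rw [pow_mul]; exact Nat.pow_le_pow_left (hc x) n⟩

theorem PolyBd.comp {f : β → ℕ} {g : α → β} (hf : PolyBd f) (hg : PolyBd fun x => MatchingGap.esize (g x)) :
    PolyBd fun x => f (g x) := by
  obtain ⟨c, hc⟩ := hf
  exact ((hg.add (.const 1)).pow c).mono fun x => hc (g x)

/-- Functions computed by a program in polynomial time. -/
@[fun_prop]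
def PT (f : α → β) : Prop :=
  ∃ p : Prog, ∃ T : α → ℕ, PolyBd T ∧ ∀ x, ∃ t ≤ T x, Run p (enc x) (enc (f x)) t

/-- Time is never less than the size of the output. This is what makes composition work: the second
program runs on an input of polynomial size. -/
theorem PT.bd {f : α → β} (hf : PT f) : PolyBd fun x => MatchingGap.esize (f x) := by
  obtain ⟨p, T, hT, h⟩ := hf
  refine hT.mono fun x => ?_
  obtain ⟨t, ht, hr⟩ := h x
  exact hr.output_size_le.trans ht

@[fun_prop]
theorem PolyBd.esize_comp {f : α → β} (hf : PT f) : PolyBd fun x => MatchingGap.esize (f x) := hf.bd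

@[fun_prop]
theorem PT.id : PT fun x : α => x := ⟨.id, _, .esize, fun x => ⟨_, le_rfl, .id _⟩⟩

/-- A program for `f` also computes every function with the same codes. -/
theorem PT.of_enc_eq {f : α → β} {g : α → γ} (hf : PT f) (h : ∀ x, enc (g x) = enc (f x)) :
    PT g := by
  obtain ⟨p, T, hT, hp⟩ := hf
  exact ⟨p, T, hT, fun x => by rw [h]; exact hp x⟩

@[fun_prop]
theorem PT.comp {g : β → γ} {f : α → β} (hg : PT g) (hf : PT f) : PT fun x => g (f x) := by
  have hb := hf.bd
  obtain ⟨p, T, hT, hp⟩ := hf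
  obtain ⟨q, U, hU, hq⟩ := hg
  refine ⟨.seq p q, fun x => T x + U (f x) + 1, (hT.add (hU.comp hb)).add (.const 1), fun x => ?_⟩
  obtain ⟨t, ht, h⟩ := hp x
  obtain ⟨u, hu, h'⟩ := hq (f x)
  exact ⟨_, by dsimp only; omega, .seq h h'⟩

@[fun_prop]
theorem PT.pair {f : α → β} {g : α → γ} (hf : PT f) (hg : PT g) : PT fun x => (f x, g x) := by
  have hb := hf.bd
  have hb' := hg.bd
  obtain ⟨p, T, hT, hp⟩ := hf
  obtain ⟨q, U, hU, hq⟩ := hg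
  refine ⟨.cons p q, fun x => T x + U x + (esize (f x) + esize (g x) + 1),
    (hT.add hU).add ((hb.add hb').add (.const 1)), fun x => ?_⟩
  obtain ⟨t, ht, h⟩ := hp x
  obtain ⟨u, hu, h'⟩ := hq x
  refine ⟨_, ?_, .cons h h'⟩
  have : (Data.cons (enc (f x)) (enc (g x))).size = esize (f x) + esize (g x) + 1 := rfl
  dsimp only
  omega

theorem PT.fst' : PT fun x : α × β => x.1 := ⟨.head, _, .esize, fun _ => ⟨_, le_rfl, .head _⟩⟩
theorem PT.snd' : PT fun x : α × β => x.2 := ⟨.tail, _, .esize, fun _ => ⟨_, le_rfl, .tail _⟩⟩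

@[fun_prop]
theorem PT.fst {f : γ → α × β} (h : PT f) : PT fun x => (f x).1 := PT.fst'.comp h

@[fun_prop]
theorem PT.snd {f : γ → α × β} (h : PT f) : PT fun x => (f x).2 := PT.snd'.comp h

@[fun_prop]
theorem PT.const (b : β) : PT fun _ : α => b := by
  -- Generalised from codes to all trees, since the induction passes to subtrees.
  suffices H : ∀ d : Data, ∃ p : Prog, ∃ T : α → ℕ, PolyBd T ∧
      ∀ x, ∃ t ≤ T x, Run p (enc x) d t from H (enc b)
  intro d
  induction d with
  | nil => exact ⟨.nil, _, .esize, fun _ => ⟨_, le_rfl, .nil _⟩⟩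
  | cons a b iha ihb =>
    obtain ⟨p, T, hT, hp⟩ := iha
    obtain ⟨q, U, hU, hq⟩ := ihb
    refine ⟨.cons p q, fun x => T x + U x + (Data.cons a b).size,
      (hT.add hU).add (.const _), fun x => ?_⟩
    obtain ⟨t, ht, h⟩ := hp x
    obtain ⟨u, hu, h'⟩ := hq x
    exact ⟨_, by dsimp only; omega, .cons h h'⟩

@[fun_prop]
theorem PT.cons {f : α → β} {g : α → List β} (hf : PT f) (hg : PT g) : PT fun x => f x :: g x :=
  (hf.pair hg).of_enc_eq fun _ => rfl

@[fun_prop]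
theorem PT.tail {f : α → List β} (hf : PT f) : PT fun x => (f x).tail := by
  refine PT.comp (g := List.tail) ⟨.tail, _, .esize, fun l => ⟨_, le_rfl, ?_⟩⟩ hf
  cases l <;> exact .tail _

/-- The machine returns `nil` as the left subtree of `nil`, so this operation costs nothing extra
exactly for a default value with code `nil`. -/
theorem PT.headD {f : α → List β} (hf : PT f) (b : β) (hb : enc b = .nil) :
    PT fun x => (f x).headD b := by
  refine PT.comp (g := fun l => List.headD l b) ⟨.head, _, .esize, fun l => ⟨_, le_rfl, ?_⟩⟩ hf
  cases l
  · change Run _ _ (enc b) _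
    rw [hb]
    exact .head _
  · exact .head _

/-- Branching on whether a code is `nil`. -/
theorem PT.branch {f : α → γ} {g h : α → β} {k : α → β} (hf : PT f) (hg : PT g) (hh : PT h)
    (h₁ : ∀ x, enc (f x) ≠ .nil → k x = g x) (h₂ : ∀ x, enc (f x) = .nil → k x = h x) : PT k := by
  obtain ⟨p, T, hT, hp⟩ := hf
  obtain ⟨q, U, hU, hq⟩ := hg
  obtain ⟨r, W, hW, hr⟩ := hh
  refine ⟨.ite p q r, fun x => T x + (U x + W x) + 1, (hT.add (hU.add hW)).add (.const 1),
    fun x => ?_⟩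
  obtain ⟨t, ht, h⟩ := hp x
  by_cases hx : enc (f x) = .nil
  · obtain ⟨u, hu, h'⟩ := hr x
    rw [h₂ x hx]
    exact ⟨_, by dsimp only; omega, .ite_false h hx h'⟩
  · obtain ⟨u, hu, h'⟩ := hq x
    rw [h₁ x hx]
    exact ⟨_, by dsimp only; omega, .ite_true h hx h'⟩

@[fun_prop]
theorem PT.cond {b : α → Bool} {f g : α → β} (hb : PT b) (hf : PT f) (hg : PT g) :
    PT fun x => bif b x then f x else g x := by
  refine hb.branch hf hg (fun x h => ?_) fun x h => ?_ <;> cases hx : b x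
  · exact absurd (by rw [hx]; rfl) h
  · rfl
  · rfl
  · rw [hx] at h
    cases h

@[fun_prop]
theorem PT.not {b : α → Bool} (hb : PT b) : PT fun x => !(b x) :=
  (hb.cond (.const false) (.const true)).of_enc_eq fun x => by cases b x <;> rfl

@[fun_prop]
theorem PT.and {a b : α → Bool} (ha : PT a) (hb : PT b) : PT fun x => a x && b x :=
  (ha.cond hb (.const false)).of_enc_eq fun x => by cases a x <;> rfl

@[fun_prop]
theorem PT.or {a b : α → Bool} (ha : PT a) (hb : PT b) : PT fun x => a x || b x :=
  (ha.cond (.const true) hb).of_enc_eq fun x => by cases a x <;> rfl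

theorem enc_list_eq_nil {l : List α} : enc l = .nil ↔ l = [] := by
  cases l with
  | nil => exact ⟨fun _ => rfl, fun _ => rfl⟩
  | cons a l => exact ⟨fun h => (Data.noConfusion h), fun h => (List.cons_ne_nil _ _ h).elim⟩

@[fun_prop]
theorem PT.isEmpty {l : α → List β} (hl : PT l) : PT fun x => (l x).isEmpty := by
  refine hl.branch (.const false) (.const true) (fun x h => ?_) fun x h => ?_
  · rw [ne_eq, enc_list_eq_nil] at h
    simp [h]
  · rw [enc_list_eq_nil] at h
    simp [h]

@[fun_prop]
theorem PT.take_one {l : α → List β} (hl : PT l) : PT fun x => (l x).take 1 := by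
  refine PT.comp (g := fun l : List β => l.take 1)
    ⟨.ite .id (.cons .head .nil) .nil, fun l => 6 * esize l + 6, by fun_prop, fun l => ?_⟩ hl
  cases l with
  | nil => exact ⟨_, by simp [Data.size, enc, encodeList], .ite_false (.id _) rfl (.nil _)⟩
  | cons a l =>
    refine ⟨_, ?_, .ite_true (.id _) (by intro h; cases h) (.cons (.head _) (.nil _))⟩
    change esize (a :: l) + (esize (a :: l) + esize (a :: l) + (esize a + 1 + 1)) + 1 ≤ _
    simp only [esize_cons]
    omega

/-- Folding over a list takes polynomial time if the sizes of the accumulated values are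
polynomially bounded. -/
theorem PT.foldl {l : γ → List α} {init : γ → β} {step : γ → β → α → β} (hl : PT l)
    (hi : PT init) (hs : PT fun p : γ × β × α => step p.1 p.2.1 p.2.2)
    {B : γ → ℕ} (hB : PolyBd B)
    (hb : ∀ g k, esize (((l g).take k).foldl (step g) (init g)) ≤ B g) :
    PT fun g => (l g).foldl (step g) (init g) := by
  have hl' := hl.bd
  obtain ⟨p, T, ⟨c, hT⟩, hp⟩ := hs
  obtain ⟨q, U, hU, hq⟩ := (PT.id (α := γ)).pair (hl.pair hi)
  -- `S` bounds the loop states up to an additive constant, and `C` bounds one run of `p` together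
  -- with the projections around it. The constants are crude.
  let S : γ → ℕ := fun g => esize g + esize (l g) + B g
  have hS : PolyBd S := by fun_prop
  let C : γ → ℕ := fun g => 12 * (S g + 3) + (S g + 3) ^ c + 30
  have hC : PolyBd C := by fun_prop
  -- The loop state is `(g, (rest of the list, accumulator))`, and the guard is the rest of the
  -- list. One turn keeps `g`, drops the first entry of the rest and runs `p` on `(g, accumulator,
  -- first entry)`.
  let body : Prog := .cons .head (.cons (.seq .tail (.seq .head .tail))
    (.seq (.cons .head (.cons (.seq .tail .tail) (.seq .tail (.seq .head .head)))) p))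
  refine ⟨.seq q (.seq (.loop (.seq .tail .head) body) (.seq .tail .tail)),
    fun g => U g + (((esize (l g) + 1) * (2 * (6 * C g) + 1)) + (6 * C g) + 1) + 1, by fun_prop,
    fun g => ?_⟩
  obtain ⟨u, hu, h₀⟩ := hq g
  let acc : ℕ → β := fun i => ((l g).take i).foldl (step g) (init g)
  let s : ℕ → Data := fun i => enc (g, ((l g).drop i, acc i))
  have hdrop : ∀ i, esize ((l g).drop i) ≤ esize (l g) := fun i =>
    esize_sublist (List.drop_sublist _ _)
  have hsz : ∀ i, (s i).size ≤ S g + 2 := fun i => by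
    change esize (g, ((l g).drop i, acc i)) ≤ _
    have h₁ := hb g i
    have h₂ := hdrop i
    simp only [esize_prod, S, acc]
    omega
  have hcond : ∀ i, ∃ r ≤ 6 * C g, Run (.seq .tail .head) (s i)
      (enc ((l g).drop i)) r := fun i => by
    refine ⟨_, ?_, .seq (.tail _) (.head _)⟩
    have h₁ := hsz i
    have h₂ : (s i).size = esize g + (s i).tail.size + 1 := rfl
    simp only [C]
    omega
  have hinit : enc ((fun g => (g, (l g, init g))) g) = s 0 := by simp [s, acc]
  rw [show enc (g, (l g, init g)) = s 0 from hinit] at h₀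
  have key : ∃ t ≤ ((l g).length + 1) * (2 * (6 * C g) + 1),
      Run (.loop (.seq .tail .head) body) (s 0) (s (l g).length) t := by
    refine Run.loop_iterate s _ _ (fun i hi => ?_) (fun i hi => ?_) ?_
    · obtain ⟨r, hr, h⟩ := hcond i
      exact ⟨_, r, by rw [ne_eq, enc_list_eq_nil]; simpa using hi, hr, h⟩
    · have hd : (l g).drop i = (l g)[i] :: (l g).drop (i + 1) := List.drop_eq_getElem_cons hi
      have hacc : acc (i + 1) = step g (acc i) (l g)[i] := by
        simp only [acc]
        rw [List.take_add_one, List.foldl_append, List.getElem?_eq_getElem hi]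
        rfl
      obtain ⟨t, ht, hr⟩ := hp (g, acc i, (l g)[i])
      have hsi : s i = .cons (enc g)
          (.cons (.cons (enc (l g)[i]) (enc ((l g).drop (i + 1)))) (enc (acc i))) := by
        simp only [s, hd]
        rfl
      have hsi' : s (i + 1) = .cons (enc g) (.cons (enc ((l g).drop (i + 1)))
          (enc (step g (acc i) (l g)[i]))) := by
        simp only [s, hacc]
        rfl
      have h₁ := hsz i
      have h₃ := hsz (i + 1)
      have hT' := hT (g, acc i, (l g)[i])
      have hX : esize (g, acc i, (l g)[i]) + 1 ≤ S g + 3 := by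
        have h₄ : (s i).size = esize g + (esize (l g)[i] + esize ((l g).drop (i + 1)) + 1 +
          esize (acc i) + 1) + 1 := by rw [hsi]; rfl
        simp only [esize_prod]
        omega
      have hY : t ≤ (S g + 3) ^ c := ht.trans (hT'.trans (Nat.pow_le_pow_left hX c))
      rw [hsi, hsi']
      refine ⟨_, ?_, .cons (.head _) (.cons (.seq (.tail _) (.seq (.head _) (.tail _)))
        (.seq (.cons (.head _) (.cons (.seq (.tail _) (.tail _))
          (.seq (.tail _) (.seq (.head _) (.head _))))) hr))⟩
      rw [hsi] at h₁
      rw [hsi'] at h₃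
      simp only [Data.tail, Data.head, Data.size, C] at h₁ h₃ ⊢
      omega
    · obtain ⟨r, hr, h⟩ := hcond (l g).length
      rw [List.drop_length] at h
      exact ⟨r, hr, h⟩
  obtain ⟨t, ht, hr⟩ := key
  have hfin : (s (l g).length).tail.tail = enc ((l g).foldl (step g) (init g)) := by
    simp [s, acc, Data.tail, enc]
  have hlast : Run (.seq .tail .tail) (s (l g).length) (enc ((l g).foldl (step g) (init g)))
      ((s (l g).length).size + (s (l g).length).tail.size + 1) := by
    rw [← hfin]
    exact .seq (.tail _) (.tail _)
  refine ⟨_, ?_, .seq h₀ (.seq hr hlast)⟩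
  have h₁ := hsz (l g).length
  have h₂ : (s (l g).length).size = esize g + (s (l g).length).tail.size + 1 := rfl
  have h₃ : ((l g).length + 1) * (2 * (6 * C g) + 1) ≤ (esize (l g) + 1) * (2 * (6 * C g) + 1) :=
    Nat.mul_le_mul_right _ (by have := length_lt_esize (l g); omega)
  have h₄ : (s (l g).length).size + (s (l g).length).tail.size + 1 ≤ 6 * C g := by
    simp only [C]
    omega
  dsimp only
  omega

end

end MatchingGap

/-! ### Polynomial time for operations on lists and unary numbers -/

namespace MatchingGap

open Enc (enc)

section

variable {α β γ δ : Type*} [Enc α] [Enc β] [Enc γ] [Enc δ]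

@[fun_prop]
theorem PT.reverse {l : γ → List α} (hl : PT l) : PT fun g => (l g).reverse := by
  have h : ∀ l m : List α, l.foldl (fun acc a => a :: acc) m = l.reverse ++ m := by
    intro l
    induction l with
    | nil => simp
    | cons a l ih => intro m; simp [ih]
  have := PT.foldl (step := fun _ acc a => a :: acc) hl (.const []) (by fun_prop) hl.bd
    (fun g k => by
      rw [h, List.append_nil, esize_reverse]
      exact esize_sublist (List.take_sublist _ _))
  simpa only [h, List.append_nil] using this

@[fun_prop]
theorem PT.append {l m : γ → List α} (hl : PT l) (hm : PT m) : PT fun g => l g ++ m g := by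
  have h : ∀ l m : List α, l.foldl (fun acc a => a :: acc) m = l.reverse ++ m := by
    intro l
    induction l with
    | nil => simp
    | cons a l ih => intro m; simp [ih]
  have := PT.foldl (l := fun g => (l g).reverse) (step := fun _ acc a => a :: acc)
    (by fun_prop) hm (by fun_prop) (hl.bd.add hm.bd)
    (fun g k => by
      rw [h]
      have h₁ := esize_append ((l g).reverse.take k).reverse (m g)
      rw [esize_reverse] at h₁
      have h₂ := esize_sublist (List.take_sublist k (l g).reverse)
      rw [esize_reverse] at h₂
      omega)
  simpa only [h, List.reverse_reverse] using this

@[fun_prop]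
theorem PT.flatMap {l : γ → List α} {f : γ → α → List β} (hl : PT l)
    (hf : PT fun p : γ × α => f p.1 p.2) : PT fun g => (l g).flatMap (f g) := by
  have h : ∀ (g : γ) (l : List α) (m : List β),
      l.foldl (fun acc a => acc ++ f g a) m = m ++ l.flatMap (f g) := by
    intro g l
    induction l with
    | nil => simp
    | cons a l ih => intro m; simp [ih]
  obtain ⟨c, hc⟩ := hf.bd
  have hl' := hl.bd
  have := PT.foldl (l := l) (init := fun _ => []) (step := fun g acc a => acc ++ f g a) hl
    (.const []) (PT.append (by fun_prop) (hf.comp (f := fun p : γ × List β × α => (p.1, p.2.2))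
      (by fun_prop)))
    (B := fun g => 1 + esize (l g) * (esize g + esize (l g) + 2) ^ c) (by fun_prop)
    (fun g k => by
      rw [h, List.nil_append]
      -- Stated for all lists of entries of `l g`, so that the induction goes through; the prefixes
      -- of `l g` are a special case.
      have key : ∀ m : List α, m ⊆ l g →
          esize (m.flatMap (f g)) ≤ 1 + m.length * (esize g + esize (l g) + 2) ^ c := by
        intro m
        induction m with
        | nil => simp
        | cons a m ih =>
          intro hm
          have h₁ := ih fun x hx => hm (List.mem_cons_of_mem _ hx)
          have h₂ := hc (g, a)
          have h₃ := esize_le_of_mem (hm (List.mem_cons_self (a := a)))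
          have h₄ : (esize (g, a) + 1) ^ c ≤ (esize g + esize (l g) + 2) ^ c :=
            Nat.pow_le_pow_left (by simp only [esize_prod]; omega) c
          have h₅ := esize_append (f g a) (m.flatMap (f g))
          rw [List.flatMap_cons, List.length_cons, Nat.succ_mul]
          dsimp only at h₂
          omega
      refine (key _ (List.take_subset _ _)).trans (Nat.add_le_add_left (Nat.mul_le_mul_right _ ?_) _)
      have := length_lt_esize (l g)
      simp only [List.length_take]
      omega)
  simpa only [h, List.nil_append] using this

@[fun_prop]
theorem PT.map {l : γ → List α} {f : γ → α → β} (hl : PT l)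
    (hf : PT fun p : γ × α => f p.1 p.2) : PT fun g => (l g).map (f g) := by
  have := PT.flatMap (f := fun g a => [f g a]) hl (hf.cons (.const []))
  simpa only [← List.map_eq_flatMap] using this

@[fun_prop]
theorem PT.filter {l : γ → List α} {f : γ → α → Bool} (hl : PT l)
    (hf : PT fun p : γ × α => f p.1 p.2) : PT fun g => (l g).filter (f g) := by
  have := PT.flatMap (f := fun g a => bif f g a then [a] else []) hl
    (hf.cond (by fun_prop) (by fun_prop))
  have h : ∀ g, (l g).flatMap (fun a => bif f g a then [a] else []) = (l g).filter (f g) := by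
    intro g
    induction l g with
    | nil => rfl
    | cons a m ih => cases h : f g a <;> simp [ih, h]
  simpa only [h] using this

@[fun_prop]
theorem PT.any {l : γ → List α} {f : γ → α → Bool} (hl : PT l)
    (hf : PT fun p : γ × α => f p.1 p.2) : PT fun g => (l g).any (f g) := by
  have h : ∀ g, (!((l g).filter (f g)).isEmpty) = (l g).any (f g) := by
    intro g
    induction l g with
    | nil => rfl
    | cons a m ih => cases h : f g a <;> simp_all
  simpa only [h] using (hl.filter hf).isEmpty.not

@[fun_prop]
theorem PT.all {l : γ → List α} {f : γ → α → Bool} (hl : PT l)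
    (hf : PT fun p : γ × α => f p.1 p.2) : PT fun g => (l g).all (f g) := by
  have h : ∀ g, (!(l g).any fun a => !f g a) = (l g).all (f g) := by
    intro g
    induction l g with
    | nil => rfl
    | cons a m ih => cases h : f g a <;> simp_all
  simpa only [h] using (hl.any (f := fun g a => !f g a) hf.not).not

@[fun_prop]
theorem PT.takeWhile {l : γ → List α} {f : γ → α → Bool} (hl : PT l)
    (hf : PT fun p : γ × α => f p.1 p.2) : PT fun g => (l g).takeWhile (f g) := by
  -- The flag records that no entry has failed the test so far; once it is false, the accumulated
  -- list is frozen.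
  let step : γ → List α × Bool → α → List α × Bool := fun g acc a =>
    bif acc.2 && f g a then (acc.1 ++ [a], true) else (acc.1, false)
  have h₀ : ∀ g (l : List α) m, l.foldl (step g) (m, false) = (m, false) := by
    intro g l
    induction l with
    | nil => simp
    | cons a l ih => intro m; simp [step, ih]
  have h : ∀ g (l m : List α), (l.foldl (step g) (m, true)).1 = m ++ l.takeWhile (f g) := by
    intro g l
    induction l with
    | nil => simp
    | cons a l ih =>
      intro m
      cases ha : f g a
      · simp [step, ha, h₀]
      · have : step g (m, true) a = (m ++ [a], true) := by simp [step, ha]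
        rw [List.foldl_cons, this, ih, List.takeWhile_cons_of_pos ha]
        simp
  have hf' : PT fun p : γ × (List α × Bool) × α => f p.1 p.2.2 :=
    hf.comp (f := fun p : γ × (List α × Bool) × α => (p.1, p.2.2)) (by fun_prop)
  have := PT.foldl (l := l) (init := fun _ => ([], true)) (step := step) hl
    (.const ([], true)) (PT.cond (PT.and (by fun_prop) hf') (by fun_prop) (by fun_prop)) (B := fun g => esize (l g) + 4)
    (hl.bd.add (.const 4))
    (fun g k => by
      rw [esize_prod, h, List.nil_append]
      have h₁ := esize_sublist
        ((List.takeWhile_sublist (f g) (l := (l g).take k)).trans (List.take_sublist _ _))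
      have h₂ := esize_bool_le (((l g).take k).foldl (step g) ([], true)).2
      omega)
  simpa only [h, List.nil_append] using this.fst

omit [Enc α] in
theorem enc_length (l : List α) : enc l.length = enc (l.map fun _ => ()) := by
  rw [List.map_const']
  rfl

@[fun_prop]
theorem PT.length {l : γ → List α} (hl : PT l) : PT fun g => (l g).length :=
  (hl.map (f := fun _ _ => ()) (.const ())).of_enc_eq fun _ => enc_length _

/-- Iterating a function takes polynomial time if the sizes of the iterates are polynomially
bounded. -/
theorem PT.iterate {n : γ → ℕ} {init : γ → β} {f : γ → β → β} (hn : PT n) (hi : PT init)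
    (hf : PT fun p : γ × β => f p.1 p.2) {B : γ → ℕ} (hB : PolyBd B)
    (hb : ∀ g, ∀ k ≤ n g, esize ((f g)^[k] (init g)) ≤ B g) :
    PT fun g => (f g)^[n g] (init g) := by
  have h : ∀ g (l : List Unit) b, l.foldl (fun b _ => f g b) b = (f g)^[l.length] b := by
    intro g l
    induction l with
    | nil => simp
    | cons a l ih => intro b; simp [ih]
  have hl : PT fun g => List.replicate (n g) () := hn.of_enc_eq fun _ => rfl
  have := PT.foldl (step := fun g b _ => f g b) hl hi
    (hf.comp (f := fun p : γ × β × Unit => (p.1, p.2.1)) (by fun_prop)) hB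
    (fun g k => by
      rw [h]
      exact hb g _ ((List.length_take_le' _ _).trans (List.length_replicate ..).le))
  simpa only [h, List.length_replicate] using this

@[fun_prop]
theorem PT.drop {n : γ → ℕ} {l : γ → List α} (hn : PT n) (hl : PT l) :
    PT fun g => (l g).drop (n g) := by
  have h : ∀ k (l : List α), List.tail^[k] l = l.drop k := by
    intro k
    induction k with
    | zero => simp
    | succ k ih => intro l; rw [Function.iterate_succ_apply, ih, List.drop_tail]
  have := PT.iterate (f := fun _ => List.tail) hn hl (by fun_prop) hl.bd
    (fun g k _ => by rw [h]; exact esize_sublist (List.drop_sublist _ _))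
  simpa only [h] using this

-- Unary coding makes addition the concatenation of lists; truncated subtraction is likewise
-- `List.drop`.
@[fun_prop]
theorem PT.add {m n : γ → ℕ} (hm : PT m) (hn : PT n) : PT fun g => m g + n g := by
  have hm' : PT fun g => List.replicate (m g) () := hm.of_enc_eq fun _ => rfl
  have hn' : PT fun g => List.replicate (n g) () := hn.of_enc_eq fun _ => rfl
  simpa using (hm'.append hn').length

@[fun_prop]
theorem PT.sub {m n : γ → ℕ} (hm : PT m) (hn : PT n) : PT fun g => m g - n g := by
  have hm' : PT fun g => List.replicate (m g) () := hm.of_enc_eq fun _ => rfl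
  simpa using (hn.drop hm').length

@[fun_prop]
theorem PT.ble {m n : γ → ℕ} (hm : PT m) (hn : PT n) : PT fun g => Nat.ble (m g) (n g) := by
  have h : ∀ g, (List.replicate (m g - n g) ()).isEmpty = Nat.ble (m g) (n g) := fun g => by
    rw [Bool.eq_iff_iff]
    simp [Nat.sub_eq_zero_iff_le]
  have hd : PT fun g => List.replicate (m g - n g) () := (hm.sub hn).of_enc_eq fun _ => rfl
  simpa only [h] using hd.isEmpty

@[fun_prop]
theorem PT.range {n : γ → ℕ} (hn : PT n) : PT fun g => List.range (n g) := by
  have h : ∀ k, (fun l : List ℕ => l ++ [l.length])^[k] [] = List.range k := by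
    intro k
    induction k with
    | zero => rfl
    | succ k ih => rw [Function.iterate_succ_apply', ih, List.range_succ, List.length_range]
  have hl : PT fun g => List.replicate (n g) () := hn.of_enc_eq fun _ => rfl
  have h₂ : ∀ (l : List Unit) (b : List ℕ), l.foldl (fun b _ => b ++ [b.length]) b =
      (fun l : List ℕ => l ++ [l.length])^[l.length] b := by
    intro l
    induction l with
    | nil => simp
    | cons a l ih => intro b; simp [ih]
  have := PT.foldl (init := fun _ => []) (step := fun _ (l : List ℕ) _ => l ++ [l.length]) hl
    (.const []) (by fun_prop) (B := fun g => esize (n g) * (esize (n g) + 1) + 1)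
    (by have := hn.bd; fun_prop)
    (fun g k => by
      rw [h₂, h]
      refine (esize_le_of_forall (B := esize (n g)) fun a ha => ?_).trans ?_
      · have := List.mem_range.1 ha
        simp only [List.length_take, List.length_replicate] at this
        simp only [esize_nat]
        omega
      · refine Nat.succ_le_succ (Nat.mul_le_mul_right _ ?_)
        simp only [List.length_take, List.length_replicate, List.length_range, esize_nat]
        omega)
  simpa only [h₂, h, List.length_replicate] using this

/-- Types on which equality is decided in polynomial time. -/
class PEq (α : Type*) [Enc α] [DecidableEq α] : Prop where
  /-- the test -/
  pt : PT fun p : α × α => decide (p.1 = p.2)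

@[fun_prop]
theorem PT.eq [DecidableEq α] [PEq α] {f g : γ → α} (hf : PT f) (hg : PT g) :
    PT fun x => decide (f x = g x) := (PEq.pt (α := α)).comp (hf.pair hg)

instance : PEq ℕ where
  pt := by
    have : PT fun p : ℕ × ℕ => Nat.ble p.1 p.2 && Nat.ble p.2 p.1 := by fun_prop
    refine this.of_enc_eq fun p => congrArg _ ?_
    rw [Bool.eq_iff_iff]
    simp only [Bool.and_eq_true, decide_eq_true_eq, Nat.ble_eq]
    omega

instance [DecidableEq α] [DecidableEq β] [PEq α] [PEq β] : PEq (α × β) where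
  pt := by
    have : PT fun p : (α × β) × (α × β) => decide (p.1.1 = p.2.1) && decide (p.1.2 = p.2.2) := by
      fun_prop
    refine this.of_enc_eq fun p => congrArg _ ?_
    rw [Bool.eq_iff_iff]
    simp [Prod.ext_iff]

/-- The decidability instance is left arbitrary so that the same proof serves lists of pairs in
`PT.mem_prod`. -/
theorem PT.mem_of_decidable [DecidableEq α] [PEq α] {f : γ → α} {l : γ → List α} (hf : PT f)
    (hl : PT l) (inst : ∀ x, Decidable (f x ∈ l x)) : PT fun x => decide (f x ∈ l x) := by
  have : PT fun x => (l x).any fun a => decide (f x = a) :=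
    hl.any ((hf.comp PT.fst').eq PT.snd')
  refine this.of_enc_eq fun p => congrArg _ ?_
  rw [Bool.eq_iff_iff]
  simp

@[fun_prop]
theorem PT.mem [DecidableEq α] [PEq α] {f : γ → α} {l : γ → List α} (hf : PT f) (hl : PT l) :
    PT fun x => decide (f x ∈ l x) := hf.mem_of_decidable hl _

@[fun_prop]
theorem PT.mem_prod [DecidableEq α] [PEq α] [DecidableEq β] [PEq β] {f : γ → α × β}
    {l : γ → List (α × β)} (hf : PT f) (hl : PT l) :
    PT fun x => decide (f x ∈ l x) := hf.mem_of_decidable hl _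

end

end MatchingGap

namespace MatchingGap

/-! ### Matchings as involutions -/

section

variable {α κ : Type*}

/-- `m` is a matching of the graph with adjacency relation `E`: it exchanges the ends of the
matching edges and fixes the exposed vertices. -/
structure IsMat (E : α → α → Prop) (m : α → α) : Prop where
  invol : ∀ x, m (m x) = x
  adj : ∀ x, m x ≠ x → E x (m x)

theorem IsMat.inj {E : α → α → Prop} {m : α → α} (hm : IsMat E m) {x y : α} (h : m x = m y) :
    x = y := by
  rw [← hm.invol x, h, hm.invol]

theorem isMat_id (E : α → α → Prop) : IsMat E (fun x => x) := ⟨fun _ => rfl, fun _ h => absurd rfl h⟩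

/-- `E` is the adjacency relation of a simple graph on the vertices in `V`. -/
structure IsGraph (V : Finset α) (E : α → α → Prop) : Prop where
  symm : ∀ {x y}, E x y → E y x
  irrefl : ∀ x, ¬ E x x
  left_mem : ∀ {x y}, E x y → x ∈ V

theorem IsGraph.right_mem {V : Finset α} {E : α → α → Prop} (h : IsGraph V E) {x y : α}
    (hxy : E x y) : y ∈ V := h.left_mem (h.symm hxy)

variable [DecidableEq α]

/-- The vertices in `V` that `m` leaves exposed. -/
def exposed (V : Finset α) (m : α → α) : Finset α := V.filter fun x => m x = x

theorem mem_exposed {V : Finset α} {m : α → α} {x : α} : x ∈ exposed V m ↔ x ∈ V ∧ m x = x := by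
  simp [exposed]

-- The ones of a sum over `ZMod 2` cancel in pairs along the involution. All parity arguments below
-- rest on this.
omit [DecidableEq α] in
theorem even_card_of_involution (S : Finset α) (m : α → α) (h₁ : ∀ x ∈ S, m x ∈ S)
    (h₂ : ∀ x ∈ S, m (m x) = x) (h₃ : ∀ x ∈ S, m x ≠ x) : Even S.card := by
  have h : ∑ _x ∈ S, (1 : ZMod 2) = 0 :=
    Finset.sum_involution (fun x _ => m x) (fun _ _ => by decide) (fun x hx _ => h₃ x hx) h₁ h₂
  rw [Finset.sum_const, nsmul_one, ZMod.natCast_eq_zero_iff_even] at h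
  exact h

theorem IsMat.map_mem {V : Finset α} {E : α → α → Prop} {m : α → α} (hG : IsGraph V E)
    (hm : IsMat E m) {x : α} (hx : x ∈ V) : m x ∈ V := by
  by_cases h : m x = x
  · rwa [h]
  · exact hG.right_mem (hm.adj x h)

theorem card_exposed_parity {V : Finset α} {E : α → α → Prop} {m : α → α} (hG : IsGraph V E)
    (hm : IsMat E m) : (exposed V m).card % 2 = V.card % 2 := by
  have h : Even (V \ exposed V m).card := by
    refine even_card_of_involution _ m (fun x hx => ?_) (fun x _ => hm.invol x) fun x hx => ?_
    · simp only [Finset.mem_sdiff, mem_exposed, not_and] at hx ⊢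
      refine ⟨hm.map_mem hG hx.1, fun _ h => hx.2 hx.1 ?_⟩
      rw [hm.invol] at h
      exact h.symm
    · simp only [Finset.mem_sdiff, mem_exposed, not_and] at hx
      exact hx.2 hx.1
  have h₁ := Finset.card_sdiff_add_card_eq_card (Finset.filter_subset (fun x => m x = x) V)
  change (V \ exposed V m).card + (exposed V m).card = _ at h₁
  rw [← h₁]
  obtain ⟨k, hk⟩ := h
  omega

/-- A matching that does not have the least number of exposed vertices can be changed into one
with two more covered vertices that still covers what it covered. -/
theorem exists_augmentation {V : Finset α} {E : α → α → Prop} {m m' : α → α} (hG : IsGraph V E)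
    (hm : IsMat E m) (hm' : IsMat E m') (hlt : (exposed V m').card < (exposed V m).card) :
    ∃ n, IsMat E n ∧ exposed V n ⊆ exposed V m ∧
      (exposed V n).card + 2 = (exposed V m).card := by
  -- Among the matchings with fewer exposed vertices than `m`, one is taken that minimises a
  -- distance to `m`. Disagreement with `m` has weight 2 and being covered has weight 1: restoring
  -- an edge of `m` pays even if it covers a vertex, and deleting an edge outside `m` pays as well.
  let φ : (α → α) → α → ℕ := fun n x => (if n x = m x then 0 else 2) + (if n x = x then 0 else 1)
  obtain ⟨n, ⟨hn, hlt⟩, hmin⟩ : ∃ n, (IsMat E n ∧ (exposed V n).card < (exposed V m).card) ∧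
      ∀ n', IsMat E n' → (exposed V n').card < (exposed V m).card →
        ¬ ∑ x ∈ V, φ n' x < ∑ x ∈ V, φ n x := by
    classical
    have hex : ∃ k, ∃ n, (IsMat E n ∧ (exposed V n).card < (exposed V m).card) ∧
        ∑ x ∈ V, φ n x = k := ⟨_, m', ⟨hm', hlt⟩, rfl⟩
    obtain ⟨n, hn, hk⟩ := Nat.find_spec hex
    exact ⟨n, hn, fun n' h₁ h₂ h₃ => Nat.find_min hex (hk ▸ h₃) ⟨n', ⟨h₁, h₂⟩, rfl⟩⟩
  have hsub : exposed V n ⊆ exposed V m := by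
    intro v hv
    obtain ⟨hvV, hv⟩ := mem_exposed.1 hv
    refine mem_exposed.2 ⟨hvV, ?_⟩
    by_contra hmv
    have hne : m v ≠ v := hmv
    have hmvv : m (m v) = v := hm.invol v
    have hV' := hm.map_mem hG hvV
    by_cases hw : n (m v) = m v
    -- Both ends of the edge `v`, `m v` are exposed by `n`, so the edge can be added; each end drops
    -- from weight 2 to weight 1.
    · let n' : α → α := fun x => if x = v then m v else if x = m v then v else n x
      have hx : ∀ x, x ≠ v → x ≠ m v → n x ≠ v ∧ n x ≠ m v := fun x h₁ h₂ =>
        ⟨fun h => h₁ (by rw [← hn.invol x, h, hv]), fun h => h₂ (by rw [← hn.invol x, h, hw])⟩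
      have hn' : IsMat E n' := by
        constructor
        · intro x
          by_cases h₁ : x = v
          · simp [n', h₁, hne]
          by_cases h₂ : x = m v
          · simp [n', h₂, hne]
          have := hx x h₁ h₂
          simp [n', h₁, h₂, this.1, this.2, hn.invol]
        · intro x hxx
          by_cases h₁ : x = v
          · subst h₁
            simpa [n'] using hm.adj x hne
          by_cases h₂ : x = m v
          · subst h₂
            simpa [n', hne] using hG.symm (hm.adj v hne)
          simp only [n', h₁, h₂, if_false] at hxx ⊢
          exact hn.adj x hxx
      refine hmin n' hn' (lt_of_le_of_lt (Finset.card_le_card fun x hx => ?_) hlt) ?_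
      · rw [mem_exposed] at hx ⊢
        refine ⟨hx.1, ?_⟩
        by_cases h₁ : x = v
        · rw [h₁, hv]
        by_cases h₂ : x = m v
        · rw [h₂, hw]
        simpa [n', h₁, h₂] using hx.2
      · refine Finset.sum_lt_sum (fun x _ => ?_) ⟨v, hvV, ?_⟩
        · by_cases h₁ : x = v
          · subst h₁
            simp [φ, n', hne, hne.symm, hv]
          by_cases h₂ : x = m v
          · subst h₂
            simp [φ, n', hne, hne.symm, hmvv, hw]
          simp [φ, n', h₁, h₂]
        · simp [φ, n', hne, hne.symm, hv]
    -- Otherwise the edge from `m v` to `w` is exchanged for the edge from `v` to `m v`. The number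
    -- of exposed vertices does not grow, and `n'` is closer to `m`.
    · set w := n (m v) with hwdef
      have hnw : n w = m v := hn.invol _
      have hwv : w ≠ v := fun h => hne (by rw [← hnw, h, hv])
      have hwV : w ∈ V := hn.map_mem hG hV'
      have hmw : m w ≠ m v := fun h => hwv (hm.inj h)
      let n' : α → α := fun x =>
        if x = v then m v else if x = m v then v else if x = w then w else n x
      have hx : ∀ x, x ≠ v → x ≠ m v → x ≠ w → n x ≠ v ∧ n x ≠ m v ∧ n x ≠ w :=
        fun x h₁ h₂ h₃ => ⟨fun h => h₁ (by rw [← hn.invol x, h, hv]),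
          fun h => h₃ (by rw [← hn.invol x, h]), fun h => h₂ (by rw [← hn.invol x, h, hnw])⟩
      have hn' : IsMat E n' := by
        constructor
        · intro x
          by_cases h₁ : x = v
          · simp [n', h₁, hne]
          by_cases h₂ : x = m v
          · simp [n', h₂, hne]
          by_cases h₃ : x = w
          · simp [n', h₃, hwv, hw]
          have := hx x h₁ h₂ h₃
          simp [n', h₁, h₂, h₃, this.1, this.2.1, this.2.2, hn.invol]
        · intro x hxx
          by_cases h₁ : x = v
          · subst h₁
            simpa [n'] using hm.adj x hne
          by_cases h₂ : x = m v
          · subst h₂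
            simpa [n', hne] using hG.symm (hm.adj v hne)
          by_cases h₃ : x = w
          · simp [n', h₃, hwv, hw] at hxx
          simp only [n', h₁, h₂, h₃, if_false] at hxx ⊢
          exact hn.adj x hxx
      have hvE : v ∈ exposed V n := mem_exposed.2 ⟨hvV, hv⟩
      refine hmin n' hn' (lt_of_le_of_lt ?_ hlt) ?_
      · have hs : exposed V n' ⊆ insert w ((exposed V n).erase v) := by
          intro x hx
          rw [mem_exposed] at hx
          rw [Finset.mem_insert, Finset.mem_erase, mem_exposed]
          by_cases h₃ : x = w
          · exact .inl h₃
          by_cases h₁ : x = v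
          · exact absurd hx.2 (by simp [n', h₁, hne])
          by_cases h₂ : x = m v
          · exact absurd hx.2 (by simp [n', h₂, hne, hne.symm])
          exact .inr ⟨h₁, hx.1, by simpa [n', h₁, h₂, h₃] using hx.2⟩
        refine (Finset.card_le_card hs).trans ((Finset.card_insert_le _ _).trans ?_)
        rw [Finset.card_erase_of_mem hvE]
        have := Finset.card_pos.2 ⟨v, hvE⟩
        omega
      · refine Finset.sum_lt_sum (fun x _ => ?_) ⟨v, hvV, ?_⟩
        · by_cases h₁ : x = v
          · subst h₁
            simp [φ, n', hne, hne.symm, hv]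
          by_cases h₂ : x = m v
          · subst h₂
            simp [φ, n', hne, hne.symm, hmvv, ← hwdef, hwv, hw]
          by_cases h₃ : x = w
          · have e₁ : n' x = x := by simp [n', h₃, hwv, hw]
            have e₂ : ¬ n x = m x := by rw [h₃, hnw]; exact fun h => hmw h.symm
            have e₃ : ¬ n x = x := by rw [h₃, hnw]; exact fun h => hw h.symm
            simp only [φ, e₁, e₂, e₃, if_true, if_false]
            split <;> omega
          simp [φ, n', h₁, h₂, h₃]
        · simp [φ, n', hne, hne.symm, hv]
  refine ⟨n, hn, hsub, ?_⟩
  have hp := card_exposed_parity hG hn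
  have hp' := card_exposed_parity hG hm
  -- By parity a gain other than 2 is at least 4. Then an edge of `n` that is not in `m` can be
  -- deleted and fewer vertices than with `m` are still exposed, against minimality.
  by_contra hcard
  have hlt' : (exposed V n).card + 2 < (exposed V m).card := by omega
  obtain ⟨a, haV, hma, hna⟩ : ∃ a ∈ V, m a ≠ n a ∧ n a ≠ a := by
    obtain ⟨a, ha, ha'⟩ := Finset.exists_mem_notMem_of_card_lt_card hlt
    obtain ⟨haV, ha⟩ := mem_exposed.1 ha
    have hna : n a ≠ a := fun h => ha' (mem_exposed.2 ⟨haV, h⟩)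
    exact ⟨a, haV, by rw [ha]; exact hna.symm, hna⟩
  have hbV := hn.map_mem hG haV
  have hnna : n (n a) = a := hn.invol a
  let n' : α → α := fun x => if x = a then a else if x = n a then n a else n x
  have hn' : IsMat E n' := by
    constructor
    · intro x
      by_cases h₁ : x = a
      · simp [n', h₁]
      by_cases h₂ : x = n a
      · simp [n', h₂, hna]
      have h₃ : n x ≠ a := fun h => h₂ (by rw [← h, hn.invol])
      have h₄ : n x ≠ n a := fun h => h₁ (hn.inj h)
      simp [n', h₁, h₂, h₃, h₄, hn.invol]
    · intro x hxx
      by_cases h₁ : x = a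
      · simp [n', h₁] at hxx
      by_cases h₂ : x = n a
      · simp [n', h₂, hna] at hxx
      simp only [n', h₁, h₂, if_false] at hxx ⊢
      exact hn.adj x hxx
  refine hmin n' hn' (lt_of_le_of_lt ?_ hlt') ?_
  · have hs : exposed V n' ⊆ insert a (insert (n a) (exposed V n)) := by
      intro x hx
      rw [mem_exposed] at hx
      rw [Finset.mem_insert, Finset.mem_insert, mem_exposed]
      by_cases h₁ : x = a
      · exact .inl h₁
      by_cases h₂ : x = n a
      · exact .inr (.inl h₂)
      exact .inr (.inr ⟨hx.1, by simpa [n', h₁, h₂] using hx.2⟩)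
    exact (Finset.card_le_card hs).trans ((Finset.card_insert_le _ _).trans
      (Nat.succ_le_succ (Finset.card_insert_le _ _)))
  · have hmb : n (n a) ≠ m (n a) := fun h => hma (by
      have := congrArg m (hnna.symm.trans h)
      rwa [hm.invol] at this)
    have key : ∀ x, x = a ∨ x = n a → φ n' x < φ n x := by
      intro x hx
      have e₁ : n' x = x := by
        rcases hx with rfl | rfl <;> simp [n', hna]
      have e₂ : ¬ n x = m x := by
        rcases hx with rfl | rfl
        · exact hma.symm
        · exact hmb
      have e₃ : ¬ n x = x := by
        rcases hx with rfl | rfl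
        · exact hna
        · rw [hnna]; exact hna.symm
      simp only [φ, e₁, e₂, e₃, if_true, if_false]
      split <;> omega
    refine Finset.sum_lt_sum (fun x _ => ?_) ⟨a, haV, key a (.inl rfl)⟩
    by_cases h : x = a ∨ x = n a
    · exact (key x h).le
    · simp only [not_or] at h
      simp [φ, n', h.1, h.2]

/-- A certificate for a matching `m` to be maximum: a set `D` of vertices, divided into classes
with no edges between them, such that the exposed vertices are in `D`, the neighbours of `D`
outside `D` are matched into `D`, and each class has at most one vertex that is exposed or matched
to a vertex outside `D`. -/
structure Wit (V : Finset α) (E : α → α → Prop) (m : α → α) (D : Set α) (K : α → κ) : Prop where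
  sub : ∀ x ∈ D, x ∈ V
  exp : ∀ x ∈ V, m x = x → x ∈ D
  cls : ∀ x ∈ D, ∀ y ∈ D, E x y → K x = K y
  base : ∀ x ∈ D, ∀ y ∈ D, K x = K y → (m x = x ∨ m x ∉ D) → (m y = y ∨ m y ∉ D) → x = y
  nbr : ∀ x ∈ D, ∀ y, y ∉ D → E x y → m y ∈ D

/-- In each class with a base, every matching has a vertex that is exposed or matched to a vertex
outside `D`. -/
theorem Wit.exists_base {V : Finset α} {E : α → α → Prop} {m m' : α → α} {D : Set α} {K : α → κ}
    (h : Wit V E m D K) (hm : IsMat E m) (hm' : IsMat E m') {p : α} (hp : p ∈ D)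
    (hb : m p = p ∨ m p ∉ D) : ∃ q ∈ D, K q = K p ∧ (m' q = q ∨ m' q ∉ D) := by
  classical
  -- Let `C` be the class of `p`. If the claim fails, `m'` pairs up `C`, while `m` pairs up `C`
  -- without its only base `p`; so both `|C|` and `|C| - 1` would be even.
  by_contra! hcon
  let C : Finset α := V.filter fun x => x ∈ D ∧ K x = K p
  have hC : ∀ x, x ∈ C ↔ x ∈ D ∧ K x = K p := fun x => by
    simp only [C, Finset.mem_filter, and_iff_right_iff_imp]
    exact fun hx => h.sub x hx.1
  have h₁ : Even C.card := by
    refine even_card_of_involution C m' (fun x hx => ?_) (fun x _ => hm'.invol x) fun x hx => ?_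
    · rw [hC] at hx ⊢
      obtain ⟨h₁, h₂⟩ := hcon x hx.1 hx.2
      exact ⟨h₂, (h.cls x hx.1 _ h₂ (hm'.adj x h₁)).symm.trans hx.2⟩
    · rw [hC] at hx
      exact (hcon x hx.1 hx.2).1
  have hpC : p ∈ C := (hC p).2 ⟨hp, rfl⟩
  have h₂ : Even (C.erase p).card := by
    have hx' : ∀ x ∈ C.erase p, m x ≠ x ∧ m x ∈ D := fun x hx => by
      rw [Finset.mem_erase, hC] at hx
      by_contra hcon'
      refine hx.1 (h.base x hx.2.1 p hp hx.2.2 ?_ hb)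
      by_cases h₃ : m x = x
      · exact .inl h₃
      · exact .inr fun h₄ => hcon' ⟨h₃, h₄⟩
    refine even_card_of_involution _ m (fun x hx => ?_) (fun x _ => hm.invol x)
      fun x hx => (hx' x hx).1
    obtain ⟨h₃, h₄⟩ := hx' x hx
    rw [Finset.mem_erase, hC] at hx ⊢
    refine ⟨fun h₅ => ?_, h₄, (h.cls x hx.2.1 _ h₄ (hm.adj x h₃)).symm.trans hx.2.2⟩
    have h₆ : m p = x := by rw [← h₅, hm.invol]
    rcases hb with hb | hb
    · exact hx.1 (by rw [← h₆, hb])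
    · exact hb (h₆ ▸ hx.2.1)
  rw [Finset.card_erase_of_mem hpC] at h₂
  have := Finset.card_pos.2 ⟨p, hpC⟩
  obtain ⟨a, ha⟩ := h₁
  obtain ⟨b, hb⟩ := h₂
  omega

open Classical in
/-- The vertices outside `D` with a neighbour in `D`. -/
noncomputable def nbrs (V : Finset α) (E : α → α → Prop) (D : Set α) : Finset α :=
  V.filter fun y => y ∉ D ∧ ∃ x ∈ D, E x y

open Classical in
/-- The vertices in `D` that are exposed or matched to a vertex outside `D`. -/
noncomputable def bases (V : Finset α) (m : α → α) (D : Set α) : Finset α :=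
  V.filter fun x => x ∈ D ∧ (m x = x ∨ m x ∉ D)

/-- The map `m` fixes the exposed bases and exchanges the other bases with the outside neighbours of
`D`. -/
theorem Wit.card_bases {V : Finset α} {E : α → α → Prop} {m : α → α} {D : Set α} {K : α → κ}
    (h : Wit V E m D K) (hG : IsGraph V E) (hm : IsMat E m) :
    (bases V m D).card = (exposed V m).card + (nbrs V E D).card := by
  classical
  have : bases V m D = exposed V m ∪ (nbrs V E D).image m := by
    ext x
    simp only [bases, nbrs, Finset.mem_union, Finset.mem_image, Finset.mem_filter, mem_exposed]
    constructor
    · rintro ⟨hx, hD, hb⟩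
      by_cases hxx : m x = x
      · exact .inl ⟨hx, hxx⟩
      · exact .inr ⟨m x, ⟨hm.map_mem hG hx, hb.resolve_left hxx, x, hD, hm.adj x hxx⟩, hm.invol x⟩
    · rintro (⟨hx, hxx⟩ | ⟨y, ⟨hy, hyD, z, hz, hzy⟩, rfl⟩)
      · exact ⟨hx, h.exp x hx hxx, .inl hxx⟩
      · exact ⟨hm.map_mem hG hy, h.nbr z hz y hyD hzy, .inr (by rwa [hm.invol])⟩
  rw [this, Finset.card_union_of_disjoint, Finset.card_image_of_injective _ fun _ _ => hm.inj]
  rw [Finset.disjoint_left]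
  rintro x hx hx'
  obtain ⟨y, hy, rfl⟩ := Finset.mem_image.1 hx'
  have h₁ := (mem_exposed.1 hx).2
  rw [hm.invol] at h₁
  simp only [nbrs, Finset.mem_filter] at hy
  obtain ⟨hyV, hyD, z, hz, hzy⟩ := hy
  exact hyD (h₁ ▸ h.nbr z hz y hyD hzy)

/-- A matching with a certificate has the least number of exposed vertices. -/
theorem Wit.le_card_exposed {V : Finset α} {E : α → α → Prop} {m m' : α → α} {D : Set α}
    {K : α → κ} (h : Wit V E m D K) (hG : IsGraph V E) (hm : IsMat E m) (hm' : IsMat E m') :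
    (exposed V m).card ≤ (exposed V m').card := by
  classical
  have hb : ∀ p ∈ bases V m D, ∃ q ∈ D, K q = K p ∧ (m' q = q ∨ m' q ∉ D) := fun p hp => by
    simp only [bases, Finset.mem_filter] at hp
    exact h.exists_base hm hm' hp.2.1 hp.2.2
  choose! q hqD hqK hq using hb
  -- Each base `p` is sent to `m' (q p)`, where `q p` is a vertex of its class that `m'` exposes or
  -- matches out of `D`. This is injective, since `q p` determines the class and the class has one
  -- base.
  have hle : (bases V m D).card ≤ (exposed V m' ∪ nbrs V E D).card := by
    refine Finset.card_le_card_of_injOn (fun p => m' (q p)) (fun p hp => ?_) fun p hp p' hp' hpp => ?_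
    · simp only [Finset.coe_union, Set.mem_union, Finset.mem_coe, mem_exposed, nbrs,
        Finset.mem_filter]
      have hV := h.sub _ (hqD p hp)
      by_cases hx : m' (q p) = q p
      · exact .inl ⟨by rwa [hx], by rw [hx, hx]⟩
      · exact .inr ⟨hm'.map_mem hG hV, (hq p hp).resolve_left hx, _, hqD p hp, hm'.adj _ hx⟩
    · have h₁ := hm'.inj hpp
      have h₂ := hqK p hp
      rw [h₁, hqK p' hp'] at h₂
      simp only [bases, Finset.mem_coe, Finset.mem_filter] at hp hp'
      exact h.base p hp.2.1 p' hp'.2.1 h₂.symm hp.2.2 hp'.2.2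
  have := h.card_bases hG hm
  have := Finset.card_union_le (exposed V m') (nbrs V E D)
  omega

end

end MatchingGap

/-! ### Existence of certificates, from Tutte's theorem -/

namespace MatchingGap

section

universe v

variable {α : Type v} [DecidableEq α]

open SimpleGraph

/-- The graph on `V` joined with a complete graph on `e` new vertices. -/
def joinGraph {V : Finset α} {E : α → α → Prop} (hG : IsGraph V E) (e : ℕ) :
    SimpleGraph (V ⊕ Fin e) where
  Adj a b := a ≠ b ∧ ∀ x y, a = .inl x → b = .inl y → E x y
  symm := ⟨fun _ _ h => ⟨h.1.symm, fun x y hx hy => hG.symm (h.2 y x hy hx)⟩⟩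
  loopless := ⟨fun _ h => h.1 rfl⟩

omit [DecidableEq α] in
theorem joinGraph_adj_inl {V : Finset α} {E : α → α → Prop} (hG : IsGraph V E) {e : ℕ} {x y : V} :
    (joinGraph hG e).Adj (.inl x) (.inl y) ↔ E x y := by
  refine ⟨fun h => h.2 x y rfl rfl, fun h => ⟨fun hxy => ?_, ?_⟩⟩
  · rw [Sum.inl.inj hxy] at h
    exact hG.irrefl _ h
  · rintro a b ha hb
    rwa [← Sum.inl.inj ha, ← Sum.inl.inj hb]

/-- Restricting a perfect matching of the join to `V` exposes only the partners of new vertices,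
hence at most `e` vertices. -/
theorem joinGraph_no_perfect {V : Finset α} {E : α → α → Prop} (hG : IsGraph V E) {e : ℕ}
    (he : ∀ m, IsMat E m → e < (exposed V m).card) (M : (joinGraph hG e).Subgraph) :
    ¬ M.IsPerfectMatching := by
  classical
  intro hM
  rw [Subgraph.isPerfectMatching_iff] at hM
  choose f hf hu using hM
  have hff : ∀ a, f (f a) = a := fun a => (hu (f a) a (hf a).symm).symm
  have hfn : ∀ a, f a ≠ a := fun a h => M.loopless.irrefl a (by have := hf a; rwa [h] at this)
  let m : α → α := fun x => if h : x ∈ V then Sum.elim (fun y : V => (y : α)) (fun _ : Fin e => x) (f (.inl ⟨x, h⟩))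
    else x
  have hm₁ : ∀ x (hx : x ∈ V) (y : V), f (.inl ⟨x, hx⟩) = .inl y → m x = y := fun x hx y h => by
    simp [m, hx, h]
  have hm₂ : ∀ x (hx : x ∈ V) j, f (.inl ⟨x, hx⟩) = .inr j → m x = x := fun x hx j h => by
    simp [m, hx, h]
  have hm : IsMat E m := by
    constructor
    · intro x
      by_cases hx : x ∈ V
      · rcases h : f (.inl ⟨x, hx⟩) with y | j
        · rw [hm₁ x hx y h]
          exact hm₁ y y.2 ⟨x, hx⟩ (by rw [← h, hff])
        · rw [hm₂ x hx j h, hm₂ x hx j h]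
      · simp [m, hx]
    · intro x hxx
      by_cases hx : x ∈ V
      · rcases h : f (.inl ⟨x, hx⟩) with y | j
        · rw [hm₁ x hx y h]
          have := (hf (.inl ⟨x, hx⟩)).adj_sub
          rw [h, joinGraph_adj_inl] at this
          exact this
        · exact absurd (hm₂ x hx j h) hxx
      · exact absurd (by simp [m, hx]) hxx
  have hlt := he m hm
  have hj : ∀ x ∈ exposed V m, ∃ j : Fin e, ∃ hx : x ∈ V, f (.inl ⟨x, hx⟩) = .inr j := by
    intro x hx
    obtain ⟨hx, hxx⟩ := mem_exposed.1 hx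
    rcases h : f (.inl ⟨x, hx⟩) with y | j
    · rw [hm₁ x hx y h] at hxx
      exact absurd (h.trans (congrArg _ (Subtype.ext hxx))) (hfn _)
    · exact ⟨j, hx, h⟩
  have := Finset.card_le_card_of_injOn (s := exposed V m)
    (t := Finset.univ.image fun j : Fin e => some (Sum.inr j : V ⊕ Fin e))
    (fun x => if h : x ∈ V then some (f (.inl ⟨x, h⟩)) else none) (fun x hx => by
      obtain ⟨j, hxV, h⟩ := hj x hx
      simp [hxV, h]) fun x hx y hy hxy => by
      simp only [dif_pos (mem_exposed.1 hx).1, dif_pos (mem_exposed.1 hy).1,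
        Option.some.injEq] at hxy
      have h₂ := congrArg f hxy
      rw [hff, hff] at h₂
      simpa using h₂
  have h' := Finset.card_image_le (s := Finset.univ)
    (f := fun j : Fin e => some (Sum.inr j : V ⊕ Fin e))
  simp only [Finset.card_univ, Fintype.card_fin] at h'
  omega

/-- A matching with the least number of exposed vertices has a certificate. -/
theorem exists_wit {V : Finset α} {E : α → α → Prop} (hG : IsGraph V E) {m : α → α}
    (hm : IsMat E m) (hmin : ∀ m', IsMat E m' → (exposed V m).card ≤ (exposed V m').card) :
    ∃ (κ : Type v) (D : Set α) (K : α → κ), Wit V E m D K := by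
  classical
  -- Deficiencies 0 and 1 are treated directly, with `D` empty and with `D = V` as a single class,
  -- because the main argument adds `d - 2` new vertices, `d` being the deficiency.
  rcases Nat.lt_or_ge (exposed V m).card 2 with hd | hd
  · rcases Nat.eq_zero_or_pos (exposed V m).card with hd₀ | hd₀
    · refine ⟨PUnit, ∅, fun _ => ⟨⟩, ?_⟩
      constructor
      · simp
      · intro x hx hxx
        rw [Finset.card_eq_zero] at hd₀
        exact absurd (mem_exposed.2 ⟨hx, hxx⟩) (by simp [hd₀])
      all_goals simp
    · refine ⟨PUnit, V, fun _ => ⟨⟩, ?_⟩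
      constructor
      · simp
      · simp +contextual
      · simp
      · have hb : ∀ x ∈ V, (m x = x ∨ m x ∉ (V : Set α)) → x ∈ exposed V m := fun x hx h =>
          mem_exposed.2 ⟨hx, h.resolve_right fun h => h (hm.map_mem hG hx)⟩
        intro x hx y hy _ hxb hyb
        exact Finset.card_le_one.1 (by omega) x (hb x hx hxb) y (hb y hy hyb)
      · intro x _ y hy hxy
        exact absurd (hG.right_mem hxy) hy
  obtain ⟨e, he⟩ : ∃ e, (exposed V m).card = e + 2 := ⟨_, (Nat.sub_add_cancel hd).symm⟩
  have hno : ¬ ∃ M : (joinGraph hG e).Subgraph, M.IsPerfectMatching := fun ⟨M, hM⟩ =>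
    joinGraph_no_perfect hG (fun m' hm' => by have := hmin m' hm'; omega) M hM
  rw [tutte] at hno
  push Not at hno
  obtain ⟨u, hu⟩ := hno
  unfold IsTutteViolator at hu
  set Hu := ((⊤ : (joinGraph hG e).Subgraph).deleteVerts u).coe with hHu
  have hverts : ∀ {x}, x ∈ ((⊤ : (joinGraph hG e).Subgraph).deleteVerts u).verts ↔ x ∉ u := by
    simp
  have hadj : ∀ {x y} (hx : x ∉ u) (hy : y ∉ u), (joinGraph hG e).Adj x y →
      Hu.connectedComponentMk ⟨x, hverts.2 hx⟩ = Hu.connectedComponentMk ⟨y, hverts.2 hy⟩ := by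
    intro x y hx hy hxy
    refine ConnectedComponent.sound (Adj.reachable ?_)
    simp [hHu, hx, hy, hxy]
  have hcardV : Nat.card (V ⊕ Fin e) = V.card + e := by simp
  have hodd : Odd Hu.oddComponents.ncard ↔ Odd (V.card + e - u.ncard) := by
    rw [odd_ncard_oddComponents, Nat.card_coe_set_eq, Subgraph.deleteVerts_verts,
      Subgraph.verts_top, ← Set.compl_eq_univ_sdiff, Set.ncard_compl, hcardV]
  have hule : u.ncard ≤ V.card + e := by
    rw [← hcardV]; exact Set.ncard_le_card u
  have hpar : (exposed V m).card % 2 = V.card % 2 := card_exposed_parity hG hm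
  -- A Tutte violator has an excess of at least 1, and the number of odd components has the parity
  -- of `|u|`, so the excess is at least 2.
  have hge : u.ncard + 2 ≤ Hu.oddComponents.ncard := by
    by_contra hcon
    have h₁ : Hu.oddComponents.ncard = u.ncard + 1 := by omega
    rw [h₁, Nat.odd_iff, Nat.odd_iff] at hodd
    omega
  -- A new vertex outside `u` is adjacent to everything, so there would be at most one component,
  -- but there are at least two odd ones.
  have hinr : ∀ j, Sum.inr j ∈ u := by
    intro j
    by_contra hj
    have h₁ : ∀ c : Hu.ConnectedComponent, c = Hu.connectedComponentMk ⟨.inr j, hverts.2 hj⟩ := by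
      intro c
      induction c using ConnectedComponent.ind with
      | h a =>
        obtain ⟨a, ha⟩ := a
        by_cases haj : a = .inr j
        · subst haj; rfl
        · exact hadj (hverts.1 ha) hj ⟨haj, fun _ _ _ h => by cases h⟩
    have h₂ : Hu.oddComponents.ncard ≤ 1 := by
      refine (Set.ncard_le_one).2 fun c _ c' _ => ?_
      rw [h₁ c, h₁ c']
    omega
  let K : α → Option Hu.ConnectedComponent := fun x =>
    if h : ∃ hx : x ∈ V, Sum.inl ⟨x, hx⟩ ∉ u then
      some (Hu.connectedComponentMk ⟨.inl ⟨x, h.1⟩, hverts.2 h.2⟩) else none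
  have hK : ∀ {x} (hx : x ∈ V) (hxu : Sum.inl ⟨x, hx⟩ ∉ u),
      K x = some (Hu.connectedComponentMk ⟨.inl ⟨x, hx⟩, hverts.2 hxu⟩) := fun {x} hx hxu => by
    have h : ∃ hx : x ∈ V, Sum.inl ⟨x, hx⟩ ∉ u := ⟨hx, hxu⟩
    simp only [K, dif_pos h]
  have hK' : ∀ {x c}, K x = some c → ∃ hx : x ∈ V, Sum.inl ⟨x, hx⟩ ∉ u := fun {x c} h => by
    by_contra hcon
    simp only [K, dif_neg hcon] at h
    cases h
  have hKE : ∀ {x y c}, K x = some c → E x y → (∀ hy : y ∈ V, Sum.inl ⟨y, hy⟩ ∉ u) →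
      K y = some c := fun {x y c} hx hxy hy => by
    obtain ⟨hxV, hxu⟩ := hK' hx
    have hyV := hG.right_mem hxy
    rw [hK hxV hxu] at hx
    rw [hK hyV (hy hyV), ← hx, hadj hxu (hy hyV) ((joinGraph_adj_inl hG).2 hxy)]
  -- The old vertices in `u`. As `|u| = |A| + e`, there are at least `|A| + d` odd components, with
  -- `d = e + 2` the deficiency.
  let A : Finset α := V.filter fun x => ∃ hx : x ∈ V, Sum.inl ⟨x, hx⟩ ∈ u
  have hA : A.card + e = u.ncard := by
    have h₁ : u = (fun x : V => (Sum.inl x : V ⊕ Fin e)) '' {x | Sum.inl x ∈ u} ∪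
        Set.range (Sum.inr : Fin e → V ⊕ Fin e) := by
      ext x
      rcases x with x | j
      · simp
      · simp [hinr]
    have h₂ : ({x : V | Sum.inl x ∈ u} : Set V).ncard = A.card := by
      rw [← Set.ncard_image_of_injective _ Subtype.val_injective, ← Set.ncard_coe_finset]
      congr 1
      ext x
      simp [A]
    rw [h₁, Set.ncard_union_eq, Set.ncard_image_of_injective _ Sum.inl_injective, h₂,
      ← Set.image_univ, Set.ncard_image_of_injective _ Sum.inr_injective]
    · simp
    · rw [Set.disjoint_left]
      rintro _ ⟨x, _, rfl⟩ ⟨j, hj⟩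
      cases hj
  -- An odd component cannot be paired up internally by `m`, and an edge that leaves it must end in
  -- `u`.
  have hbase : ∀ c ∈ Hu.oddComponents, ∃ b, K b = some c ∧
      (b ∈ exposed V m ∨ m b ∈ A) := by
    intro c hc
    by_contra! hcon
    let C : Finset α := V.filter fun x => K x = some c
    have hC : ∀ x, x ∈ C ↔ K x = some c := fun x => by
      simp only [C, Finset.mem_filter, and_iff_right_iff_imp]
      exact fun h => (hK' h).1
    have h₁ : C.card = c.supp.ncard := by
      rw [← Set.ncard_coe_finset]
      refine Set.ncard_congr (fun x hx => ⟨.inl ⟨x, (hK' ((hC x).1 hx)).1⟩,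
        hverts.2 (hK' ((hC x).1 hx)).2⟩) (fun x hx => ?_) (fun x y hx hy h => ?_) fun b hb => ?_
      · have h₂ := (hC x).1 hx
        obtain ⟨h₃, h₄⟩ := hK' h₂
        rw [hK h₃ h₄] at h₂
        exact Option.some.inj h₂
      · simpa using h
      · obtain ⟨x | j, hb'⟩ := b
        · refine ⟨x, ?_, rfl⟩
          change (x : α) ∈ C
          rw [hC, hK x.2 (hverts.1 hb')]
          exact congrArg _ hb
        · exact absurd (hinr j) (hverts.1 hb')
    have h₂ : Even C.card := by
      have hx' : ∀ x ∈ C, m x ≠ x := fun x hx h => by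
        rw [hC] at hx
        exact (hcon x hx).1 (mem_exposed.2 ⟨(hK' hx).1, h⟩)
      refine even_card_of_involution C m (fun x hx => ?_) (fun x _ => hm.invol x) hx'
      have h₂ := hx' x hx
      rw [hC] at hx ⊢
      refine hKE hx (hm.adj x h₂) fun hy hyu => (hcon x hx).2 ?_
      exact Finset.mem_filter.2 ⟨hy, hy, hyu⟩
    rw [h₁] at h₂
    exact absurd hc (by simpa using h₂)
  have hne : Nonempty α := by
    obtain ⟨x, _⟩ := Finset.card_pos.1 (show 0 < (exposed V m).card by omega)
    exact ⟨x⟩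
  choose! b hbK hb using hbase
  let ψ : Hu.ConnectedComponent → α := fun c => if m (b c) = b c then b c else m (b c)
  have hψm : ∀ c, ψ c = m (b c) := fun c => by
    simp only [ψ]
    split
    · next h => exact h.symm
    · rfl
  let O : Finset Hu.ConnectedComponent := Hu.oddComponents.toFinite.toFinset
  have hO : ∀ c, c ∈ O ↔ c ∈ Hu.oddComponents := fun c => Set.Finite.mem_toFinset _
  have hOcard : O.card = Hu.oddComponents.ncard := (Set.ncard_eq_toFinset_card _ _).symm
  -- The map `ψ` is injective on the odd components, and there are at least as many of these as
  -- elements of the target. So it is onto: the chosen vertices `b c` account for all exposed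
  -- vertices and all mates of `A`, and no odd component has a second base.
  have himg : O.image ψ = exposed V m ∪ A := by
    refine Finset.eq_of_subset_of_card_le (fun x hx => ?_) ?_
    · obtain ⟨c, hc, rfl⟩ := Finset.mem_image.1 hx
      rw [Finset.mem_union]
      rcases hb c ((hO c).1 hc) with h | h
      · left
        rwa [hψm, (mem_exposed.1 h).2]
      · right
        rwa [hψm]
    · rw [Finset.card_image_of_injOn, hOcard]
      · have := Finset.card_union_le (exposed V m) A
        omega
      · intro c hc c' hc' h
        simp only [hψm] at h
        have h₁ := hbK c ((hO c).1 hc)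
        rw [hm.inj h, hbK c' ((hO c').1 hc')] at h₁
        exact (Option.some.inj h₁).symm
  have hψ : ∀ x, x ∈ exposed V m ∨ x ∈ A → ∃ c ∈ Hu.oddComponents, m x = b c := by
    intro x hx
    rw [← Finset.mem_union, ← himg, Finset.mem_image] at hx
    obtain ⟨c, hc, rfl⟩ := hx
    exact ⟨c, (hO c).1 hc, by rw [hψm, hm.invol]⟩
  have hout : ∀ {x y c}, c ∈ Hu.oddComponents → K x = some c → E x y →
      y ∉ {x | ∃ c ∈ Hu.oddComponents, K x = some c} → y ∈ A := by
    intro x y c hc hx hxy hy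
    by_contra hyA
    refine hy ⟨c, hc, hKE hx hxy fun hyV hyu => hyA ?_⟩
    exact Finset.mem_filter.2 ⟨hyV, hyV, hyu⟩
  -- The set `D` is the union of the odd components, and these are its classes.
  refine ⟨_, {x | ∃ c ∈ Hu.oddComponents, K x = some c}, K, ?_⟩
  have hbases : ∀ {x c}, c ∈ Hu.oddComponents → K x = some c →
      (m x = x ∨ m x ∉ {x | ∃ c ∈ Hu.oddComponents, K x = some c}) → x = b c := by
    intro x c hc hx hbx
    have h₁ : ∃ c' ∈ Hu.oddComponents, x = b c' := by
      by_cases hxx : m x = x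
      · obtain ⟨c', hc', h⟩ := hψ x (.inl (mem_exposed.2 ⟨(hK' hx).1, hxx⟩))
        exact ⟨c', hc', by rw [← h, hxx]⟩
      · obtain ⟨c', hc', h⟩ := hψ (m x)
          (.inr (hout hc hx (hm.adj x hxx) (hbx.resolve_left hxx)))
        exact ⟨c', hc', by rw [← h, hm.invol]⟩
    obtain ⟨c', hc', rfl⟩ := h₁
    rw [hbK c' hc'] at hx
    rw [Option.some.inj hx]
  constructor
  · rintro x ⟨c, _, hx⟩
    exact (hK' hx).1
  · intro x hx hxx
    obtain ⟨c, hc, h⟩ := hψ x (.inl (mem_exposed.2 ⟨hx, hxx⟩))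
    exact ⟨c, hc, by rw [← hxx, h]; exact hbK c hc⟩
  · rintro x ⟨c, _, hx⟩ y ⟨c', _, hy⟩ hxy
    rw [hx]
    exact (hKE hx hxy fun hyV hyu => (hK' hy).2 hyu).symm
  · rintro x ⟨c, hc, hx⟩ y ⟨c', hc', hy⟩ hxy hbx hby
    rw [hx, hy] at hxy
    rw [hbases hc hx hbx, hbases hc' hy hby, Option.some.inj hxy]
  · rintro x ⟨c, hc, hx⟩ y hy hxy
    obtain ⟨c', hc', h⟩ := hψ y (.inr (hout hc hx hxy hy))
    exact ⟨c', hc', by rw [h]; exact hbK c' hc'⟩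

end

end MatchingGap

namespace MatchingGap

/-! ### Computing a maximum matching -/

section

universe v

variable {α : Type v} [DecidableEq α]

/-- The vertices exposed by the matching with list of arcs `M`. -/
def expL (V : List α) (M : List (α × α)) : List α :=
  V.filter fun v => !(M.any fun e => decide (e.1 = v))

/-- One round of breadth-first search in the graph induced by `D`. -/
def reachStep (E : List (α × α)) (D S : List α) : List α :=
  D.filter fun x => decide (x ∈ S) || S.any fun y => decide ((y, x) ∈ E)

/-- The component of `v` in the graph induced by `D`. -/
def reachL (E : List (α × α)) (D : List α) (v : α) : List α :=
  (reachStep E D)^[D.length] (D.filter fun x => decide (x = v))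

/-- Whether `u` and `v` are in the same component of the graph induced by `D`. -/
def conn (E : List (α × α)) (D : List α) (u v : α) : Bool := decide (v ∈ reachL E D u)

/-- Whether the component of `x` in the graph induced by `D` has a vertex before `x` in `D`. -/
def earlier (E : List (α × α)) (D : List α) (x : α) : Bool :=
  (D.takeWhile fun y => !decide (y = x)).any fun p => conn E D p x

/-- Whether the head of the arc `a` of the matching is to be added to the search list `D`. -/
def canGrow (E : List (α × α)) (D : List α) (a : α × α) : Bool :=
  !decide (a.2 ∈ D) && bif decide (a.1 ∈ D) then earlier E D a.1
    else D.any fun v => decide ((v, a.1) ∈ E)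

/-- One step of the search for an augmentation. -/
def growStep (E M : List (α × α)) (D : List α) : List α :=
  D ++ ((M.filter (canGrow E D)).map fun a => a.2).take 1

/-- The final search list. -/
def growL (V : List α) (E M : List (α × α)) : List α := (growStep E M)^[V.length] (expL V M)

/-- Whether each component of the graph induced by `D` has at most one exposed vertex. -/
def checkL (E M : List (α × α)) (D : List α) : Bool :=
  D.all fun x => (M.any fun e => decide (e.1 = x)) || !(earlier E D x)

/-- Whether `M` is a maximum matching. -/
def isMaxL (V : List α) (E M : List (α × α)) : Bool := checkL E M (growL V E M)

/-- Removal of an edge. -/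
def delEdge (e : α × α) (E : List (α × α)) : List (α × α) :=
  E.filter fun f => !decide (f = e) && !decide (f = (e.2, e.1))

/-- Removal of an edge if `M` stays a matching that is not maximum. -/
def thinStep (V : List α) (M E' : List (α × α)) (e : α × α) : List (α × α) :=
  bif !decide (e ∈ M) && !(isMaxL V (delEdge e E') M) then delEdge e E' else E'

/-- A minimal set of edges containing `M` in which `M` is not a maximum matching. -/
def thin (V : List α) (E M : List (α × α)) : List (α × α) := E.foldl (thinStep V M) E

/-- The edges of `E'` outside `M`, with the edges of `M` that are disjoint from them. -/
def augL (E M E' : List (α × α)) : List (α × α) :=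
  E.filter fun e => bif decide (e ∈ M) then
    !(E'.any fun f => !decide (f ∈ M) && (decide (f.1 = e.1) || decide (f.1 = e.2)))
    else decide (e ∈ E')

/-- Replacing a matching by a larger one, unless it is maximum. -/
def maxStep (V : List α) (E M : List (α × α)) : List (α × α) :=
  bif isMaxL V E M then M else augL E M (thin V E M)

/-- A maximum matching. -/
def maxL (V : List α) (E : List (α × α)) : List (α × α) := (maxStep V E)^[V.length] []

/-- An iteration that increases a bounded quantity reaches a fixed point. -/
theorem iterate_fixed {β : Type*} {f : β → β} {P : β → Prop} {μ : β → ℕ} {N : ℕ}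
    (hP : ∀ b, P b → P (f b)) (hN : ∀ b, P b → μ b ≤ N) (hμ : ∀ b, P b → f b ≠ b → μ b < μ (f b))
    {b : β} (hb : P b) : f (f^[N] b) = f^[N] b := by
  have hPk : ∀ k, P (f^[k] b) := fun k => by
    induction k with
    | zero => exact hb
    | succ k ih => rw [Function.iterate_succ_apply']; exact hP _ ih
  by_contra hcon
  have hk : ∀ k ≤ N, f (f^[k] b) ≠ f^[k] b := by
    intro k hk h
    have : ∀ j, f^[j] (f^[k] b) = f^[k] b := fun j => Function.iterate_fixed h j
    have h₂ := this (N - k)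
    rw [← Function.iterate_add_apply, Nat.sub_add_cancel hk] at h₂
    exact hcon (by rw [h₂, h])
  have hlt : ∀ k ≤ N + 1, k ≤ μ (f^[k] b) := by
    intro k
    induction k with
    | zero => simp
    | succ k ih =>
      intro hkN
      rw [Function.iterate_succ_apply']
      have h₁ := hμ _ (hPk k) (hk k (by omega))
      have h₂ := ih (by omega)
      omega
  have h₁ := hlt (N + 1) le_rfl
  have h₂ := hN _ (hPk (N + 1))
  omega

theorem iterate_induction {β : Type*} {f : β → β} {P : β → Prop} (hP : ∀ b, P b → P (f b)) {b : β}
    (hb : P b) (k : ℕ) : P (f^[k] b) := by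
  induction k with
  | zero => exact hb
  | succ k ih => rw [Function.iterate_succ_apply']; exact hP _ ih

/-- The relation given by a list of arcs. -/
def rel (E : List (α × α)) (x y : α) : Prop := (x, y) ∈ E

/-- Adjacency in the graph induced by `D`. -/
def relOn (E : List (α × α)) (D : List α) (x y : α) : Prop := x ∈ D ∧ y ∈ D ∧ (x, y) ∈ E

theorem conn_iff {E : List (α × α)} {D : List α} {u v : α} :
    conn E D u v = true ↔ u ∈ D ∧ Relation.ReflTransGen (relOn E D) u v := by
  -- `P S` says that `S` is listed in the order of `D`. Such lists with the same length, one
  -- containing the other, are equal, so each round that changes `S` makes it longer.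
  let P : List α → Prop := fun S => S = D.filter fun x => decide (x ∈ S)
  have hP : ∀ q : α → Bool, P (D.filter q) := fun q => by
    refine List.filter_congr fun x hx => ?_
    simp [hx]
  have hsub : ∀ S, P S → S.Sublist (reachStep E D S) := fun S hS => by
    conv_lhs => rw [hS]
    refine List.monotone_filter_right _ fun x hx => ?_
    simp_all
  have hfix : reachStep E D (reachL E D u) = reachL E D u := by
    refine iterate_fixed (f := reachStep E D) (b := D.filter fun x => decide (x = u)) (N := D.length)
      (P := P) (μ := List.length) (fun S _ => hP _) (fun S hS => ?_)
      (fun S hS hne => ?_) (hP _)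
    · rw [hS]; exact List.length_filter_le _ _
    · have h₁ := (hsub S hS).length_le
      refine lt_of_le_of_ne h₁ fun h₂ => hne ?_
      exact ((hsub S hS).eq_of_length h₂).symm
  have hsubD : ∀ x ∈ reachL E D u, x ∈ D := fun x hx => by
    rw [← hfix, reachStep, List.mem_filter] at hx
    exact hx.1
  rw [conn, decide_eq_true_eq]
  constructor
  · have : ∀ x ∈ reachL E D u, u ∈ D ∧ Relation.ReflTransGen (relOn E D) u x := by
      refine iterate_induction (P := fun S => ∀ x ∈ S, u ∈ D ∧ Relation.ReflTransGen (relOn E D) u x)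
        (fun S hS x hx => ?_) (fun x hx => ?_) _
      · rw [reachStep, List.mem_filter] at hx
        simp only [Bool.or_eq_true, decide_eq_true_eq, List.any_eq_true] at hx
        obtain ⟨hxD, hx | ⟨y, hy, hyx⟩⟩ := hx
        · exact hS x hx
        · obtain ⟨h₁, h₂⟩ := hS y hy
          refine ⟨h₁, h₂.tail ⟨?_, hxD, hyx⟩⟩
          rcases Relation.ReflTransGen.cases_tail h₂ with h | ⟨z, _, h⟩
          · rwa [h]
          · exact h.2.1
      · simp only [List.mem_filter, decide_eq_true_eq] at hx
        rw [← hx.2]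
        exact ⟨hx.1, .refl⟩
    exact this v
  · rintro ⟨hu, h⟩
    induction h with
    | refl =>
      refine iterate_induction (P := fun S => P S ∧ u ∈ S)
        (fun S hS => ⟨hP _, (hsub S hS.1).subset hS.2⟩) ⟨hP _, ?_⟩ _ |>.2
      simpa using hu
    | tail _ h ih =>
      rw [← hfix, reachStep, List.mem_filter]
      refine ⟨h.2.1, ?_⟩
      simp only [Bool.or_eq_true, decide_eq_true_eq, List.any_eq_true]
      exact .inr ⟨_, ih, h.2.2⟩

/-- Components are finer than any classes without edges between them. This compares the search with
an arbitrary certificate. -/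
theorem conn_class {κ : Type*} {E : List (α × α)} {D : List α} {K : α → κ}
    (hK : ∀ x ∈ D, ∀ y ∈ D, (x, y) ∈ E → K x = K y) {u v : α} (h : conn E D u v = true) :
    K u = K v := by
  have h' := (conn_iff.1 h).2
  clear h
  induction h' with
  | refl => rfl
  | tail _ h ih => exact ih.trans (hK _ h.1 _ h.2.1 h.2.2)

theorem conn_symm {E : List (α × α)} (hE : ∀ x y, (x, y) ∈ E → (y, x) ∈ E) {D : List α} {u v : α}
    (h : conn E D u v = true) : conn E D v u = true := by
  rw [conn_iff] at h ⊢
  constructor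
  · rcases Relation.ReflTransGen.cases_tail h.2 with h' | ⟨z, _, h'⟩
    · rw [h']; exact h.1
    · exact h'.2.1
  · have : Std.Symm (relOn E D) := ⟨fun x y h => ⟨h.2.1, h.1, hE _ _ h.2.2⟩⟩
    exact symm h.2

theorem conn_trans {E : List (α × α)} {D : List α} {u v w : α} (h : conn E D u v = true)
    (h' : conn E D v w = true) : conn E D u w = true := by
  rw [conn_iff] at *
  exact ⟨h.1, h.2.trans h'.2⟩

theorem conn_refl {E : List (α × α)} {D : List α} {u : α} (h : u ∈ D) : conn E D u u = true :=
  conn_iff.2 ⟨h, .refl⟩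

theorem mem_takeWhile_ne_or {l : List α} {x y : α} (hx : x ∈ l) (hy : y ∈ l) (hxy : x ≠ y) :
    x ∈ l.takeWhile (fun z => !decide (z = y)) ∨ y ∈ l.takeWhile (fun z => !decide (z = x)) := by
  induction l with
  | nil => simp at hx
  | cons a l ih =>
    by_cases hax : a = x
    · subst hax
      left
      simp [hxy]
    · by_cases hay : a = y
      · subst hay
        right
        simp [hax]
      · have := ih (by grind) (by grind)
        simp [hax, hay]
        tauto

theorem takeWhile_ne_append {l m : List α} {x : α} (hx : x ∈ l) :
    (l ++ m).takeWhile (fun z => !decide (z = x)) = l.takeWhile (fun z => !decide (z = x)) := by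
  induction l with
  | nil => simp at hx
  | cons a l ih =>
    by_cases hax : a = x
    · simp [hax]
    · simp [hax, ih (by grind)]

theorem takeWhile_ne_concat {l : List α} {x : α} (hx : x ∉ l) :
    (l ++ [x]).takeWhile (fun z => !decide (z = x)) = l := by
  induction l with
  | nil => simp
  | cons a l ih =>
    have : a ≠ x := by grind
    simp [this, ih (by grind)]

theorem earlier_iff {E : List (α × α)} {D : List α} {x : α} : earlier E D x = true ↔
    ∃ p ∈ D.takeWhile (fun z => !decide (z = x)), conn E D p x = true := by
  rw [earlier, List.any_eq_true]

/-- The list `M` consists of the arcs of the matching `m`. -/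
def ArcsOf (M : List (α × α)) (m : α → α) : Prop := ∀ x y, (x, y) ∈ M ↔ m x = y ∧ x ≠ y

theorem ArcsOf.any_iff {M : List (α × α)} {m : α → α} (hM : ArcsOf M m) {x : α} :
    (M.any fun e => decide (e.1 = x)) = true ↔ m x ≠ x := by
  simp only [List.any_eq_true, decide_eq_true_eq, Prod.exists]
  constructor
  · rintro ⟨a, b, h, rfl⟩
    obtain ⟨h₁, h₂⟩ := (hM a b).1 h
    rw [h₁]; exact h₂.symm
  · intro h
    exact ⟨x, m x, (hM _ _).2 ⟨rfl, h.symm⟩, rfl⟩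

theorem ArcsOf.mem_expL {V : List α} {M : List (α × α)} {m : α → α} (hM : ArcsOf M m) {x : α} :
    x ∈ expL V M ↔ x ∈ V ∧ m x = x := by
  rw [expL, List.mem_filter, Bool.not_eq_true', ← Bool.not_eq_true, hM.any_iff, not_not]

theorem canGrow_iff {E : List (α × α)} {D : List α} {x y : α} : canGrow E D (x, y) = true ↔
    y ∉ D ∧ ((x ∈ D ∧ earlier E D x = true) ∨ (x ∉ D ∧ ∃ v ∈ D, (v, x) ∈ E)) := by
  by_cases h : x ∈ D <;> simp [canGrow, h]

theorem growStep_cases (E M : List (α × α)) (D : List α) :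
    (growStep E M D = D ∧ ∀ a ∈ M, canGrow E D a = false) ∨
      ∃ a ∈ M, canGrow E D a = true ∧ growStep E M D = D ++ [a.2] := by
  rw [growStep]
  rcases h : M.filter (canGrow E D) with _ | ⟨a, l⟩
  · left
    rw [List.filter_eq_nil_iff] at h
    simpa using h
  · right
    have ha : a ∈ M.filter (canGrow E D) := by rw [h]; simp
    rw [List.mem_filter] at ha
    exact ⟨a, ha.1, ha.2, by simp⟩

section

variable {V : List α} {E M : List (α × α)} {m : α → α}

omit [DecidableEq α] in
theorem ArcsOf.mem_symm (hM : ArcsOf M m) (hm : IsMat (rel E) m) {x y : α} (h : (x, y) ∈ M) :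
    (y, x) ∈ M := by
  obtain ⟨rfl, h₂⟩ := (hM _ _).1 h
  exact (hM _ _).2 ⟨hm.invol _, h₂.symm⟩

omit [DecidableEq α] in
theorem ArcsOf.mem_edges (hM : ArcsOf M m) (hm : IsMat (rel E) m) {x y : α} (h : (x, y) ∈ M) :
    (x, y) ∈ E := by
  obtain ⟨rfl, h₂⟩ := (hM _ _).1 h
  exact hm.adj _ h₂.symm

/-- The properties of the search list. -/
theorem growL_spec (hV : V.Nodup) (hG : IsGraph V.toFinset (rel E)) (hm : IsMat (rel E) m)
    (hM : ArcsOf M m) : (growL V E M).Nodup ∧ (∀ x ∈ growL V E M, x ∈ V) ∧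
      (∀ x ∈ expL V M, x ∈ growL V E M) ∧ ∀ a ∈ M, canGrow E (growL V E M) a = false := by
  let P : List α → Prop := fun D => D.Nodup ∧ (∀ x ∈ D, x ∈ V) ∧ ∀ x ∈ expL V M, x ∈ D
  have hP : ∀ D, P D → P (growStep E M D) := by
    rintro D ⟨h₁, h₂, h₃⟩
    rcases growStep_cases E M D with ⟨h, _⟩ | ⟨⟨x, y⟩, ha, hc, h⟩
    · rw [h]; exact ⟨h₁, h₂, h₃⟩
    · have hy := (canGrow_iff.1 hc).1
      have hyV : y ∈ V := by simpa using hG.right_mem (hM.mem_edges hm ha)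
      rw [h]
      refine ⟨h₁.append (by simp) (by simpa using hy), fun z hz => ?_, fun z hz => ?_⟩
      · rw [List.mem_append, List.mem_singleton] at hz
        rcases hz with hz | rfl
        · exact h₂ z hz
        · exact hyV
      · exact List.mem_append_left _ (h₃ z hz)
  have h₀ : P (expL V M) := ⟨hV.filter _, fun x hx => (List.mem_filter.1 hx).1, fun x hx => hx⟩
  -- Every step that changes the list adds a new vertex of `V`, so `V.length` steps reach a fixed
  -- point.
  have hfix : growStep E M (growL V E M) = growL V E M := by
    refine iterate_fixed (P := P) (μ := List.length) hP (fun D hD => ?_) (fun D _ hne => ?_) h₀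
    · exact (hD.1.subperm fun x hx => hD.2.1 x hx).length_le
    · rcases growStep_cases E M D with ⟨h, _⟩ | ⟨a, _, _, h⟩
      · exact absurd h hne
      · rw [h]; simp
  obtain ⟨h₁, h₂, h₃⟩ := iterate_induction hP h₀ V.length
  refine ⟨h₁, h₂, h₃, ?_⟩
  rcases growStep_cases E M (growL V E M) with ⟨_, h⟩ | ⟨a, _, _, h⟩
  · exact h
  · rw [hfix] at h
    exact absurd (congrArg List.length h) (by simp)

/-- If the check succeeds, the search list is a certificate for a maximum matching. -/
theorem wit_of_isMaxL (hV : V.Nodup) (hG : IsGraph V.toFinset (rel E)) (hm : IsMat (rel E) m)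
    (hM : ArcsOf M m) (h : isMaxL V E M = true) :
    Wit V.toFinset (rel E) m {x | x ∈ growL V E M} fun x => {y | conn E (growL V E M) x y = true} := by
  obtain ⟨_, h₂, h₃, h₄⟩ := growL_spec hV hG hm hM
  set D := growL V E M with hD
  have hc : ∀ x ∈ D, m x = x → earlier E D x = false := fun x hx hxx => by
    rw [isMaxL, checkL, List.all_eq_true] at h
    have := h x hx
    rw [Bool.or_eq_true, hM.any_iff] at this
    simpa using this.resolve_left (not_not.2 hxx)
  -- A base is the first vertex of its component in the list: for an exposed vertex this is the
  -- final check, and for a vertex matched out of `D` the search would otherwise have added its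
  -- mate. Hence a component has at most one base.
  have hb : ∀ x ∈ D, (m x = x ∨ m x ∉ D) → earlier E D x = false := by
    rintro x hx (hxx | hxx)
    · exact hc x hx hxx
    · have h₅ := h₄ (x, m x) ((hM _ _).2 ⟨rfl, fun h => hxx (h ▸ hx)⟩)
      by_contra h₆
      rw [← Bool.not_eq_true, canGrow_iff] at h₅
      exact h₅ ⟨hxx, .inl ⟨hx, by simpa using h₆⟩⟩
  have hsy : ∀ x y, (x, y) ∈ E → (y, x) ∈ E := fun x y hxy => hG.symm hxy
  constructor
  · exact fun x hx => by simpa using h₂ x hx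
  · exact fun x hx hxx => h₃ x (hM.mem_expL.2 ⟨by simpa using hx, hxx⟩)
  · intro x hx y hy hxy
    have h₅ : conn E D x y = true := conn_iff.2 ⟨hx, .single ⟨hx, hy, hxy⟩⟩
    ext z
    exact ⟨fun hz => conn_trans (conn_symm hsy h₅) hz, fun hz => conn_trans h₅ hz⟩
  · intro x hx y hy hxy hbx hby
    have hcxy : conn E D x y = true := by
      have : y ∈ {z | conn E D x z = true} := by
        rw [hxy]
        exact conn_refl hy
      exact this
    by_contra hne
    rcases mem_takeWhile_ne_or hx hy hne with h₅ | h₅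
    · exact absurd (earlier_iff.2 ⟨x, h₅, hcxy⟩) (by rw [hb y hy hby]; simp)
    · exact absurd (earlier_iff.2 ⟨y, h₅, conn_symm hsy hcxy⟩) (by rw [hb x hx hbx]; simp)
  · intro x hx y hy hxy
    by_contra hmy
    have hyy : m y ≠ y := fun h => hy (h₃ y (hM.mem_expL.2 ⟨by simpa using hG.right_mem hxy, h⟩))
    have h₅ := h₄ (y, m y) ((hM _ _).2 ⟨rfl, hyy.symm⟩)
    rw [← Bool.not_eq_true, canGrow_iff] at h₅
    exact h₅ ⟨hmy, .inr ⟨hy, x, hx, hxy⟩⟩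

/-- If a matching has a certificate, then the check succeeds. -/
theorem isMaxL_of_wit {κ : Type*} {S : Set α} {K : α → κ}
    (hm : IsMat (rel E) m) (hM : ArcsOf M m) (hW : Wit V.toFinset (rel E) m S K) :
    isMaxL V E M = true := by
  let B : α → Prop := fun x => m x = x ∨ m x ∉ S
  -- The invariant of the search: it stays inside `S`, it has the base of every class that it meets,
  -- and no vertex of the same class precedes a base. At the end, an exposed vertex is a base, so
  -- the check cannot fail at it.
  let P : List α → Prop := fun D => (∀ x ∈ D, x ∈ S) ∧ (∀ x ∈ D, ∃ b ∈ D, B b ∧ K b = K x) ∧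
    ∀ x ∈ D, B x → ∀ p ∈ D.takeWhile (fun z => !decide (z = x)), K p ≠ K x
  have hconn : ∀ D : List α, (∀ x ∈ D, x ∈ S) → ∀ {x y}, conn E D x y = true → K x = K y :=
    fun D hD x y h => conn_class (fun x hx y hy hxy => hW.cls x (hD x hx) y (hD y hy) hxy) h
  have hP : ∀ D, P D → P (growStep E M D) := by
    rintro D ⟨h₁, h₂, h₃⟩
    rcases growStep_cases E M D with ⟨h, _⟩ | ⟨⟨x, y⟩, ha, hc, h⟩
    · rw [h]; exact ⟨h₁, h₂, h₃⟩
    · rw [h]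
      obtain ⟨rfl, hxy⟩ := (hM _ _).1 ha
      obtain ⟨hyD, hc⟩ := canGrow_iff.1 hc
      dsimp only at hyD ⊢
      have hEx : rel E x (m x) := hm.adj x hxy.symm
      -- The new vertex `m x` is either the base of a class not met so far or a non-base of a class
      -- whose base is already listed. If `x` is listed and not first in its component, it is no
      -- base, so its mate is in `S`. If `x` is in `S` but not listed, its class is that of a listed
      -- neighbour, whose base is listed, so again `x` is no base. If `x` is outside `S`, then `m x`
      -- is a base, and a listed vertex of its class would have brought `m x` into the list.
      have key : m x ∈ S ∧ ((B (m x) ∧ ∀ p ∈ D, K p ≠ K (m x)) ∨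
          (¬ B (m x) ∧ ∃ b ∈ D, B b ∧ K b = K (m x))) := by
        have hnB : x ∈ S → m x ∈ S → ¬ B (m x) := fun hx hmx hB => by
          rcases hB with hB | hB
          · rw [hm.invol] at hB; exact hxy hB
          · rw [hm.invol] at hB; exact hB hx
        rcases hc with ⟨hx, he⟩ | ⟨hx, v, hv, hvx⟩
        · obtain ⟨p, hp, hpc⟩ := earlier_iff.1 he
          have hmx : m x ∈ S := by
            by_contra hmx
            exact h₃ x hx (.inr hmx) p hp (hconn D h₁ hpc)
          refine ⟨hmx, .inr ⟨hnB (h₁ x hx) hmx, ?_⟩⟩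
          obtain ⟨b, hb, hB, hK⟩ := h₂ x hx
          exact ⟨b, hb, hB, hK.trans (hW.cls x (h₁ x hx) _ hmx hEx)⟩
        · by_cases hxS : x ∈ S
          · obtain ⟨b, hb, hB, hK⟩ := h₂ v hv
            have hKx : K b = K x := hK.trans (hW.cls v (h₁ v hv) x hxS hvx)
            have hmx : m x ∈ S := by
              by_contra hmx
              have := hW.base b (h₁ b hb) x hxS hKx hB (.inr hmx)
              exact hx (this ▸ hb)
            exact ⟨hmx, .inr ⟨hnB hxS hmx, b, hb, hB,
              hKx.trans (hW.cls x hxS _ hmx hEx)⟩⟩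
          · have hmx : m x ∈ S := hW.nbr v (h₁ v hv) x hxS hvx
            have hB : B (m x) := .inr (by rwa [hm.invol])
            refine ⟨hmx, .inl ⟨hB, fun p hp hpK => ?_⟩⟩
            obtain ⟨b, hb, hB', hK⟩ := h₂ p hp
            have := hW.base b (h₁ b hb) (m x) hmx (hK.trans hpK) hB' hB
            exact hyD (this ▸ hb)
      refine ⟨fun z hz => ?_, fun z hz => ?_, fun z hz hB p hp => ?_⟩
      · rw [List.mem_append, List.mem_singleton] at hz
        rcases hz with hz | rfl
        · exact h₁ z hz
        · exact key.1
      · rw [List.mem_append, List.mem_singleton] at hz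
        rcases hz with hz | rfl
        · obtain ⟨b, hb, hB, hK⟩ := h₂ z hz
          exact ⟨b, List.mem_append_left _ hb, hB, hK⟩
        · rcases key.2 with ⟨hB, _⟩ | ⟨_, b, hb, hB, hK⟩
          · exact ⟨m x, by simp, hB, rfl⟩
          · exact ⟨b, List.mem_append_left _ hb, hB, hK⟩
      · rw [List.mem_append, List.mem_singleton] at hz
        rcases hz with hz | rfl
        · rw [takeWhile_ne_append hz] at hp
          exact h₃ z hz hB p hp
        · rw [takeWhile_ne_concat hyD] at hp
          exact (key.2.resolve_right fun h => h.1 hB).2 p hp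
  have h₀ : P (expL V M) := by
    have hS : ∀ x ∈ expL V M, x ∈ S := fun x hx => by
      obtain ⟨h₁, h₂⟩ := hM.mem_expL.1 hx
      exact hW.exp x (by simpa using h₁) h₂
    refine ⟨hS, fun x hx => ⟨x, hx, .inl (hM.mem_expL.1 hx).2, rfl⟩, fun x hx hB p hp hK => ?_⟩
    have hp' := (List.takeWhile_sublist _).subset hp
    have := hW.base p (hS p hp') x (hS x hx) hK (.inl (hM.mem_expL.1 hp').2) hB
    subst this
    simpa using List.mem_takeWhile_imp hp
  obtain ⟨h₁, _, h₃⟩ := iterate_induction hP h₀ V.length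
  change checkL E M (growL V E M) = true
  rw [checkL, List.all_eq_true]
  intro x hx
  rw [Bool.or_eq_true, hM.any_iff, Bool.not_eq_true']
  by_contra! hcon
  obtain ⟨hxx, he⟩ := hcon
  rw [ne_eq, Bool.not_eq_false, earlier_iff] at he
  obtain ⟨p, hp, hpc⟩ := he
  exact h₃ x hx (.inl hxx) p hp (hconn _ h₁ hpc)

/-- A successful search is itself a certificate. Conversely, the certificate from Tutte's theorem
need not be the one found by the search; its existence alone keeps the check from failing. -/
theorem isMaxL_iff (hV : V.Nodup) (hG : IsGraph V.toFinset (rel E)) (hm : IsMat (rel E) m)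
    (hM : ArcsOf M m) : isMaxL V E M = true ↔ ∀ m', IsMat (rel E) m' →
      (exposed V.toFinset m).card ≤ (exposed V.toFinset m').card := by
  constructor
  · exact fun h m' hm' => (wit_of_isMaxL hV hG hm hM h).le_card_exposed hG hm hm'
  · intro h
    obtain ⟨κ, D, K, hW⟩ := exists_wit hG hm h
    exact isMaxL_of_wit hm hM hW

end

end

end MatchingGap

/-! ### Enlarging a matching by means of the maximality test -/

namespace MatchingGap

section

universe v

variable {α : Type v} [DecidableEq α]

omit [DecidableEq α] in
theorem exists_arcsOf {E M : List (α × α)} (hE : ∀ x, (x, x) ∉ E) (hME : ∀ e ∈ M, e ∈ E)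
    (hs : ∀ x y, (x, y) ∈ M → (y, x) ∈ M) (hf : ∀ x y z, (x, y) ∈ M → (x, z) ∈ M → y = z) :
    ∃ m, IsMat (rel E) m ∧ ArcsOf M m := by
  classical
  let m : α → α := fun x => if h : ∃ y, (x, y) ∈ M then h.choose else x
  have hm : ∀ {x y}, (x, y) ∈ M → m x = y := fun {x y} h => by
    have h' : ∃ y, (x, y) ∈ M := ⟨y, h⟩
    simp only [m, dif_pos h']
    exact hf x _ _ h'.choose_spec h
  have hm' : ∀ x, m x ≠ x → (x, m x) ∈ M := fun x h => by
    by_cases h' : ∃ y, (x, y) ∈ M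
    · obtain ⟨y, hy⟩ := h'
      rwa [hm hy]
    · exact absurd (by simp only [m, dif_neg h']) h
  refine ⟨m, ⟨fun x => ?_, fun x h => hME _ (hm' x h)⟩, fun x y => ⟨fun h => ⟨hm h, ?_⟩, ?_⟩⟩
  · by_cases h : m x = x
    · rw [h, h]
    · exact hm (hs _ _ (hm' x h))
  · rintro rfl
    exact hE _ (hME _ h)
  · rintro ⟨rfl, h⟩
    exact hm' x h.symm

theorem ArcsOf.length_expL {V : List α} (hV : V.Nodup) {M : List (α × α)} {m : α → α}
    (hM : ArcsOf M m) : (expL V M).length = (exposed V.toFinset m).card := by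
  have h : (expL V M).toFinset = exposed V.toFinset m := by
    ext x
    rw [List.mem_toFinset, hM.mem_expL, mem_exposed, List.mem_toFinset]
  rw [← h]
  exact (List.toFinset_card_of_nodup (hV.filter _)).symm

theorem mem_delEdge {e f : α × α} {E : List (α × α)} :
    f ∈ delEdge e E ↔ f ∈ E ∧ f ≠ e ∧ f ≠ (e.2, e.1) := by
  simp [delEdge]

variable {V : List α} {E M : List (α × α)} {m : α → α}

/-- Some matching in `E'` has fewer exposed vertices than `m`. -/
def Improves (V : List α) (m : α → α) (E' : List (α × α)) : Prop :=
  ∃ m', IsMat (rel E') m' ∧ (exposed V.toFinset m').card < (exposed V.toFinset m).card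

/-- A set of edges between `M` and `E` in which `m` is not maximum. -/
structure Thinning (V : List α) (E M : List (α × α)) (m : α → α) (E' : List (α × α)) : Prop where
  sub : ∀ e ∈ E', e ∈ E
  symm : ∀ x y, (x, y) ∈ E' → (y, x) ∈ E'
  arcs : ∀ e ∈ M, e ∈ E'
  impr : Improves V m E'

theorem Improves.mono {E₁ E₂ : List (α × α)} (h : ∀ e ∈ E₁, e ∈ E₂) :
    Improves V m E₁ → Improves V m E₂ :=
  fun ⟨m', h₁, h₂⟩ => ⟨m', ⟨h₁.invol, fun x hx => h _ (h₁.adj x hx)⟩, h₂⟩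

theorem isMaxL_delEdge (hV : V.Nodup) (hG : IsGraph V.toFinset (rel E)) (hm : IsMat (rel E) m)
    (hM : ArcsOf M m) {E' : List (α × α)} (h : Thinning V E M m E') {e : α × α} (he : e ∉ M) :
    (isMaxL V (delEdge e E') M = false ↔ Improves V m (delEdge e E')) ∧
      (Improves V m (delEdge e E') → Thinning V E M m (delEdge e E')) := by
  have h₁ : ∀ f ∈ delEdge e E', f ∈ E := fun f hf => h.sub f (mem_delEdge.1 hf).1
  have h₂ : ∀ x y, (x, y) ∈ delEdge e E' → (y, x) ∈ delEdge e E' := fun x y hxy => by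
    rw [mem_delEdge] at hxy ⊢
    refine ⟨h.symm x y hxy.1, fun h' => hxy.2.2 ?_, fun h' => hxy.2.1 ?_⟩
    · rw [← h']
    · obtain ⟨e₁, e₂⟩ := e
      simp only [Prod.mk.injEq] at h' ⊢
      exact ⟨h'.2, h'.1⟩
  have h₃ : ∀ f ∈ M, f ∈ delEdge e E' := fun f hf => by
    refine mem_delEdge.2 ⟨h.arcs f hf, fun h' => he (h' ▸ hf), fun h' => he ?_⟩
    rw [h'] at hf
    exact hM.mem_symm hm hf
  refine ⟨?_, fun h₄ => ⟨h₁, h₂, h₃, h₄⟩⟩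
  have hG' : IsGraph V.toFinset (rel (delEdge e E')) :=
    ⟨fun hxy => h₂ _ _ hxy, fun x hx => hG.irrefl x (h₁ _ hx), fun hxy => hG.left_mem (h₁ _ hxy)⟩
  have hm' : IsMat (rel (delEdge e E')) m :=
    ⟨hm.invol, fun x hx => h₃ _ ((hM _ _).2 ⟨rfl, hx.symm⟩)⟩
  rw [← Bool.not_eq_true, isMaxL_iff hV hG' hm' hM]
  simp only [Improves]
  push Not
  rfl

/-- A single pass over the edges suffices: since `Improves` is monotone in the edge set, an edge
that could not be spared when it was examined cannot be spared after further deletions. -/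
theorem foldl_thinStep (hV : V.Nodup) (hG : IsGraph V.toFinset (rel E)) (hm : IsMat (rel E) m)
    (hM : ArcsOf M m) (L : List (α × α)) {E' : List (α × α)} (h : Thinning V E M m E') :
    Thinning V E M m (L.foldl (thinStep V M) E') ∧
      (∀ e ∈ L.foldl (thinStep V M) E', e ∈ E') ∧
      ∀ e ∈ L, e ∈ L.foldl (thinStep V M) E' → e ∉ M →
        ¬ Improves V m (delEdge e (L.foldl (thinStep V M) E')) := by
  induction L generalizing E' with
  | nil => exact ⟨h, fun e he => he, by simp⟩
  | cons a L ih =>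
    rw [List.foldl_cons]
    have hstep : Thinning V E M m (thinStep V M E' a) ∧ (∀ e ∈ thinStep V M E' a, e ∈ E') ∧
        (a ∈ thinStep V M E' a → a ∉ M → ¬ Improves V m (delEdge a E')) := by
      by_cases ha : a ∈ M
      · have : thinStep V M E' a = E' := by simp [thinStep, ha]
        rw [this]
        exact ⟨h, fun e he => he, fun _ h => absurd ha h⟩
      · obtain ⟨h₁, h₂⟩ := isMaxL_delEdge hV hG hm hM h ha
        cases hmax : isMaxL V (delEdge a E') M
        · have : thinStep V M E' a = delEdge a E' := by simp [thinStep, ha, hmax]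
          rw [this]
          exact ⟨h₂ (h₁.1 hmax), fun e he => (mem_delEdge.1 he).1,
            fun h => absurd rfl (mem_delEdge.1 h).2.1⟩
        · have : thinStep V M E' a = E' := by simp [thinStep, ha, hmax]
          rw [this]
          refine ⟨h, fun e he => he, fun _ _ h' => ?_⟩
          rw [h₁.2 h'] at hmax
          cases hmax
    obtain ⟨h₁, h₂, h₃⟩ := ih hstep.1
    refine ⟨h₁, fun e he => hstep.2.1 e (h₂ e he), fun e he he' heM => ?_⟩
    rcases List.mem_cons.1 he with rfl | he
    · refine fun h' => hstep.2.2 (h₂ e he') heM (h'.mono fun f hf => ?_)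
      rw [mem_delEdge] at hf ⊢
      exact ⟨hstep.2.1 f (h₂ f hf.1), hf.2⟩
    · exact h₃ e he he' heM

theorem mem_augL {E' : List (α × α)} {e : α × α} : e ∈ augL E M E' ↔ e ∈ E ∧
    ((e ∈ M ∧ ∀ f ∈ E', f ∉ M → f.1 ≠ e.1 ∧ f.1 ≠ e.2) ∨ (e ∉ M ∧ e ∈ E')) := by
  by_cases h : e ∈ M <;> simp [augL, h, not_or]

/-- By minimality, every remaining edge outside `M` belongs to every matching that improves on `m`.
So these edges form a matching, and with the edges of `M` disjoint from them they include such an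
improving matching. -/
theorem augL_spec (hV : V.Nodup) (hG : IsGraph V.toFinset (rel E)) (hm : IsMat (rel E) m)
    (hM : ArcsOf M m) (h : isMaxL V E M = false) :
    ∃ n, IsMat (rel E) n ∧ ArcsOf (augL E M (thin V E M)) n ∧
      (exposed V.toFinset n).card < (exposed V.toFinset m).card := by
  have hE : Thinning V E M m E := by
    refine ⟨fun e he => he, fun x y hxy => hG.symm hxy, fun e he => hM.mem_edges hm he, ?_⟩
    rw [← Bool.not_eq_true, isMaxL_iff hV hG hm hM] at h
    push Not at h
    exact h
  obtain ⟨h₁, _, h₃⟩ := foldl_thinStep hV hG hm hM E hE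
  change Thinning V E M m (thin V E M) at h₁
  change ∀ e ∈ E, e ∈ thin V E M → e ∉ M → ¬ Improves V m (delEdge e (thin V E M)) at h₃
  set E' := thin V E M
  obtain ⟨m', hm', hlt⟩ := h₁.impr
  -- Otherwise `m'` would still be available after deletion of this edge.
  have key : ∀ x y, (x, y) ∈ E' → (x, y) ∉ M → m' x = y := by
    intro x y hxy hxyM
    by_contra hcon
    refine h₃ _ (h₁.sub _ hxy) hxy hxyM ⟨m', ⟨hm'.invol, fun z hz => ?_⟩, hlt⟩
    refine mem_delEdge.2 ⟨hm'.adj z hz, fun h => ?_, fun h => ?_⟩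
    · simp only [Prod.mk.injEq] at h
      exact hcon (h.1 ▸ h.2)
    · simp only [Prod.mk.injEq] at h
      exact hcon (by rw [← h.2, hm'.invol]; exact h.1)
  have hMs : ∀ {x y}, (x, y) ∈ M → (y, x) ∈ M := hM.mem_symm hm
  obtain ⟨n, hn, hnM⟩ : ∃ n, IsMat (rel E) n ∧ ArcsOf (augL E M E') n := by
    refine exists_arcsOf hG.irrefl (fun e he => (mem_augL.1 he).1) (fun x y hxy => ?_)
      fun x y z hxy hxz => ?_
    · rw [mem_augL] at hxy ⊢
      refine ⟨hG.symm hxy.1, ?_⟩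
      rcases hxy.2 with ⟨h₄, h₅⟩ | ⟨h₄, h₅⟩
      · exact .inl ⟨hMs h₄, fun f hf hfM => (h₅ f hf hfM).symm⟩
      · exact .inr ⟨fun h => h₄ (hMs h), h₁.symm _ _ h₅⟩
    · rw [mem_augL] at hxy hxz
      rcases hxy.2 with ⟨h₄, h₅⟩ | ⟨h₄, h₅⟩ <;> rcases hxz.2 with ⟨h₆, h₇⟩ | ⟨h₆, h₇⟩
      · rw [← ((hM _ _).1 h₄).1, ((hM _ _).1 h₆).1]
      · exact absurd rfl (h₅ _ h₇ h₆).1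
      · exact absurd rfl (h₇ _ h₅ h₄).1
      · rw [← key x y h₅ h₄, key x z h₇ h₆]
  -- It suffices that each edge of `m'` is in the new list. An edge of `m'` in `M` is disjoint from
  -- the remaining edges outside `M`, because those are edges of `m'` too.
  refine ⟨n, hn, hnM, lt_of_le_of_lt (Finset.card_le_card fun x hx => ?_) hlt⟩
  rw [mem_exposed] at hx ⊢
  refine ⟨hx.1, ?_⟩
  by_contra hcon
  have hxE : (x, m' x) ∈ E' := hm'.adj x hcon
  have : (x, m' x) ∈ augL E M E' := by
    refine mem_augL.2 ⟨h₁.sub _ hxE, ?_⟩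
    by_cases hxM : (x, m' x) ∈ M
    · refine .inl ⟨hxM, fun ⟨f₁, f₂⟩ hf hfM => ⟨fun h => hfM ?_, fun h => hfM ?_⟩⟩
      · have := key _ _ hf hfM
        simp only at h
        rw [← this, h]
        exact hxM
      · have := key _ _ hf hfM
        simp only at h
        rw [← this, h, hm'.invol]
        exact hMs hxM
    · exact .inr ⟨hxM, hxE⟩
  have := ((hnM _ _).1 this).1
  exact hcon (this ▸ hx.2)

theorem maxL_spec (hV : V.Nodup) (hG : IsGraph V.toFinset (rel E)) :
    isMaxL V E (maxL V E) = true ∧ ∃ m, IsMat (rel E) m ∧ ArcsOf (maxL V E) m := by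
  let P : List (α × α) → Prop := fun M => ∃ m, IsMat (rel E) m ∧ ArcsOf M m
  have hstep : ∀ M, P M → isMaxL V E M = false → P (maxStep V E M) ∧
      (expL V (maxStep V E M)).length < (expL V M).length := by
    rintro M ⟨m, hm, hM⟩ h
    obtain ⟨n, hn, hnM, hlt⟩ := augL_spec hV hG hm hM h
    rw [maxStep, h, cond_false]
    refine ⟨⟨n, hn, hnM⟩, ?_⟩
    rwa [hnM.length_expL hV, hM.length_expL hV]
  have hle : ∀ M, (expL V M).length ≤ V.length := fun M => List.length_filter_le _ _
  have hmax : ∀ M, isMaxL V E M = true → maxStep V E M = M := fun M h => by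
    rw [maxStep, h, cond_true]
  have hP : ∀ M, P M → P (maxStep V E M) := fun M h => by
    cases hM : isMaxL V E M
    · exact (hstep M h hM).1
    · rwa [hmax M hM]
  have h₀ : P [] := ⟨fun x => x, isMat_id _, fun x y => by simp⟩
  have hfix : maxStep V E (maxL V E) = maxL V E := by
    refine iterate_fixed (P := P) (μ := fun M => V.length - (expL V M).length) hP
      (fun M _ => Nat.sub_le _ _) (fun M hPM hne => ?_) h₀
    cases hM : isMaxL V E M
    · have h₁ := (hstep M hPM hM).2
      have h₂ := hle M
      omega
    · exact absurd (hmax M hM) hne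
  have hPm : P (maxL V E) := iterate_induction hP h₀ _
  refine ⟨?_, hPm⟩
  by_contra hcon
  have := (hstep _ hPm (by simpa using hcon)).2
  rw [hfix] at this
  exact lt_irrefl _ this

end

end MatchingGap

namespace MatchingGap

/-! ### The test for a gap -/

section

universe v

variable {α : Type v} [DecidableEq α]

/-- Whether `v` has a neighbour in `T`. -/
def touches (E : List (α × α)) (T : List α) (v : α) : Bool := T.any fun t => decide ((t, v) ∈ E)

/-- The vertices in `D` that are exposed or matched to a vertex outside `D`. -/
def basesL (M : List (α × α)) (D : List α) : List α :=
  D.filter fun p => !(M.any fun e => decide (e.1 = p) && decide (e.2 ∈ D))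

/-- The bases whose components are disjoint from `T`. -/
def freeBases (E M : List (α × α)) (D T : List α) : List α :=
  (basesL M D).filter fun p => !(T.any fun t => conn E D p t)

/-- The vertices of the auxiliary graph: those outside `T`, one vertex for each element of `Z` and
one for each element of `Y`. -/
def gadgetV (V T Z Y : List α) : List (ℕ × α) :=
  (V.filter fun v => !decide (v ∈ T)).map (fun v => (0, v)) ++
    (Z.map (fun p => (1, p)) ++ Y.map fun r => (2, r))

/-- The edges of the auxiliary graph: an element of `Z` is joined to the vertices of its component
that have no neighbour in `T` and to all elements of `Y`. -/
def gadgetE (E : List (α × α)) (D T Z Y : List α) : List ((ℕ × α) × (ℕ × α)) :=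
  (E.filter fun e => !decide (e.1 ∈ T) && !decide (e.2 ∈ T)).map
      (fun e => ((0, e.1), (0, e.2))) ++
    ((Z.flatMap fun p => (D.filter fun v => conn E D p v && !touches E T v).flatMap
      fun v => [((0, v), (1, p)), ((1, p), (0, v))]) ++
    Z.flatMap fun p => Y.flatMap fun r => [((1, p), (2, r)), ((2, r), (1, p))])

/-- Whether the graph has a perfect matching. -/
def perfectL {β : Type*} [DecidableEq β] (V : List β) (E : List (β × β)) : Bool :=
  (expL V (maxL V E)).isEmpty

/-- The number of vertices outside `T` to be exposed for a gap of `j`. -/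
def needed (V : List α) (M : List (α × α)) (j : ℕ) (T : List α) : ℕ :=
  (expL V M).length + (j + j) - T.length

/-- The test with free bases `Z` and the number `q` of vertices to be exposed. -/
def testZ (V : List α) (E : List (α × α)) (D T Z : List α) (q : ℕ) : Bool :=
  Nat.ble q Z.length && perfectL (gadgetV V T Z (Z.drop q)) (gadgetE E D T Z (Z.drop q))

/-- Whether some maximal matching that exposes `T` has gap `j`. -/
def testT (V : List α) (E M : List (α × α)) (D : List α) (j : ℕ) (T : List α) : Bool :=
  (T.all fun t => !touches E T t) && testZ V E D T (freeBases E M D T) (needed V M j T)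

theorem touches_iff {E : List (α × α)} {T : List α} {v : α} :
    touches E T v = true ↔ ∃ t ∈ T, (t, v) ∈ E := by
  simp [touches]

theorem perfectL_iff {V : List α} {E : List (α × α)} (hV : V.Nodup)
    (hG : IsGraph V.toFinset (rel E)) :
    perfectL V E = true ↔ ∃ g, IsMat (rel E) g ∧ ∀ x ∈ V, g x ≠ x := by
  obtain ⟨h, m, hm, hM⟩ := maxL_spec hV hG
  rw [isMaxL_iff hV hG hm hM] at h
  rw [perfectL, List.isEmpty_iff, ← List.length_eq_zero_iff, hM.length_expL hV]
  constructor
  · intro h₀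
    refine ⟨m, hm, fun x hx hxx => ?_⟩
    rw [Finset.card_eq_zero] at h₀
    exact absurd (mem_exposed.2 ⟨List.mem_toFinset.2 hx, hxx⟩) (by simp [h₀])
  · rintro ⟨g, hg, hgx⟩
    have h₀ : exposed V.toFinset g = ∅ := by
      ext x
      simp only [mem_exposed, List.mem_toFinset, Finset.notMem_empty, iff_false, not_and]
      exact hgx x
    have := h g hg
    rwa [h₀, Finset.card_empty, Nat.le_zero] at this

theorem mem_gadgetV {V T Z Y : List α} {a : ℕ × α} : a ∈ gadgetV V T Z Y ↔
    (∃ v ∈ V, v ∉ T ∧ a = (0, v)) ∨ (∃ p ∈ Z, a = (1, p)) ∨ ∃ r ∈ Y, a = (2, r) := by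
  simp only [gadgetV, List.mem_append, List.mem_map, List.mem_filter, Bool.not_eq_true',
    decide_eq_false_iff_not, and_assoc, eq_comm (a := a)]

theorem mem_gadgetE {E : List (α × α)} {D T Z Y : List α} {a b : ℕ × α} :
    (a, b) ∈ gadgetE E D T Z Y ↔
      (∃ x y, (x, y) ∈ E ∧ x ∉ T ∧ y ∉ T ∧ a = (0, x) ∧ b = (0, y)) ∨
      (∃ p ∈ Z, ∃ v ∈ D, conn E D p v = true ∧ touches E T v = false ∧
        ((a = (0, v) ∧ b = (1, p)) ∨ (a = (1, p) ∧ b = (0, v)))) ∨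
      ∃ p ∈ Z, ∃ r ∈ Y, (a = (1, p) ∧ b = (2, r)) ∨ (a = (2, r) ∧ b = (1, p)) := by
  simp only [gadgetE, List.mem_append, List.mem_map, List.mem_filter, List.mem_flatMap,
    List.mem_cons, List.not_mem_nil, or_false, Prod.mk.injEq, Prod.exists, Bool.and_eq_true,
    Bool.not_eq_true', decide_eq_false_iff_not]
  refine or_congr ⟨?_, ?_⟩ (or_congr ⟨?_, ?_⟩ Iff.rfl)
  · rintro ⟨x, y, ⟨h₁, h₂, h₃⟩, h₄, h₅⟩
    exact ⟨x, y, h₁, h₂, h₃, h₄.symm, h₅.symm⟩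
  · rintro ⟨x, y, h₁, h₂, h₃, h₄, h₅⟩
    exact ⟨x, y, ⟨h₁, h₂, h₃⟩, h₄.symm, h₅.symm⟩
  · rintro ⟨p, hp, v, ⟨h₁, h₂, h₃⟩, h₄⟩
    exact ⟨p, hp, v, h₁, h₂, h₃, h₄⟩
  · rintro ⟨p, hp, v, h₁, h₂, h₃, h₄⟩
    exact ⟨p, hp, v, ⟨h₁, h₂, h₃⟩, h₄⟩

/-- A maximum matching with the certificate found by the search. -/
structure Searched (V : List α) (E M : List (α × α)) (D : List α) (m : α → α) : Prop where
  nodup : V.Nodup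
  graph : IsGraph V.toFinset (rel E)
  mat : IsMat (rel E) m
  arcs : ArcsOf M m
  nodupD : D.Nodup
  wit : Wit V.toFinset (rel E) m {x | x ∈ D} fun x => {y | conn E D x y = true}

theorem searched_maxL {V : List α} {E : List (α × α)} (hV : V.Nodup)
    (hG : IsGraph V.toFinset (rel E)) :
    ∃ m, Searched V E (maxL V E) (growL V E (maxL V E)) m := by
  obtain ⟨h, m, hm, hM⟩ := maxL_spec hV hG
  exact ⟨m, hV, hG, hm, hM, (growL_spec hV hG hm hM).1, wit_of_isMaxL hV hG hm hM h⟩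

namespace Searched

variable {V D : List α} {E M : List (α × α)} {m : α → α}

theorem csymm (h : Searched V E M D m) {u v : α} (huv : conn E D u v = true) :
    conn E D v u = true := conn_symm (fun _ _ hxy => h.graph.symm hxy) huv

theorem mem_basesL (h : Searched V E M D m) {p : α} :
    p ∈ basesL M D ↔ p ∈ D ∧ (m p = p ∨ m p ∉ D) := by
  rw [basesL, List.mem_filter, Bool.not_eq_true', ← Bool.not_eq_true]
  refine and_congr_right fun hp => ?_
  simp only [List.any_eq_true, Bool.and_eq_true, decide_eq_true_eq, Prod.exists]
  constructor
  · intro h₁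
    by_contra! h₂
    exact h₁ ⟨p, m p, (h.arcs _ _).2 ⟨rfl, h₂.1.symm⟩, rfl, h₂.2⟩
  · rintro h₁ ⟨a, b, hab, rfl, hb⟩
    obtain ⟨rfl, h₂⟩ := (h.arcs _ _).1 hab
    rcases h₁ with h₁ | h₁
    · exact h₂ h₁.symm
    · exact h₁ hb

/-- Two bases in the same component are equal. -/
theorem base_unique (h : Searched V E M D m) {p p' : α} (hp : p ∈ basesL M D)
    (hp' : p' ∈ basesL M D) (hc : conn E D p p' = true) : p = p' := by
  rw [h.mem_basesL] at hp hp'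
  refine h.wit.base p hp.1 p' hp'.1 ?_ hp.2 hp'.2
  ext z
  exact ⟨fun hz => conn_trans (h.csymm hc) hz, fun hz => conn_trans hc hz⟩

theorem conn_mem {u v : α} (hc : conn E D u v = true) : v ∈ D := by
  obtain ⟨h₁, h₂⟩ := conn_iff.1 hc
  rcases Relation.ReflTransGen.cases_tail h₂ with h₃ | ⟨z, _, h₃⟩
  · rwa [h₃]
  · exact h₃.2.1

theorem mem_freeBases {T : List α} {p : α} : p ∈ freeBases E M D T ↔
    p ∈ basesL M D ∧ ∀ t ∈ T, conn E D p t = false := by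
  simp [freeBases]

theorem nodup_freeBases (h : Searched V E M D m) (T : List α) : (freeBases E M D T).Nodup :=
  (h.nodupD.filter _).filter _

theorem nodup_gadgetV {V T Z Y : List α} (hV : V.Nodup) (hZ : Z.Nodup) (hY : Y.Nodup) :
    (gadgetV V T Z Y).Nodup := by
  have hinj : ∀ i : ℕ, Function.Injective fun v : α => (i, v) := fun i a b h => by simpa using h
  refine List.Nodup.append ((hV.filter _).map (hinj 0))
    (List.Nodup.append (hZ.map (hinj 1)) (hY.map (hinj 2)) ?_) ?_
  · intro x hx hx'
    simp only [List.mem_map] at hx hx'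
    obtain ⟨a, _, rfl⟩ := hx
    obtain ⟨b, _, hb⟩ := hx'
    simp at hb
  · intro x hx hx'
    simp only [List.mem_map, List.mem_append] at hx hx'
    obtain ⟨a, _, rfl⟩ := hx
    rcases hx' with ⟨b, _, hb⟩ | ⟨b, _, hb⟩ <;> simp at hb

theorem isGraph_gadget (h : Searched V E M D m) {T Z Y : List α}
    (hZ : ∀ p ∈ Z, p ∈ freeBases E M D T) :
    IsGraph (gadgetV V T Z Y).toFinset (rel (gadgetE E D T Z Y)) := by
  refine ⟨fun {a b} hab => ?_, fun a ha => ?_, fun {a b} hab => ?_⟩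
  · rw [rel, mem_gadgetE] at hab ⊢
    rcases hab with ⟨x, y, h₁, h₂, h₃, h₄, h₅⟩ | ⟨p, hp, v, h₁, h₂, h₃, h₄⟩ | ⟨p, hp, r, hr, h₄⟩
    · exact .inl ⟨y, x, h.graph.symm h₁, h₃, h₂, h₅, h₄⟩
    · exact .inr (.inl ⟨p, hp, v, h₁, h₂, h₃, h₄.symm.imp And.symm And.symm⟩)
    · exact .inr (.inr ⟨p, hp, r, hr, h₄.symm.imp And.symm And.symm⟩)
  · rw [rel, mem_gadgetE] at ha
    rcases ha with ⟨x, y, h₁, h₂, h₃, rfl, h₅⟩ | ⟨p, hp, v, h₁, h₂, h₃, h₄⟩ | ⟨p, hp, r, hr, h₄⟩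
    · simp only [Prod.mk.injEq, true_and] at h₅
      subst h₅
      exact h.graph.irrefl _ h₁
    · rcases h₄ with ⟨rfl, h₄⟩ | ⟨rfl, h₄⟩ <;> simp at h₄
    · rcases h₄ with ⟨rfl, h₄⟩ | ⟨rfl, h₄⟩ <;> simp at h₄
  · rw [rel, mem_gadgetE] at hab
    rw [List.mem_toFinset, mem_gadgetV]
    rcases hab with ⟨x, y, h₁, h₂, h₃, h₄, h₅⟩ | ⟨p, hp, v, h₁, h₂, h₃, h₄⟩ | ⟨p, hp, r, hr, h₄⟩
    · exact .inl ⟨x, by simpa using h.graph.left_mem h₁, h₂, h₄⟩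
    · rcases h₄ with ⟨h₄, _⟩ | ⟨h₄, _⟩
      · refine .inl ⟨v, by simpa using h.wit.sub v h₁, fun hvT => ?_, h₄⟩
        have := (mem_freeBases.1 (hZ p hp)).2 v hvT
        rw [h₂] at this
        cases this
      · exact .inr (.inl ⟨p, hp, h₄⟩)
    · rcases h₄ with ⟨h₄, _⟩ | ⟨h₄, _⟩
      · exact .inr (.inl ⟨p, hp, h₄⟩)
      · exact .inr (.inr ⟨r, hr, h₄⟩)

/-- If the test succeeds, then there is a maximal matching with the given gap. -/
theorem sound (h : Searched V E M D m) {T : List α} (hT : T.Nodup) (hTV : ∀ t ∈ T, t ∈ V) {j : ℕ}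
    (ht : testT V E M D j T = true) : ∃ n, IsMat (rel E) n ∧
      (∀ x ∈ exposed V.toFinset n, ∀ y ∈ exposed V.toFinset n, ¬ rel E x y) ∧
      (exposed V.toFinset m).card + 2 * j ≤ (exposed V.toFinset n).card := by
  rw [testT, testZ, Bool.and_eq_true, Bool.and_eq_true, List.all_eq_true, Nat.ble_eq] at ht
  obtain ⟨hind, hq, hperf⟩ := ht
  set Z := freeBases E M D T with hZ
  set q := needed V M j T with hqdef
  have hZn : Z.Nodup := h.nodup_freeBases T
  rw [perfectL_iff (nodup_gadgetV h.nodup hZn (hZn.sublist (List.drop_sublist _ _)))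
    (h.isGraph_gadget fun p hp => hp)] at hperf
  obtain ⟨g, hg, hgx⟩ := hperf
  -- A vertex outside `T` is matched along an edge of the graph or to the auxiliary vertex of a free
  -- base. In the second case `n` exposes it.
  have hgv : ∀ x ∈ V, x ∉ T → (∃ y, g (0, x) = (0, y) ∧ (x, y) ∈ E ∧ y ∉ T) ∨
      ∃ p ∈ Z, g (0, x) = (1, p) ∧ conn E D p x = true ∧ touches E T x = false := by
    intro x hx hxT
    have h₁ := hg.adj _ (hgx (0, x) (mem_gadgetV.2 (.inl ⟨x, hx, hxT, rfl⟩)))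
    rw [rel, mem_gadgetE] at h₁
    rcases h₁ with ⟨a, b, h₁, h₂, h₃, h₄, h₅⟩ | ⟨p, hp, v, h₁, h₂, h₃, h₄⟩ | ⟨p, hp, r, hr, h₄⟩
    · simp only [Prod.mk.injEq, true_and] at h₄
      subst h₄
      exact .inl ⟨b, h₅, h₁, h₃⟩
    · rcases h₄ with ⟨h₄, h₅⟩ | ⟨h₄, h₅⟩
      · simp only [Prod.mk.injEq, true_and] at h₄
        subst h₄
        exact .inr ⟨p, hp, h₅, h₂, h₃⟩
      · simp at h₄
    · rcases h₄ with ⟨h₄, h₅⟩ | ⟨h₄, h₅⟩ <;> simp at h₄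
  let n : α → α := fun x => if x ∈ V ∧ x ∉ T ∧ (g (0, x)).1 = 0 then (g (0, x)).2 else x
  have hn₁ : ∀ {x y}, x ∈ V → x ∉ T → g (0, x) = (0, y) → n x = y := fun hx hxT hxy => by
    simp [n, hx, hxT, hxy]
  have hn₂ : ∀ {x p}, g (0, x) = (1, p) → n x = x := fun hxp => by simp [n, hxp]
  have hn₃ : ∀ {x}, x ∈ T → n x = x := fun hx => by simp [n, hx]
  have hn₄ : ∀ {x}, x ∉ V → n x = x := fun hx => by simp [n, hx]
  have hcases : ∀ x, n x ≠ x → (∃ y, n x = y ∧ (x, y) ∈ E ∧ n y = x) := by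
    intro x hxx
    have hxV : x ∈ V := by_contra fun h => hxx (hn₄ h)
    have hxT : x ∉ T := fun h => hxx (hn₃ h)
    rcases hgv x hxV hxT with ⟨y, h₁, h₂, h₃⟩ | ⟨p, _, h₁, _⟩
    · refine ⟨y, hn₁ hxV hxT h₁, h₂, hn₁ ?_ h₃ ?_⟩
      · simpa using h.graph.right_mem h₂
      · rw [← h₁, hg.invol]
    · exact absurd (hn₂ h₁) hxx
  have hn : IsMat (rel E) n := by
    constructor
    · intro x
      by_cases hxx : n x = x
      · rw [hxx, hxx]
      · obtain ⟨y, h₁, _, h₃⟩ := hcases x hxx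
        rw [h₁, h₃]
    · intro x hxx
      obtain ⟨y, h₁, h₂, _⟩ := hcases x hxx
      rw [h₁]
      exact h₂
  have hexp : ∀ x, x ∈ exposed V.toFinset n → x ∈ T ∨ ∃ p ∈ Z, g (0, x) = (1, p) ∧
      conn E D p x = true ∧ touches E T x = false := by
    intro x hx
    obtain ⟨hxV, hxx⟩ := mem_exposed.1 hx
    by_cases hxT : x ∈ T
    · exact .inl hxT
    · rw [List.mem_toFinset] at hxV
      rcases hgv x hxV hxT with ⟨y, h₁, h₂, _⟩ | h₁
      · rw [hn₁ hxV hxT h₁] at hxx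
        subst hxx
        exact absurd h₂ (h.graph.irrefl _)
      · exact .inr h₁
  have htT : ∀ t ∈ T, ∀ y, touches E T y = false → ¬ (t, y) ∈ E := fun t ht y hy hty => by
    rw [← Bool.not_eq_true, touches_iff] at hy
    exact hy ⟨t, ht, hty⟩
  refine ⟨n, hn, fun x hx y hy hxy => ?_, ?_⟩
  · rcases hexp x hx with hxT | ⟨p, hp, h₁, h₂, h₃⟩
    · rcases hexp y hy with hyT | ⟨p', _, _, _, h₆⟩
      · exact htT x hxT y (by simpa using hind y hyT) hxy
      · exact htT x hxT y h₆ hxy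
    · rcases hexp y hy with hyT | ⟨p', hp', h₄, h₅, _⟩
      · exact htT y hyT x h₃ (h.graph.symm hxy)
      -- Two adjacent exposed vertices outside `T` would lie in one component, hence be matched by
      -- `g` to the same auxiliary vertex.
      · have hc : conn E D x y = true :=
          conn_iff.2 ⟨conn_mem h₂, .single ⟨conn_mem h₂, conn_mem h₅, hxy⟩⟩
        have hpp := h.base_unique (mem_freeBases.1 hp).1 (mem_freeBases.1 hp').1
          (conn_trans (conn_trans h₂ hc) (h.csymm h₅))
        subst hpp
        have hxy' := hg.inj (h₁.trans h₄.symm)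
        simp only [Prod.mk.injEq, true_and] at hxy'
        subst hxy'
        exact h.graph.irrefl _ hxy
  · set X := exposed V.toFinset n \ T.toFinset with hX
    have hXT : X.card + T.length = (exposed V.toFinset n).card := by
      rw [← List.toFinset_card_of_nodup hT]
      refine Finset.card_sdiff_add_card_eq_card fun t ht => ?_
      rw [List.mem_toFinset] at ht
      exact mem_exposed.2 ⟨List.mem_toFinset.2 (hTV t ht), hn₃ ht⟩
    -- The vertices for `Z` have their partners among the exposed vertices outside `T` and the `|Z|
    -- - q` vertices for `Y`, so at least `q` vertices outside `T` are exposed. Truncation in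
    -- `needed` is harmless, as only a lower bound is claimed.
    have hle : Z.toFinset.card ≤ (X.image (fun x => ((0 : ℕ), x)) ∪
        (Z.drop q).toFinset.image fun r => ((2 : ℕ), r)).card := by
      refine Finset.card_le_card_of_injOn (fun p => g (1, p)) (fun p hp => ?_) fun p _ p' _ hpp => ?_
      · rw [Finset.mem_coe, List.mem_toFinset] at hp
        have hpV : ((1 : ℕ), p) ∈ gadgetV V T Z (Z.drop q) := mem_gadgetV.2 (.inr (.inl ⟨p, hp, rfl⟩))
        have h₁ := hg.adj _ (hgx _ hpV)
        have h₁' := h₁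
        rw [rel, mem_gadgetE] at h₁
        simp only [Finset.mem_coe, Finset.mem_union, Finset.mem_image, List.mem_toFinset]
        rcases h₁ with ⟨a, b, _, _, _, h₄, _⟩ | ⟨p', hp', v, h₁, h₂, h₃, h₄⟩ | ⟨p', hp', r, hr, h₄⟩
        · simp at h₄
        · rcases h₄ with ⟨h₄, _⟩ | ⟨_, h₅⟩
          · simp at h₄
          · left
            refine ⟨v, ?_, h₅.symm⟩
            have hgv' : g (0, v) = (1, p) := by rw [← h₅, hg.invol]
            have hv := (h.isGraph_gadget fun p hp => hp).right_mem h₁'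
            rw [h₅, List.mem_toFinset, mem_gadgetV] at hv
            obtain ⟨v', hv', hvT, hvv⟩ : ∃ v' ∈ V, v' ∉ T ∧ v = v' := by simpa using hv
            subst hvv
            rw [hX, Finset.mem_sdiff, List.mem_toFinset, mem_exposed, List.mem_toFinset]
            exact ⟨⟨hv', hn₂ hgv'⟩, hvT⟩
        · rcases h₄ with ⟨_, h₅⟩ | ⟨h₄, _⟩
          · exact .inr ⟨r, hr, h₅.symm⟩
          · simp at h₄
      · simpa using hg.inj hpp
    have h₁ := Finset.card_union_le (X.image (fun x => ((0 : ℕ), x)))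
      ((Z.drop q).toFinset.image fun r => ((2 : ℕ), r))
    have h₂ := Finset.card_image_le (s := X) (f := fun x => ((0 : ℕ), x))
    have h₃ := Finset.card_image_le (s := (Z.drop q).toFinset) (f := fun r => ((2 : ℕ), r))
    have h₄ := List.toFinset_card_le (Z.drop q)
    rw [List.length_drop] at h₄
    rw [List.toFinset_card_of_nodup hZn] at hle
    rw [needed, h.arcs.length_expL h.nodup] at hqdef
    omega

end Searched

end

end MatchingGap

/-! ### Completeness of the test for a gap -/

namespace MatchingGap

section

universe v

variable {α : Type v} [DecidableEq α]

theorem exists_isMat_of_rel {β : Type*} {E R : β → β → Prop} 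
    (hRE : ∀ x y, R x y → E x y) (hs : ∀ x y, R x y → R y x)
    (hf : ∀ x y z, R x y → R x z → y = z) : ∃ m, IsMat E m ∧ ∀ x y, R x y → m x = y := by
  classical
  let m : β → β := fun x => if h : ∃ y, R x y then h.choose else x
  have hm : ∀ x y, R x y → m x = y := fun x y h => by
    have h' : ∃ y, R x y := ⟨y, h⟩
    simp only [m, dif_pos h']
    exact hf x _ _ h'.choose_spec h
  have hm' : ∀ x, m x ≠ x → R x (m x) := fun x h => by
    by_cases h' : ∃ y, R x y
    · obtain ⟨y, hy⟩ := h'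
      rwa [hm x y hy]
    · exact absurd (by simp only [m, dif_neg h']) h
  refine ⟨m, ⟨fun x => ?_, fun x h => hRE _ _ (hm' x h)⟩, hm⟩
  by_cases h : m x = x
  · rw [h, h]
  · exact hm _ _ (hs _ _ (hm' x h))

namespace Searched

variable {V D : List α} {E M : List (α × α)} {m : α → α}

/-- A matching `n` all of whose exposed vertices outside `T` are matched to the free bases in `U`
by `x` gives a perfect matching of the auxiliary graph. -/
theorem testZ_of_matching (h : Searched V E M D m) {T : List α} {n : α → α}
    (hn : IsMat (rel E) n) (hTn : ∀ t ∈ T, n t = t) {U : Finset α} {x : α → α}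
    (hU : ∀ p ∈ U, p ∈ freeBases E M D T)
    (hx : ∀ p ∈ U, n (x p) = x p ∧ x p ∉ T ∧ conn E D p (x p) = true ∧ touches E T (x p) = false)
    (hcov : ∀ v ∈ V, n v = v → v ∉ T → ∃ p ∈ U, x p = v) {q : ℕ} (hq : q = U.card) :
    testZ V E D T (freeBases E M D T) q = true := by
  set Z := freeBases E M D T with hZ
  have hZn : Z.Nodup := h.nodup_freeBases T
  have hUZ : U ⊆ Z.toFinset := fun p hp => List.mem_toFinset.2 (hU p hp)
  have hZc := List.toFinset_card_of_nodup hZn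
  have hqZ : q ≤ Z.length := by
    rw [hq, ← hZc]
    exact Finset.card_le_card hUZ
  rw [testZ, Bool.and_eq_true, Nat.ble_eq]
  refine ⟨hqZ, ?_⟩
  have hYn : (Z.drop q).Nodup := hZn.sublist (List.drop_sublist _ _)
  have hGr := h.isGraph_gadget (T := T) (Z := Z) (Y := Z.drop q) fun p hp => hp
  rw [perfectL_iff (nodup_gadgetV h.nodup hZn hYn) hGr]
  set Y := Z.drop q with hY
  -- Only the length of `Y` matters: exactly the free bases outside `U` have to be absorbed by
  -- vertices of `Y`.
  have hcard : (Z.toFinset \ U).card = Y.toFinset.card := by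
    rw [Finset.card_sdiff_of_subset hUZ, hZc, List.toFinset_card_of_nodup hYn, hY,
      List.length_drop, hq]
  let e := Finset.equivOfCardEq hcard
  have he : ∀ p : ↥(Z.toFinset \ U), (p : α) ∈ Z ∧ (p : α) ∉ U := fun p => by
    have := p.2
    rwa [Finset.mem_sdiff, List.mem_toFinset] at this
  have hxinj : ∀ p ∈ U, ∀ p' ∈ U, x p = x p' → p = p' := fun p hp p' hp' hpp =>
    h.base_unique (mem_freeBases.1 (hU p hp)).1 (mem_freeBases.1 (hU p' hp')).1
      (conn_trans (hx p hp).2.2.1 (hpp ▸ h.csymm (hx p' hp').2.2.1))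
  -- The matching of the auxiliary graph as a symmetric relation: the edges of `n`, the pairs of `x
  -- p` and `p` for `p` in `U`, and a bijection `e` of the other free bases with `Y`.
  let R : ℕ × α → ℕ × α → Prop := fun a b =>
    (∃ v, n v ≠ v ∧ a = (0, v) ∧ b = (0, n v)) ∨
    (∃ p ∈ U, a = (0, x p) ∧ b = (1, p)) ∨ (∃ p ∈ U, a = (1, p) ∧ b = (0, x p)) ∨
    (∃ p : ↥(Z.toFinset \ U), a = (1, (p : α)) ∧ b = (2, (e p : α))) ∨
    ∃ p : ↥(Z.toFinset \ U), a = (2, (e p : α)) ∧ b = (1, (p : α))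
  obtain ⟨g, hg, hgR⟩ : ∃ g, IsMat (rel (gadgetE E D T Z Y)) g ∧ ∀ a b, R a b → g a = b := by
    refine exists_isMat_of_rel (fun a b hab => ?_) (fun a b hab => ?_)
      fun a b c hab hac => ?_
    · rw [rel, mem_gadgetE]
      rcases hab with ⟨v, hv, h₁, h₂⟩ | ⟨p, hp, h₁, h₂⟩ | ⟨p, hp, h₁, h₂⟩ | ⟨p, h₁, h₂⟩ | ⟨p, h₁, h₂⟩
      · refine .inl ⟨v, n v, hn.adj v hv, fun hvT => hv (hTn v hvT), fun hvT => hv ?_, h₁, h₂⟩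
        have := hTn _ hvT
        rw [hn.invol] at this
        exact this.symm
      · obtain ⟨_, _, h₃, h₄⟩ := hx p hp
        exact .inr (.inl ⟨p, hU p hp, x p, conn_mem h₃, h₃, h₄, .inl ⟨h₁, h₂⟩⟩)
      · obtain ⟨_, _, h₃, h₄⟩ := hx p hp
        exact .inr (.inl ⟨p, hU p hp, x p, conn_mem h₃, h₃, h₄, .inr ⟨h₁, h₂⟩⟩)
      · exact .inr (.inr ⟨p, (he p).1, e p, List.mem_toFinset.1 (e p).2, .inl ⟨h₁, h₂⟩⟩)
      · exact .inr (.inr ⟨p, (he p).1, e p, List.mem_toFinset.1 (e p).2, .inr ⟨h₁, h₂⟩⟩)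
    · rcases hab with ⟨v, hv, h₁, h₂⟩ | ⟨p, hp, h₁, h₂⟩ | ⟨p, hp, h₁, h₂⟩ | ⟨p, h₁, h₂⟩ | ⟨p, h₁, h₂⟩
      · exact .inl ⟨n v, fun h' => hv (hn.inj h'), h₂, by rw [hn.invol, h₁]⟩
      · exact .inr (.inr (.inl ⟨p, hp, h₂, h₁⟩))
      · exact .inr (.inl ⟨p, hp, h₂, h₁⟩)
      · exact .inr (.inr (.inr (.inr ⟨p, h₂, h₁⟩)))
      · exact .inr (.inr (.inr (.inl ⟨p, h₂, h₁⟩)))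
    · rcases hab with ⟨v, hv, rfl, rfl⟩ | ⟨p, hp, rfl, rfl⟩ | ⟨p, hp, rfl, rfl⟩ | ⟨p, rfl, rfl⟩ |
        ⟨p, rfl, rfl⟩ <;>
      rcases hac with ⟨v', hv', h₁, rfl⟩ | ⟨p', hp', h₁, rfl⟩ | ⟨p', hp', h₁, rfl⟩ |
        ⟨p', h₁, rfl⟩ | ⟨p', h₁, rfl⟩ <;>
      simp only [Prod.mk.injEq, true_and, OfNat.ofNat_ne_zero, OfNat.zero_ne_ofNat, zero_ne_one,
        one_ne_zero, OfNat.ofNat_ne_one, OfNat.one_ne_ofNat, false_and] at h₁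
      · rw [h₁]
      · exact absurd (hx p' hp').1 (h₁ ▸ hv)
      · exact absurd (hx p hp).1 (h₁ ▸ hv')
      · rw [hxinj p hp p' hp' h₁]
      · rw [h₁]
      · exact absurd hp (h₁ ▸ (he p').2)
      · exact absurd hp' (h₁ ▸ (he p).2)
      · rw [Subtype.ext h₁]
      · rw [e.injective (Subtype.ext h₁)]
  refine ⟨g, hg, fun a ha haa => ?_⟩
  suffices H : ∃ b, R a b ∧ b ≠ a by
    obtain ⟨b, hb, hne⟩ := H
    exact hne (by rw [← hgR a b hb, haa])
  rw [mem_gadgetV] at ha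
  rcases ha with ⟨v, hv, hvT, rfl⟩ | ⟨p, hp, rfl⟩ | ⟨r, hr, rfl⟩
  · by_cases hnv : n v = v
    · obtain ⟨p, hp, rfl⟩ := hcov v hv hnv hvT
      exact ⟨(1, p), .inr (.inl ⟨p, hp, rfl, rfl⟩), by simp⟩
    · exact ⟨(0, n v), .inl ⟨v, hnv, rfl, rfl⟩, by simpa using hnv⟩
  · by_cases hpU : p ∈ U
    · exact ⟨(0, x p), .inr (.inr (.inl ⟨p, hpU, rfl, rfl⟩)), by simp⟩
    · exact ⟨(2, (e ⟨p, by simp [hp, hpU]⟩ : α)), .inr (.inr (.inr (.inl ⟨_, rfl, rfl⟩))), by simp⟩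
  · refine ⟨(1, (e.symm ⟨r, List.mem_toFinset.2 hr⟩ : α)),
      .inr (.inr (.inr (.inr ⟨_, ?_, rfl⟩))), by simp⟩
    rw [e.apply_symm_apply]

/-- If there is a maximal matching with gap exactly `j`, then the test succeeds for a set of at
most `4 * j` vertices. -/
theorem complete (h : Searched V E M D m) {n : α → α} (hn : IsMat (rel E) n)
    (hind : ∀ x ∈ exposed V.toFinset n, ∀ y ∈ exposed V.toFinset n, ¬ rel E x y) {j : ℕ}
    (hj : (exposed V.toFinset n).card = (exposed V.toFinset m).card + 2 * j) :
    ∃ S : Finset α, S.card ≤ 4 * j ∧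
      testT V E M D j (V.filter fun v => decide (v ∈ S)) = true := by
  classical
  set I := exposed V.toFinset n with hI
  set B := bases V.toFinset m {x | x ∈ D} with hB
  have hBL : ∀ p, p ∈ B ↔ p ∈ basesL M D := fun p => by
    rw [h.mem_basesL]
    simp only [hB, bases, Finset.mem_filter, Set.mem_ofPred_eq, and_iff_right_iff_imp]
    exact fun hp => h.wit.sub p hp.1
  -- `J p` consists of the exposed vertices in the component of `p`. `W` is the set of bases whose
  -- component has a vertex matched by `n` out of `D`, and `U` the set of bases outside `W` with
  -- exactly one exposed vertex in the component.
  let J : α → Finset α := fun p => I.filter fun x => conn E D p x = true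
  let W : Finset α := B.filter fun p => ∃ v, conn E D p v = true ∧ n v ≠ v ∧ n v ∉ D
  let U : Finset α := (B \ W).filter fun p => (J p).card = 1
  have hdisj : ∀ p ∈ B, ∀ p' ∈ B, ∀ z, conn E D p z = true → conn E D p' z = true → p = p' :=
    fun p hp p' hp' z hz hz' => h.base_unique ((hBL p).1 hp) ((hBL p').1 hp')
      (conn_trans hz (h.csymm hz'))
  -- Distinct components send distinct vertices to the outside neighbours of `D`.
  have hW : W.card ≤ (nbrs V.toFinset (rel E) {x | x ∈ D}).card := by
    have hW' : ∀ p ∈ W, ∃ v, conn E D p v = true ∧ n v ≠ v ∧ n v ∉ D := fun p hp =>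
      (Finset.mem_filter.1 hp).2
    choose! f hf using hW'
    refine Finset.card_le_card_of_injOn (fun p => n (f p)) (fun p hp => ?_) fun p hp p' hp' hpp => ?_
    · obtain ⟨h₁, h₂, h₃⟩ := hf p hp
      have hadj := hn.adj _ h₂
      simp only [nbrs, Finset.coe_filter, Set.mem_ofPred_eq]
      exact ⟨h.graph.right_mem hadj, h₃, f p, conn_mem h₁, hadj⟩
    · have h₁ := hn.inj hpp
      refine hdisj p (Finset.mem_filter.1 hp).1 p' (Finset.mem_filter.1 hp').1 (f p) (hf p hp).1 ?_
      rw [h₁]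
      exact (hf p' hp').1
  have hJ : ∀ p ∈ B \ W, 1 ≤ (J p).card := by
    intro p hp
    rw [Finset.mem_sdiff] at hp
    have hpB := h.mem_basesL.1 ((hBL p).1 hp.1)
    obtain ⟨z, hzD, hzK, hz⟩ := h.wit.exists_base h.mat hn hpB.1 hpB.2
    have hpz : conn E D p z = true := by
      have : z ∈ {y | conn E D p y = true} := by
        rw [← hzK]
        exact conn_refl hzD
      exact this
    have hzz : n z = z := by
      by_contra hzz
      exact hp.2 (Finset.mem_filter.2 ⟨hp.1, z, hpz, hzz, hz.resolve_left hzz⟩)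
    exact Finset.card_pos.2 ⟨z, Finset.mem_filter.2 ⟨mem_exposed.2 ⟨h.wit.sub z hzD, hzz⟩, hpz⟩⟩
  have hsum : ∑ p ∈ B \ W, (J p).card ≤ I.card := by
    rw [← Finset.card_biUnion]
    · refine Finset.card_le_card fun z hz => ?_
      obtain ⟨p, _, hz⟩ := Finset.mem_biUnion.1 hz
      exact (Finset.mem_filter.1 hz).1
    · intro p hp p' hp' hne
      change Disjoint (J p) (J p')
      rw [Finset.disjoint_left]
      intro z hz hz'
      rw [Finset.mem_coe, Finset.mem_sdiff] at hp hp'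
      exact hne (hdisj p hp.1 p' hp'.1 z (Finset.mem_filter.1 hz).2 (Finset.mem_filter.1 hz').2)
  -- Each `J p` has at least two elements, except for one element if `p` is in `U`.
  have hlow : 2 * (B \ W).card ≤ ∑ p ∈ B \ W, (J p).card + U.card := by
    have h₁ : U.card = ∑ p ∈ B \ W, if (J p).card = 1 then 1 else 0 := by
      rw [Finset.card_filter]
    rw [h₁, ← Finset.sum_add_distrib, mul_comm, ← smul_eq_mul, ← Finset.sum_const]
    refine Finset.sum_le_sum fun p hp => ?_
    have := hJ p hp
    split <;> omega
  have hBc := h.wit.card_bases h.graph h.mat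
  rw [← hB] at hBc
  have hBW : (B \ W).card + W.card = B.card :=
    Finset.card_sdiff_add_card_eq_card (Finset.filter_subset _ _)
  have hUone : ∀ p ∈ U, ∃ z, J p = {z} := fun p hp =>
    Finset.card_eq_one.1 (Finset.mem_filter.1 hp).2
  have hUB : ∀ p ∈ U, p ∈ B := fun p hp =>
    (Finset.mem_sdiff.1 (Finset.mem_filter.1 hp).1).1
  choose! x hx using hUone
  have hxJ : ∀ p ∈ U, x p ∈ I ∧ conn E D p (x p) = true := fun p hp => by
    have : x p ∈ J p := by rw [hx p hp]; simp
    exact Finset.mem_filter.1 this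
  have hxinj : Set.InjOn x U := fun p hp p' hp' hpp =>
    hdisj p (hUB p hp) p' (hUB p' hp') (x p) (hxJ p hp).2 (hpp ▸ (hxJ p' hp').2)
  -- The guess: all exposed vertices other than the lone ones of the components of `U`.
  let S : Finset α := I \ U.image x
  have hS : S.card + U.card = I.card := by
    rw [← Finset.card_image_of_injOn hxinj]
    refine Finset.card_sdiff_add_card_eq_card fun z hz => ?_
    obtain ⟨p, hp, rfl⟩ := Finset.mem_image.1 hz
    exact (hxJ p hp).1
  set T := V.filter fun v => decide (v ∈ S) with hTdef
  have hmemT : ∀ v, v ∈ T ↔ v ∈ S := fun v => by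
    rw [hTdef, List.mem_filter, decide_eq_true_eq, and_iff_right_iff_imp]
    intro hv
    exact List.mem_toFinset.1 (mem_exposed.1 (Finset.mem_sdiff.1 hv).1).1
  have hTlen : T.length = S.card := by
    rw [← List.toFinset_card_of_nodup (h.nodup.filter _)]
    congr 1
    ext v
    rw [List.mem_toFinset, hmemT]
  have hSI : ∀ t ∈ T, t ∈ I := fun t ht => (Finset.mem_sdiff.1 ((hmemT t).1 ht)).1
  -- With `d` the deficiency, `|B \ W| ≥ d` gives `|U| ≥ 2d - |I| = d - 2j`, hence `|S| = |I| - |U|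
  -- ≤ 4j`.
  have hbound : S.card ≤ 4 * j := by
    have h₁ : (B \ W).card ≥ (exposed V.toFinset m).card := by omega
    omega
  refine ⟨S, hbound, ?_⟩
  rw [testT, Bool.and_eq_true, List.all_eq_true]
  constructor
  · intro t ht
    rw [Bool.not_eq_true', ← Bool.not_eq_true, touches_iff]
    rintro ⟨t', ht', h₁⟩
    exact hind t' (hSI t' ht') t (hSI t ht) h₁
  · refine h.testZ_of_matching hn (fun t ht => (mem_exposed.1 (hSI t ht)).2) (U := U) (x := x)
      (fun p hp => ?_) (fun p hp => ?_) (fun v hv hnv hvT => ?_) ?_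
    · refine mem_freeBases.2 ⟨(hBL p).1 (hUB p hp), fun t ht => ?_⟩
      by_contra hc
      have : t ∈ J p := Finset.mem_filter.2 ⟨hSI t ht, by simpa using hc⟩
      rw [hx p hp, Finset.mem_singleton] at this
      exact (Finset.mem_sdiff.1 ((hmemT t).1 ht)).2 (this ▸ Finset.mem_image_of_mem x hp)
    · obtain ⟨h₁, h₂⟩ := hxJ p hp
      refine ⟨(mem_exposed.1 h₁).2, fun hxT => ?_, h₂, ?_⟩
      · exact (Finset.mem_sdiff.1 ((hmemT _).1 hxT)).2 (Finset.mem_image_of_mem x hp)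
      · rw [← Bool.not_eq_true, touches_iff]
        rintro ⟨t, ht, h₃⟩
        exact hind t (hSI t ht) _ h₁ h₃
    · have hvI : v ∈ I := mem_exposed.2 ⟨List.mem_toFinset.2 hv, hnv⟩
      rw [hmemT, Finset.mem_sdiff, not_and, not_not] at hvT
      obtain ⟨p, hp, hpv⟩ := Finset.mem_image.1 (hvT hvI)
      exact ⟨p, hp, hpv⟩
    -- The number to be exposed outside `T` is `|I| - |S| = |U|`.
    · rw [needed, h.arcs.length_expL h.nodup, hTlen]
      omega

end Searched

end

end MatchingGap

/-! ### Polynomial running time of the search and of the tests -/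

namespace MatchingGap

open Enc (enc)

section

universe v

variable {α : Type v} {γ : Type*} [DecidableEq α] [Enc α] [Enc γ] [PEq α]

@[fun_prop]
theorem PT.expL {V : γ → List α} {M : γ → List (α × α)} (hV : PT V) (hM : PT M) :
    PT fun g => expL (V g) (M g) := by
  unfold MatchingGap.expL
  fun_prop

omit [PEq α] in
theorem esize_reachStep (E : List (α × α)) (D S : List α) : esize (reachStep E D S) ≤ esize D :=
  esize_sublist (List.filter_sublist)

@[fun_prop]
theorem PT.reachStep {E : γ → List (α × α)} {D S : γ → List α} (hE : PT E) (hD : PT D)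
    (hS : PT S) : PT fun g => reachStep (E g) (D g) (S g) := by
  unfold MatchingGap.reachStep
  fun_prop

@[fun_prop]
theorem PT.reachL {E : γ → List (α × α)} {D : γ → List α} {v : γ → α} (hE : PT E) (hD : PT D)
    (hv : PT v) : PT fun g => reachL (E g) (D g) (v g) := by
  unfold MatchingGap.reachL
  refine PT.iterate (f := fun g => MatchingGap.reachStep (E g) (D g)) (by fun_prop) (by fun_prop)
    (by fun_prop) hD.bd fun g k _ => ?_
  cases k with
  | zero => exact esize_sublist List.filter_sublist
  | succ k => rw [Function.iterate_succ_apply']; exact esize_reachStep _ _ _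

@[fun_prop]
theorem PT.conn {E : γ → List (α × α)} {D : γ → List α} {u v : γ → α} (hE : PT E) (hD : PT D)
    (hu : PT u) (hv : PT v) : PT fun g => conn (E g) (D g) (u g) (v g) := by
  unfold MatchingGap.conn
  fun_prop

@[fun_prop]
theorem PT.earlier {E : γ → List (α × α)} {D : γ → List α} {x : γ → α} (hE : PT E) (hD : PT D)
    (hx : PT x) : PT fun g => earlier (E g) (D g) (x g) := by
  unfold MatchingGap.earlier
  fun_prop

@[fun_prop]
theorem PT.canGrow {E : γ → List (α × α)} {D : γ → List α} {a : γ → α × α} (hE : PT E)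
    (hD : PT D) (ha : PT a) : PT fun g => canGrow (E g) (D g) (a g) := by
  unfold MatchingGap.canGrow
  fun_prop

@[fun_prop]
theorem PT.growStep {E M : γ → List (α × α)} {D : γ → List α} (hE : PT E) (hM : PT M)
    (hD : PT D) : PT fun g => growStep (E g) (M g) (D g) := by
  unfold MatchingGap.growStep
  fun_prop

-- The one vertex that may be added is the head of an arc of `M`, so the growth per step is at most
-- additive and all iterates stay polynomial.
omit [PEq α] in
theorem esize_growStep (E M : List (α × α)) (D : List α) :
    esize (growStep E M D) ≤ esize D + esize M := by
  rcases growStep_cases E M D with ⟨h, _⟩ | ⟨a, ha, _, h⟩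
  · rw [h]; omega
  · rw [h]
    have h₁ := esize_append D [a.2]
    have h₂ := esize_le_of_mem ha
    simp only [esize_cons, esize_nil, esize_prod] at h₁ h₂
    omega

@[fun_prop]
theorem PT.growL {V : γ → List α} {E M : γ → List (α × α)} (hV : PT V) (hE : PT E) (hM : PT M) :
    PT fun g => growL (V g) (E g) (M g) := by
  unfold MatchingGap.growL
  refine PT.iterate (f := fun g => MatchingGap.growStep (E g) (M g)) (by fun_prop) (by fun_prop)
    (by fun_prop) (B := fun g => esize (V g) + esize (V g) * esize (M g))
    (by have := hV.bd; have := hM.bd; fun_prop) fun g k hk => ?_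
  have h₁ : ∀ k, esize ((MatchingGap.growStep (E g) (M g))^[k] (MatchingGap.expL (V g) (M g))) ≤
      esize (V g) + k * esize (M g) := by
    intro k
    induction k with
    | zero =>
      have : esize (MatchingGap.expL (V g) (M g)) ≤ esize (V g) :=
        esize_sublist List.filter_sublist
      simpa using this
    | succ k ih =>
      rw [Function.iterate_succ_apply', Nat.succ_mul]
      have := esize_growStep (E g) (M g)
        ((MatchingGap.growStep (E g) (M g))^[k] (MatchingGap.expL (V g) (M g)))
      omega
  exact (h₁ k).trans (Nat.add_le_add_left
    (Nat.mul_le_mul_right _ (hk.trans (length_lt_esize (V g)).le)) _)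

@[fun_prop]
theorem PT.checkL {E M : γ → List (α × α)} {D : γ → List α} (hE : PT E) (hM : PT M)
    (hD : PT D) : PT fun g => checkL (E g) (M g) (D g) := by
  unfold MatchingGap.checkL
  fun_prop

@[fun_prop]
theorem PT.isMaxL {V : γ → List α} {E M : γ → List (α × α)} (hV : PT V) (hE : PT E) (hM : PT M) :
    PT fun g => isMaxL (V g) (E g) (M g) := by
  unfold MatchingGap.isMaxL
  fun_prop

@[fun_prop]
theorem PT.delEdge {e : γ → α × α} {E : γ → List (α × α)} (he : PT e) (hE : PT E) :
    PT fun g => delEdge (e g) (E g) := by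
  unfold MatchingGap.delEdge
  fun_prop

@[fun_prop]
theorem PT.thinStep {V : γ → List α} {M E : γ → List (α × α)} {e : γ → α × α} (hV : PT V)
    (hM : PT M) (hE : PT E) (he : PT e) : PT fun g => thinStep (V g) (M g) (E g) (e g) := by
  unfold MatchingGap.thinStep
  fun_prop

omit [Enc α] [PEq α] in
theorem foldl_thinStep_sublist (V : List α) (M L E : List (α × α)) :
    (L.foldl (thinStep V M) E).Sublist E := by
  induction L generalizing E with
  | nil => exact List.Sublist.refl _
  | cons a L ih =>
    refine (ih _).trans ?_
    rw [thinStep]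
    cases (!decide (a ∈ M) && !isMaxL V (delEdge a E) M)
    · exact List.Sublist.refl _
    · exact List.filter_sublist

@[fun_prop]
theorem PT.thin {V : γ → List α} {E M : γ → List (α × α)} (hV : PT V) (hE : PT E) (hM : PT M) :
    PT fun g => thin (V g) (E g) (M g) := by
  unfold MatchingGap.thin
  exact PT.foldl (step := fun g => MatchingGap.thinStep (V g) (M g)) hE hE (by fun_prop) hE.bd
    fun g k => esize_sublist (foldl_thinStep_sublist _ _ _ _)

@[fun_prop]
theorem PT.augL {E M E' : γ → List (α × α)} (hE : PT E) (hM : PT M) (hE' : PT E') :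
    PT fun g => augL (E g) (M g) (E' g) := by
  unfold MatchingGap.augL
  fun_prop

@[fun_prop]
theorem PT.maxStep {V : γ → List α} {E M : γ → List (α × α)} (hV : PT V) (hE : PT E)
    (hM : PT M) : PT fun g => maxStep (V g) (E g) (M g) := by
  unfold MatchingGap.maxStep
  fun_prop

@[fun_prop]
theorem PT.maxL {V : γ → List α} {E : γ → List (α × α)} (hV : PT V) (hE : PT E) :
    PT fun g => maxL (V g) (E g) := by
  unfold MatchingGap.maxL
  refine PT.iterate (f := fun g => MatchingGap.maxStep (V g) (E g)) (by fun_prop) (by fun_prop)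
    (by fun_prop) hE.bd fun g k _ => ?_
  -- The iterates have codes no larger than that of `E`: a new matching is a sublist of `E`.
  refine iterate_induction (P := fun M => esize M ≤ esize (E g)) (fun M hM => ?_)
    (show esize ([] : List (α × α)) ≤ _ from esize_pos _) k
  rw [MatchingGap.maxStep]
  cases MatchingGap.isMaxL (V g) (E g) M
  · exact esize_sublist List.filter_sublist
  · exact hM

@[fun_prop]
theorem PT.touches {E : γ → List (α × α)} {T : γ → List α} {v : γ → α} (hE : PT E) (hT : PT T)
    (hv : PT v) : PT fun g => touches (E g) (T g) (v g) := by
  unfold MatchingGap.touches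
  fun_prop

@[fun_prop]
theorem PT.freeBases {E M : γ → List (α × α)} {D T : γ → List α} (hE : PT E) (hM : PT M)
    (hD : PT D) (hT : PT T) : PT fun g => freeBases (E g) (M g) (D g) (T g) := by
  unfold MatchingGap.freeBases MatchingGap.basesL
  fun_prop

@[fun_prop]
theorem PT.gadgetV {V T Z Y : γ → List α} (hV : PT V) (hT : PT T) (hZ : PT Z) (hY : PT Y) :
    PT fun g => gadgetV (V g) (T g) (Z g) (Y g) := by
  unfold MatchingGap.gadgetV
  fun_prop

@[fun_prop]
theorem PT.gadgetE {E : γ → List (α × α)} {D T Z Y : γ → List α} (hE : PT E) (hD : PT D)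
    (hT : PT T) (hZ : PT Z) (hY : PT Y) :
    PT fun g => gadgetE (E g) (D g) (T g) (Z g) (Y g) := by
  unfold MatchingGap.gadgetE
  fun_prop

@[fun_prop]
theorem PT.perfectL {V : γ → List α} {E : γ → List (α × α)} (hV : PT V) (hE : PT E) :
    PT fun g => perfectL (V g) (E g) := by
  unfold MatchingGap.perfectL
  fun_prop

@[fun_prop]
theorem PT.needed {V : γ → List α} {M : γ → List (α × α)} {j : γ → ℕ} {T : γ → List α}
    (hV : PT V) (hM : PT M) (hj : PT j) (hT : PT T) :
    PT fun g => needed (V g) (M g) (j g) (T g) := by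
  unfold MatchingGap.needed
  fun_prop

@[fun_prop]
theorem PT.testZ {V : γ → List α} {E : γ → List (α × α)} {D T Z : γ → List α} {q : γ → ℕ}
    (hV : PT V) (hE : PT E) (hD : PT D) (hT : PT T) (hZ : PT Z) (hq : PT q) :
    PT fun g => testZ (V g) (E g) (D g) (T g) (Z g) (q g) := by
  unfold MatchingGap.testZ
  fun_prop

@[fun_prop]
theorem PT.testT {V : γ → List α} {E M : γ → List (α × α)} {D T : γ → List α} {j : γ → ℕ}
    (hV : PT V) (hE : PT E) (hM : PT M) (hD : PT D) (hj : PT j) (hT : PT T) :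
    PT fun g => testT (V g) (E g) (M g) (D g) (j g) (T g) := by
  unfold MatchingGap.testT
  fun_prop

end

end MatchingGap

namespace MatchingGap

/-! ### Matchings as subgraphs -/

section

variable {V : Type*} {G : SimpleGraph V}

/-- The handshake lemma, all covered vertices having degree one. -/
theorem two_mul_ncard_edgeSet [Finite V] {M : G.Subgraph} (hM : M.IsMatching) :
    2 * M.edgeSet.ncard = M.verts.ncard := by
  classical
  have := Fintype.ofFinite V
  have h₁ := M.spanningCoe.sum_degrees_eq_twice_card_edges
  have h₂ : ∀ v, M.spanningCoe.degree v = if v ∈ M.verts then 1 else 0 := fun v => by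
    rw [SimpleGraph.Subgraph.degree_spanningCoe]
    split_ifs with h
    · exact SimpleGraph.Subgraph.isMatching_iff_forall_degree.1 hM v h
    · exact SimpleGraph.Subgraph.degree_of_notMem_verts h
  rw [Finset.sum_congr rfl fun v _ => h₂ v, Finset.sum_boole] at h₁
  rw [Set.ncard_eq_toFinset_card', Set.ncard_eq_toFinset_card']
  have h₃ : M.edgeSet.toFinset = M.spanningCoe.edgeFinset := by
    ext e
    simp
  rw [h₃, ← h₁, Nat.cast_id]
  congr 1
  ext v
  simp

/-- An edge between exposed vertices can be added. Conversely, a larger matching keeps the mates of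
covered vertices, so that a new edge has both ends exposed. -/
theorem isMaximalMatching_iff {M : G.Subgraph} (hM : M.IsMatching) :
    IsMaximalMatching M ↔ ∀ x ∉ M.verts, ∀ y ∉ M.verts, ¬ G.Adj x y := by
  constructor
  · intro h x hx y hy hxy
    have hs : (M ⊔ G.subgraphOfAdj hxy).IsMatching := by
      refine hM.sup (SimpleGraph.Subgraph.IsMatching.subgraphOfAdj hxy) ?_
      rw [hM.support_eq_verts, SimpleGraph.support_subgraphOfAdj, Set.disjoint_right]
      rintro z (rfl | rfl) <;> assumption
    have := (h.2 hs le_sup_left).1 (show x ∈ (M ⊔ G.subgraphOfAdj hxy).verts by simp)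
    exact hx this
  · intro h
    refine ⟨hM, fun M' hM' hle => ?_⟩
    have hadj : ∀ x y, M'.Adj x y → M.Adj x y := by
      have key : ∀ x y, M'.Adj x y → x ∈ M.verts → M.Adj x y := fun x y hxy hx => by
        obtain ⟨z, hz, _⟩ := hM hx
        rwa [hM'.eq_of_adj_left hxy (hle.2 hz)]
      intro x y hxy
      by_cases hx : x ∈ M.verts
      · exact key x y hxy hx
      by_cases hy : y ∈ M.verts
      · exact (key y x hxy.symm hy).symm
      · exact absurd hxy.adj_sub (h x hx y hy)
    refine ⟨fun x hx => ?_, fun x y => hadj x y⟩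
    obtain ⟨y, hy, _⟩ := hM' hx
    exact (hadj x y hy).fst_mem

end

section

variable {n : ℕ} {G : SimpleGraph (Fin n)}

/-- The adjacency relation on natural numbers. -/
def natAdj (G : SimpleGraph (Fin n)) (x y : ℕ) : Prop :=
  ∃ (hx : x < n) (hy : y < n), G.Adj ⟨x, hx⟩ ⟨y, hy⟩

theorem exists_isMat_of_isMatching {M : G.Subgraph} (hM : M.IsMatching) :
    ∃ m, IsMat (natAdj G) m ∧ ∀ x : Fin n, x ∈ M.verts ↔ m x ≠ x := by
  have hex : ∀ x : ℕ, ∃ y : ℕ,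
      (∃ (hx : x < n) (hy : y < n), M.Adj ⟨x, hx⟩ ⟨y, hy⟩) ∨
        (y = x ∧ ∀ hx : x < n, (⟨x, hx⟩ : Fin n) ∉ M.verts) := fun x => by
    by_cases h : ∃ hx : x < n, (⟨x, hx⟩ : Fin n) ∈ M.verts
    · obtain ⟨hx, h⟩ := h
      obtain ⟨y, hy, _⟩ := hM h
      exact ⟨y, .inl ⟨hx, y.2, hy⟩⟩
    · exact ⟨x, .inr ⟨rfl, fun hx h' => h ⟨hx, h'⟩⟩⟩
  choose m hm using hex
  have hiff : ∀ x : Fin n, x ∈ M.verts ↔ m x ≠ x := fun x => by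
    rcases hm x with ⟨hx, hy, h⟩ | ⟨h₁, h₂⟩
    · exact ⟨fun _ h' => h.adj_sub.ne (Fin.ext h'.symm), fun _ => h.fst_mem⟩
    · exact ⟨fun h => absurd h (h₂ x.2), fun h => absurd h₁ h⟩
  refine ⟨m, ⟨fun x => ?_, fun x hx => ?_⟩, hiff⟩
  · rcases hm x with ⟨hx, hy, h⟩ | ⟨h₁, _⟩
    · rcases hm (m x) with ⟨_, hy', h'⟩ | ⟨_, h₂⟩
      · exact congrArg Fin.val (hM.eq_of_adj_left h' h.symm)
      · exact absurd h.snd_mem (h₂ hy)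
    · rw [h₁, h₁]
  · rcases hm x with ⟨hx, hy, h⟩ | ⟨h₁, _⟩
    · exact ⟨hx, hy, h.adj_sub⟩
    · exact absurd h₁ hx

theorem exists_isMatching_of_isMat {m : ℕ → ℕ} (hm : IsMat (natAdj G) m) :
    ∃ M : G.Subgraph, M.IsMatching ∧ ∀ x : Fin n, x ∈ M.verts ↔ m x ≠ x := by
  refine ⟨{
    verts := {x | m x ≠ x}
    Adj := fun x y => m x = y ∧ m x ≠ x
    adj_sub := ?_
    edge_vert := fun h => h.2
    symm := ?_ }, ?_, fun x => Iff.rfl⟩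
  · rintro x y ⟨h, h'⟩
    obtain ⟨_, hy, h''⟩ := hm.adj x h'
    rwa [show y = ⟨m x, hy⟩ from Fin.ext h.symm]
  · refine ⟨fun x y ⟨h, h'⟩ => ?_⟩
    have hyx : m y = x := by rw [← h, hm.invol]
    refine ⟨hyx, fun h'' => h' ?_⟩
    rw [h, ← h'', hyx]
  · intro x hx
    obtain ⟨_, hy, _⟩ := hm.adj x hx
    exact ⟨⟨m x, hy⟩, ⟨rfl, hx⟩, fun z hz => Fin.ext hz.1.symm⟩

theorem two_mul_ncard_add_card_exposed {M : G.Subgraph} (hM : M.IsMatching) {m : ℕ → ℕ}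
    (h : ∀ x : Fin n, x ∈ M.verts ↔ m x ≠ x) :
    2 * M.edgeSet.ncard + (exposed (Finset.range n) m).card = n := by
  have h₁ : (exposed (Finset.range n) m).card = (M.vertsᶜ).ncard := by
    rw [← Set.ncard_image_of_injective _ Fin.val_injective, ← Set.ncard_coe_finset]
    congr 1
    ext x
    simp only [Finset.mem_coe, mem_exposed, Finset.mem_range, Set.mem_image, Set.mem_compl_iff, h,
      not_not]
    constructor
    · rintro ⟨hx, hmx⟩
      exact ⟨⟨x, hx⟩, hmx, rfl⟩
    · rintro ⟨y, hy, rfl⟩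
      exact ⟨y.2, hy⟩
  rw [two_mul_ncard_edgeSet hM, h₁, Set.ncard_add_ncard_compl, Nat.card_fin]

/-- The matching gap in terms of involutions. -/
theorem le_matchingGap_iff {m : ℕ → ℕ} (hm : IsMat (natAdj G) m)
    (hmin : ∀ m', IsMat (natAdj G) m' →
      (exposed (Finset.range n) m).card ≤ (exposed (Finset.range n) m').card)
    (hind : ∀ x ∈ exposed (Finset.range n) m, ∀ y ∈ exposed (Finset.range n) m, ¬ natAdj G x y)
    {j : ℕ} : j ≤ matchingGap G ↔ ∃ m', IsMat (natAdj G) m' ∧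
      (∀ x ∈ exposed (Finset.range n) m', ∀ y ∈ exposed (Finset.range n) m', ¬ natAdj G x y) ∧
      (exposed (Finset.range n) m).card + 2 * j ≤ (exposed (Finset.range n) m').card := by
  have hmax : ∀ (m' : ℕ → ℕ) (M : G.Subgraph), M.IsMatching → (∀ x : Fin n, x ∈ M.verts ↔ m' x ≠ x) →
      (IsMaximalMatching M ↔ ∀ x ∈ exposed (Finset.range n) m',
        ∀ y ∈ exposed (Finset.range n) m', ¬ natAdj G x y) := fun m' M hM h => by
    rw [isMaximalMatching_iff hM]
    simp only [h, not_not, mem_exposed, Finset.mem_range, natAdj, not_exists]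
    exact ⟨fun h x hx y hy hx' hy' => h ⟨x, hx'⟩ hx.2 ⟨y, hy'⟩ hy.2,
      fun h x hx y hy => h x ⟨x.2, hx⟩ y ⟨y.2, hy⟩ x.2 y.2⟩
  obtain ⟨M, hM, hMm⟩ := exists_isMatching_of_isMat hm
  have hc := two_mul_ncard_add_card_exposed hM hMm
  have hν : matchingNumber G = M.edgeSet.ncard := by
    refine IsGreatest.csSup_eq ⟨⟨M, hM, rfl⟩, ?_⟩
    rintro _ ⟨M', hM', rfl⟩
    obtain ⟨m', hm', h⟩ := exists_isMat_of_isMatching hM'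
    have := two_mul_ncard_add_card_exposed hM' h
    have := hmin m' hm'
    omega
  have hMmax := (hmax m M hM hMm).2 hind
  have hβ : minMaximalMatchingNumber G ≤ M.edgeSet.ncard := Nat.sInf_le ⟨M, hMmax, rfl⟩
  rw [matchingGap, hν]
  constructor
  · intro hj
    obtain ⟨M', hM', h'⟩ : minMaximalMatchingNumber G ∈
        {m | ∃ M : G.Subgraph, IsMaximalMatching M ∧ M.edgeSet.ncard = m} :=
      Nat.sInf_mem ⟨_, M, hMmax, rfl⟩
    obtain ⟨m', hm', h⟩ := exists_isMat_of_isMatching hM'.1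
    have := two_mul_ncard_add_card_exposed hM'.1 h
    exact ⟨m', hm', (hmax m' M' hM'.1 h).1 hM', by omega⟩
  · rintro ⟨m', hm', hind', hle⟩
    obtain ⟨M', hM', h⟩ := exists_isMatching_of_isMat hm'
    have := two_mul_ncard_add_card_exposed hM' h
    have h₂ : minMaximalMatchingNumber G ≤ M'.edgeSet.ncard :=
      Nat.sInf_le ⟨M', (hmax m' M' hM' h).2 hind', rfl⟩
    omega

theorem matchingGap_le (G : SimpleGraph (Fin n)) : matchingGap G ≤ n := by
  refine (Nat.sub_le _ _).trans (csSup_le ⟨0, ⊥, by intro x hx; exact hx.elim, by simp⟩ ?_)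
  rintro _ ⟨M, hM, rfl⟩
  obtain ⟨m, _, h⟩ := exists_isMat_of_isMatching hM
  have := two_mul_ncard_add_card_exposed hM h
  omega

end

/-! ### Adjusting the number of exposed vertices -/

section

variable {α : Type*} [DecidableEq α]

/-- Between the numbers of exposed vertices of a minimum and of another matching, all those of
the right parity are attained without exposing new vertices. -/
theorem exists_isMat_card_exposed {V : Finset α} {E : α → α → Prop} {m m' : α → α}
    (hG : IsGraph V E) (hm : IsMat E m) (hm' : IsMat E m') {j : ℕ}
    (hle : (exposed V m).card + 2 * j ≤ (exposed V m').card) :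
    ∃ n, IsMat E n ∧ exposed V n ⊆ exposed V m' ∧
      (exposed V n).card = (exposed V m).card + 2 * j := by
  obtain ⟨d, hd⟩ := Nat.exists_eq_add_of_le hle
  have h₁ := card_exposed_parity hG hm
  have h₂ := card_exposed_parity hG hm'
  obtain ⟨e, rfl⟩ : ∃ e, d = 2 * e := ⟨d / 2, by omega⟩
  clear h₂ hle
  induction e generalizing m' with
  | zero => exact ⟨m', hm', subset_rfl, by omega⟩
  | succ e ih =>
    obtain ⟨n, hn, hs, hc⟩ := exists_augmentation hG hm' hm (by omega)
    obtain ⟨n', hn', hs', hc'⟩ := ih hn (by omega)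
    exact ⟨n', hn', hs'.trans hs, hc'⟩

/-- Exposed vertices are bases, and adjacent ones would be two bases of one class. -/
theorem Searched.indep {V : List α} {E M : List (α × α)} {D : List α} {m : α → α}
    (h : Searched V E M D m) : ∀ x ∈ exposed V.toFinset m, ∀ y ∈ exposed V.toFinset m,
      ¬ rel E x y := fun x hx y hy hxy => by
  rw [mem_exposed] at hx hy
  have hxD := h.wit.exp x hx.1 hx.2
  have hyD := h.wit.exp y hy.1 hy.2
  have := h.wit.base x hxD y hyD (h.wit.cls x hxD y hyD hxy) (.inl hx.2) (.inl hy.2)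
  exact h.graph.irrefl x (this ▸ hxy)

end

end MatchingGap

namespace MatchingGap

open Enc (enc)

/-! ### The algorithm -/

/-- The minimum of `c` and the number with the given binary digits. -/
def cappedValue (c : ℕ) (l : List Bool) : ℕ :=
  l.reverse.foldl (fun a b => bif Nat.ble (a + a + bif b then 1 else 0) c
    then a + a + bif b then 1 else 0 else c) 0

/-- Capping after every step of Horner's scheme gives the capped value, since a value that has
reached `c` never falls below it again. Without the cap the unary code would be exponential in the
number of digits. -/
theorem cappedValue_bits (c k : ℕ) : cappedValue c k.bits = min k c := by
  induction k using Nat.binaryRec' with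
  | zero => simp [cappedValue]
  | bit b k h ih =>
    have hb : Nat.bit b k = k + k + bif b then 1 else 0 := by cases b <;> simp [Nat.bit, two_mul]
    rw [Nat.bits_append_bit k b h, hb]
    simp only [cappedValue, List.reverse_cons, List.foldl_append, List.foldl_cons,
      List.foldl_nil] at ih ⊢
    rw [ih]
    have h₁ : (bif b then 1 else 0) ≤ 1 := by cases b <;> simp
    generalize (bif b then 1 else 0) = d at h₁
    cases h₂ : Nat.ble (min k c + min k c + d) c
    · have : ¬ (min k c + min k c + d ≤ c) := by rw [← Nat.ble_eq, h₂]; simp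
      rw [cond_false]
      omega
    · rw [Nat.ble_eq] at h₂
      rw [cond_true]
      omega

/-- The arcs of the graph with the given adjacency matrix. -/
def arcsOfRows (R : List (List Bool)) : List (ℕ × ℕ) :=
  (List.range R.length).flatMap fun i =>
    ((List.range R.length).filter fun j => (((R.drop i).headD []).drop j).headD false).map
      fun j => (i, j)

open Classical in
/-- The adjacency matrix of a graph. -/
noncomputable def rowsOf {n : ℕ} (G : SimpleGraph (Fin n)) : List (List Bool) :=
  List.ofFn fun i : Fin n => List.ofFn fun j : Fin n => decide (G.Adj i j)

theorem length_rowsOf {n : ℕ} (G : SimpleGraph (Fin n)) : (rowsOf G).length = n := by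
  simp [rowsOf]

theorem rel_arcsOfRows {n : ℕ} (G : SimpleGraph (Fin n)) :
    rel (arcsOfRows (rowsOf G)) = natAdj G := by
  classical
  funext x y
  have h : ∀ (β : Type) (f : Fin n → β) (b : β) (i : ℕ) (hi : i < n),
      ((List.ofFn f).drop i).headD b = f ⟨i, hi⟩ := fun β f b i hi => by
    rw [List.headD_eq_head?_getD, List.head?_drop, List.getElem?_ofFn, dif_pos hi, Option.getD_some]
  simp only [rel, arcsOfRows, length_rowsOf, List.mem_flatMap, List.mem_map, List.mem_filter,
    List.mem_range, natAdj, Prod.mk.injEq, eq_iff_iff]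
  constructor
  · rintro ⟨i, hi, j, ⟨hj, hij⟩, rfl, rfl⟩
    rw [rowsOf, h _ _ _ _ hi, h _ _ _ _ hj, decide_eq_true_eq] at hij
    exact ⟨hi, hj, hij⟩
  · rintro ⟨hx, hy, hxy⟩
    refine ⟨x, hx, y, ⟨hy, ?_⟩, rfl, rfl⟩
    rwa [rowsOf, h _ _ _ _ hx, h _ _ _ _ hy, decide_eq_true_eq]

theorem isGraph_natAdj {n : ℕ} (G : SimpleGraph (Fin n)) :
    IsGraph (Finset.range n) (natAdj G) where
  symm := fun ⟨hx, hy, h⟩ => ⟨hy, hx, h.symm⟩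
  irrefl := fun _ ⟨_, _, h⟩ => h.ne rfl
  left_mem := fun ⟨hx, _, _⟩ => Finset.mem_range.2 hx

section

variable {α : Type*} [DecidableEq α]

/-- The lists in `L` and those with one more element. -/
def growC (V : List α) (L : List (List α)) : List (List α) :=
  L.flatMap fun T => T :: V.map fun v => V.filter fun x => decide (x = v) || decide (x ∈ T)

/-- This count is the only source of a running time that is not polynomial. -/
theorem length_iterate_growC (V : List α) (i : ℕ) :
    ((growC V)^[i] [[]]).length = (V.length + 1) ^ i := by
  induction i with
  | zero => rfl
  | succ i ih =>
    rw [Function.iterate_succ_apply', growC, List.length_flatMap]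
    simp only [List.length_cons, List.length_map, List.map_const', List.sum_replicate, ih,
      smul_eq_mul, pow_succ]

theorem sublist_of_mem_iterate_growC {V : List α} {i : ℕ} :
    ∀ T ∈ (growC V)^[i] [[]], T.Sublist V := by
  induction i with
  | zero => simp
  | succ i ih =>
    intro T hT
    rw [Function.iterate_succ_apply', growC, List.mem_flatMap] at hT
    obtain ⟨T', hT', h⟩ := hT
    rcases List.mem_cons.1 h with rfl | h
    · exact ih _ hT'
    · obtain ⟨v, _, rfl⟩ := List.mem_map.1 h
      exact List.filter_sublist

theorem filter_mem_iterate_growC {V : List α} {i : ℕ} {S : Finset α} (hS : S.card ≤ i) :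
    (V.filter fun v => decide (v ∈ S)) ∈ (growC V)^[i] [[]] := by
  induction i generalizing S with
  | zero => simp [Finset.card_eq_zero.1 (Nat.le_zero.1 hS)]
  | succ i ih =>
    rw [Function.iterate_succ_apply', growC, List.mem_flatMap]
    rcases hS.lt_or_eq with h | h
    · exact ⟨_, ih (Nat.lt_succ_iff.1 h), List.mem_cons_self⟩
    · obtain ⟨a, S', ha, rfl, hc⟩ := Finset.card_eq_succ.1 h
      refine ⟨_, ih hc.le, ?_⟩
      by_cases haV : a ∈ V
      · refine List.mem_cons_of_mem _ (List.mem_map.2 ⟨a, haV, ?_⟩)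
        refine List.filter_congr fun x hx => ?_
        rw [Bool.eq_iff_iff]
        simp [hx]
      -- An element of `S` outside `V` does not change the filtered list, and the smaller lists are
      -- kept in every round.
      · refine List.mem_cons.2 (.inl (List.filter_congr fun x hx => ?_))
        have : x ≠ a := fun h => haV (h ▸ hx)
        rw [Bool.eq_iff_iff]
        simp [this]

end

/-- The test decides whether the gap is at least `j`. -/
theorem any_testT_iff {n : ℕ} {G : SimpleGraph (Fin n)} {E M : List (ℕ × ℕ)} {D : List ℕ}
    {m : ℕ → ℕ} (hE : rel E = natAdj G) (h : Searched (List.range n) E M D m) {j : ℕ} :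
    (((growC (List.range n))^[4 * j] [[]]).any fun T => testT (List.range n) E M D j T) = true ↔
      j ≤ matchingGap G := by
  have hV : (List.range n).toFinset = Finset.range n := List.toFinset_range n
  have hmin : ∀ m', IsMat (rel E) m' →
      (exposed (List.range n).toFinset m).card ≤ (exposed (List.range n).toFinset m').card :=
    fun m' hm' => h.wit.le_card_exposed h.graph h.mat hm'
  have hind := h.indep
  have hm := h.mat
  have key : ∀ j, j ≤ matchingGap G ↔ ∃ m', IsMat (rel E) m' ∧
      (∀ x ∈ exposed (List.range n).toFinset m', ∀ y ∈ exposed (List.range n).toFinset m',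
        ¬ rel E x y) ∧
      (exposed (List.range n).toFinset m).card + 2 * j ≤
        (exposed (List.range n).toFinset m').card := by
    rw [hV, hE] at *
    exact fun j => le_matchingGap_iff hm hmin hind
  rw [key, List.any_eq_true]
  constructor
  · rintro ⟨T, hT, ht⟩
    have hs := sublist_of_mem_iterate_growC T hT
    exact h.sound (List.nodup_range.sublist hs) (fun t ht => hs.subset ht) ht
  · rintro ⟨m', hm', hind', hle⟩
    -- The gap is cut down to exactly `j`, as the bound `4 * j` requires. No new vertex becomes
    -- exposed, so the exposed set stays independent.
    obtain ⟨N, hN, hsub, hc⟩ := exists_isMat_card_exposed h.graph h.mat hm' hle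
    obtain ⟨S, hS, ht⟩ := h.complete hN
      (fun x hx y hy => hind' x (hsub hx) y (hsub hy)) hc
    exact ⟨_, filter_mem_iterate_growC hS, ht⟩

/-- The states of the algorithm: the vertices, the arcs, a maximum matching and a search list, the
capped threshold, a lower bound for the gap and the list of candidate sets. -/
abbrev State : Type :=
  (List ℕ × List (ℕ × ℕ) × List (ℕ × ℕ) × List ℕ) × ℕ × ℕ × List (List ℕ)

/-- The state after `i` turns. -/
def stateAt (x : List (List Bool) × List Bool) (i : ℕ) : State :=
  ((List.range x.1.length, arcsOfRows x.1, maxL (List.range x.1.length) (arcsOfRows x.1),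
    growL (List.range x.1.length) (arcsOfRows x.1)
      (maxL (List.range x.1.length) (arcsOfRows x.1))),
    cappedValue (x.1.length + 1) x.2, i, (growC (List.range x.1.length))^[4 * (i + 1)] [[]])

/-- Whether the lower bound is below the threshold and can be increased. -/
def continues (s : State) : Bool :=
  !(Nat.ble s.2.1 s.2.2.1) &&
    s.2.2.2.any fun T => testT s.1.1 s.1.2.1 s.1.2.2.1 s.1.2.2.2 (s.2.2.1 + 1) T

/-- One turn. -/
def turn (s : State) : State :=
  (s.1, s.2.1, s.2.2.1 + 1, growC s.1.1 (growC s.1.1 (growC s.1.1 (growC s.1.1 s.2.2.2))))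

theorem turn_stateAt (x : List (List Bool) × List Bool) (i : ℕ) :
    turn (stateAt x i) = stateAt x (i + 1) := by
  simp only [turn, stateAt, show 4 * (i + 1 + 1) = (4 * (i + 1)) + 1 + 1 + 1 + 1 by ring,
    Function.iterate_succ_apply']

section

variable {γ : Type*} [Enc γ]

@[fun_prop]
theorem PT.cappedValue {c : γ → ℕ} {l : γ → List Bool} (hc : PT c) (hl : PT l) :
    PT fun g => cappedValue (c g) (l g) := by
  unfold MatchingGap.cappedValue
  refine PT.foldl (l := fun g => (l g).reverse) (init := fun _ => 0)
    (step := fun g a b => bif Nat.ble (a + a + bif b then 1 else 0) (c g)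
      then a + a + bif b then 1 else 0 else c g) (by fun_prop) (by fun_prop) (by fun_prop)
    (B := fun g => esize (c g)) hc.bd fun g k => ?_
  suffices H : ∀ (L : List Bool) (a : ℕ), a ≤ c g →
      L.foldl (fun a b => bif Nat.ble (a + a + bif b then 1 else 0) (c g)
        then a + a + bif b then 1 else 0 else c g) a ≤ c g by
    have := H ((l g).reverse.take k) 0 (Nat.zero_le _)
    simp only [esize_nat]
    omega
  intro L
  induction L with
  | nil => exact fun a h => h
  | cons b L ih =>
    intro a _
    refine ih _ ?_
    dsimp only
    cases h : Nat.ble (a + a + bif b then 1 else 0) (c g)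
    · exact (cond_false ..).le
    · exact Nat.le_of_ble_eq_true h

@[fun_prop]
theorem PT.arcsOfRows {R : γ → List (List Bool)} (hR : PT R) : PT fun g => arcsOfRows (R g) := by
  unfold MatchingGap.arcsOfRows
  have h : PT fun p : (γ × ℕ) × ℕ => ((((R p.1.1).drop p.1.2).headD []).drop p.2).headD false :=
    PT.headD (PT.drop (by fun_prop) (PT.headD (by fun_prop) _ rfl)) _ rfl
  fun_prop

@[fun_prop]
theorem PT.growC {α : Type*} [DecidableEq α] [Enc α] [PEq α] {V : γ → List α}
    {L : γ → List (List α)} (hV : PT V) (hL : PT L) : PT fun g => growC (V g) (L g) := by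
  unfold MatchingGap.growC
  fun_prop

end

theorem pt_turn : PT turn := by
  unfold turn
  fun_prop

theorem pt_continues : PT continues := by
  unfold continues
  fun_prop

theorem pt_stateAt_zero : PT fun x => stateAt x 0 := by
  simp only [stateAt, zero_add, mul_one]
  have h : ∀ V : List ℕ, (growC V)^[4] [[]] = growC V (growC V (growC V (growC V [[]]))) :=
    fun _ => rfl
  simp only [h]
  fun_prop

@[fun_prop]
theorem polyBd_nat : PolyBd fun x : ℕ => x :=
  PolyBd.esize.mono fun x => by rw [esize_nat]; omega

/-- Only the counter and the candidate lists change between turns, and each candidate is a sublist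
of the vertex list. -/
theorem esize_stateAt_le (x : List (List Bool) × List Bool) (i : ℕ) :
    esize (stateAt x i) ≤ esize (stateAt x 0) + 2 * i +
      (x.1.length + 1) ^ (4 * (i + 1)) * (esize (stateAt x 0) + 1) + 1 := by
  have h₁ : esize (List.range x.1.length) ≤ esize (stateAt x 0) := by
    simp only [stateAt, esize_prod]
    omega
  have h₂ := esize_le_of_forall (l := (growC (List.range x.1.length))^[4 * (i + 1)] [[]])
    fun T hT => (esize_sublist (sublist_of_mem_iterate_growC T hT)).trans h₁
  rw [length_iterate_growC, List.length_range] at h₂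
  simp only [stateAt, esize_prod, esize_nat] at h₂ ⊢
  omega

theorem esize_instance_le {n : ℕ} (G : SimpleGraph (Fin n)) (k : ℕ) {X : ℕ}
    (hX : n + Nat.size k ≤ X) : esize (rowsOf G, k.bits) ≤ X * (4 * X + 2) + 4 * X + 3 := by
  have h₁ : esize (rowsOf G) ≤ n * (n * 4 + 1 + 1) + 1 := by
    refine (esize_le_of_forall (B := n * 4 + 1) fun r hr => ?_).trans
      (by rw [length_rowsOf])
    obtain ⟨i, rfl⟩ := (List.mem_ofFn' _ _).1 hr
    refine (esize_le_of_forall (B := 3) fun b _ => esize_bool_le b).trans ?_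
    rw [List.length_ofFn]
  have h₂ := esize_le_of_forall (l := k.bits) (B := 3) fun b _ => esize_bool_le b
  rw [Nat.size_eq_bits_len] at h₂
  rw [esize_prod]
  have h₃ : n * (n * 4 + 1 + 1) ≤ X * (4 * X + 2) := Nat.mul_le_mul (by omega) (by omega)
  dsimp only
  omega

/-- The algorithm decides the problem, in time polynomial in `s ^ (μ + 1)`. -/
theorem exists_decides : ∃ p : Prog, ∃ F : ℕ → ℕ, PolyBd F ∧
    ∀ (n : ℕ) (G : SimpleGraph (Fin n)) (k : ℕ),
      ∃ t ≤ F ((n + Nat.size k + 2) ^ (matchingGap G + 1)),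
        Run p (encodeInstance G k) (encodeBool (decide (k ≤ matchingGap G))) t := by
  obtain ⟨c₀, hc₀⟩ := pt_stateAt_zero.bd
  obtain ⟨p₁, T₁, ⟨c₁, hT₁⟩, h₁⟩ := pt_stateAt_zero
  obtain ⟨p₂, T₂, ⟨c₂, hT₂⟩, h₂⟩ := pt_continues
  obtain ⟨p₃, T₃, ⟨c₃, hT₃⟩, h₃⟩ := pt_turn
  obtain ⟨p₄, T₄, ⟨c₄, hT₄⟩, h₄⟩ :=
    (show PT fun s : State => Nat.ble s.2.1 s.2.2.1 by fun_prop)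
  -- Bounds in terms of `X = s ^ (μ + 1)`, where `s` is the base of the time bound: `I` for the
  -- input, `Z` for every state that occurs, `B` for one run of the guard or of a turn.
  let I : ℕ → ℕ := fun X => X * (4 * X + 2) + 4 * X + 4
  let Z : ℕ → ℕ := fun X => I X ^ c₀ + 2 * X + X ^ 4 * (I X ^ c₀ + 1) + 2
  let B : ℕ → ℕ := fun X => Z X ^ c₂ + Z X ^ c₃
  refine ⟨.seq p₁ (.seq (.loop p₂ p₃) p₄),
    fun X => I X ^ c₁ + ((X + 1) * (2 * B X + 1) + Z X ^ c₄ + 1) + 1, by fun_prop,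
    fun n G k => ?_⟩
  set X := (n + Nat.size k + 2) ^ (matchingGap G + 1) with hX
  have hsX : n + Nat.size k + 2 ≤ X := Nat.le_self_pow (Nat.succ_ne_zero _) _
  have hgX : matchingGap G ≤ X := (matchingGap_le G).trans (by omega)
  let x : List (List Bool) × List Bool := (rowsOf G, k.bits)
  have hx : esize x + 1 ≤ I X := Nat.succ_le_succ (esize_instance_le G k (by omega))
  have hlen : x.1.length = n := length_rowsOf G
  have hz : ∀ i ≤ matchingGap G, esize (stateAt x i) + 1 ≤ Z X := fun i hi => by
    have h₀ : esize (stateAt x 0) ≤ I X ^ c₀ := (hc₀ x).trans (Nat.pow_le_pow_left hx _)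
    -- In state `i` the gap `i + 1` is tested, and `i ≤ μ`; hence the exponent `μ + 1` rather than
    -- `μ`.
    have h₁ : (x.1.length + 1) ^ (4 * (i + 1)) ≤ X ^ 4 := by
      rw [hX, ← pow_mul, mul_comm _ 4]
      exact (Nat.pow_le_pow_left (by omega) _).trans (Nat.pow_le_pow_right (by omega) (by omega))
    have h₂ := esize_stateAt_le x i
    have h₃ := Nat.mul_le_mul h₁ (Nat.succ_le_succ h₀)
    simp only [Z]
    simp only [Nat.succ_eq_add_one] at h₃
    omega
  obtain ⟨f, hf⟩ : ∃ f, Searched (List.range n) (arcsOfRows (rowsOf G))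
      (maxL (List.range n) (arcsOfRows (rowsOf G)))
      (growL (List.range n) (arcsOfRows (rowsOf G))
        (maxL (List.range n) (arcsOfRows (rowsOf G)))) f := by
    refine searched_maxL List.nodup_range ?_
    rw [rel_arcsOfRows, List.toFinset_range]
    exact isGraph_natAdj G
  have hcont : ∀ i, continues (stateAt x i) = true ↔
      i < min k (n + 1) ∧ i + 1 ≤ matchingGap G := fun i => by
    rw [← any_testT_iff (rel_arcsOfRows G) hf, continues, Bool.and_eq_true, Bool.not_eq_true',
      ← Bool.not_eq_true, Nat.ble_eq, not_le]
    simp only [stateAt, x, length_rowsOf, cappedValue_bits]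
  have hgn := matchingGap_le G
  -- The number of turns: the loop stops as soon as the lower bound reaches the capped threshold or
  -- the gap itself.
  let m := min (min k (n + 1)) (matchingGap G)
  obtain ⟨t₁, ht₁, hr₁⟩ := h₁ x
  obtain ⟨t₂, ht₂, hr₂⟩ := Run.loop_iterate (c := p₂) (p := p₃) (fun i => enc (stateAt x i)) m (B X)
    (fun i hi => by
      obtain ⟨t, ht, hr⟩ := h₂ (stateAt x i)
      have hb := (hT₂ (stateAt x i)).trans (Nat.pow_le_pow_left (hz i (by omega)) _)
      refine ⟨_, t, ?_, by simp only [B]; omega, hr⟩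
      rw [(hcont i).2 (by omega)]
      exact fun h => Data.noConfusion h)
    (fun i hi => by
      obtain ⟨t, ht, hr⟩ := h₃ (stateAt x i)
      have hb := (hT₃ (stateAt x i)).trans (Nat.pow_le_pow_left (hz i (by omega)) _)
      rw [turn_stateAt] at hr
      exact ⟨t, by simp only [B]; omega, hr⟩)
    (by
      obtain ⟨t, ht, hr⟩ := h₂ (stateAt x m)
      have hb := (hT₂ (stateAt x m)).trans (Nat.pow_le_pow_left (hz m (by omega)) _)
      rw [show continues (stateAt x m) = false by
        rw [← Bool.not_eq_true, hcont]; omega] at hr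
      exact ⟨t, by simp only [B]; omega, hr⟩)
  obtain ⟨t₄, ht₄, hr₄⟩ := h₄ (stateAt x m)
  have hb₄ := (hT₄ (stateAt x m)).trans (Nat.pow_le_pow_left (hz m (by omega)) _)
  have hb₁ := (hT₁ x).trans (Nat.pow_le_pow_left hx _)
  have hm : (m + 1) * (2 * B X + 1) ≤ (X + 1) * (2 * B X + 1) :=
    Nat.mul_le_mul_right _ (by omega)
  -- As `μ ≤ n`, capping the threshold at `n + 1` does not change the answer.
  have hans : Nat.ble (stateAt x m).2.1 (stateAt x m).2.2.1 = decide (k ≤ matchingGap G) := by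
    rw [Bool.eq_iff_iff, Nat.ble_eq, decide_eq_true_eq]
    simp only [stateAt, x, length_rowsOf, cappedValue_bits]
    omega
  rw [show (fun s : State => Nat.ble s.2.1 s.2.2.1) (stateAt x m) = _ from hans] at hr₄
  exact ⟨_, by dsimp only; omega, .seq hr₁ (.seq hr₂ hr₄)⟩

end MatchingGap

/-- Whether `μ(G) ≥ k` can be decided in time `s ^ O(μ(G) + |A(G)| + 1)`, where `s` is the number
of vertices of `G` plus the number of binary digits of `k` plus two. -/
theorem mainTheorem9 :
    ∃ (p : MatchingGap.Prog) (c : ℕ),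
      MatchingGap.DecidesWithin p (fun {n} (G : SimpleGraph (Fin n)) (k : ℕ) =>
        (n + Nat.size k + 2) ^
          (c * (MatchingGap.matchingGap G + (MatchingGap.gallaiEdmondsA G).ncard + 1))) := by
  obtain ⟨p, F, ⟨c, hF⟩, h⟩ := MatchingGap.exists_decides
  -- The factor 3 comes from the unary code of `X`: its size plus one is `2 * X + 2`, which is at
  -- most `X ^ 3` since `X ≥ 2`.
  refine ⟨p, 3 * c, fun n G k => ?_⟩
  obtain ⟨t, ht, hr⟩ := h n G k
  refine ⟨t, ht.trans ((hF _).trans ?_), hr⟩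
  set X := (n + Nat.size k + 2) ^ (MatchingGap.matchingGap G + 1) with hX
  have h₂ : 2 ≤ X := (Nat.le_add_left 2 _).trans (Nat.le_self_pow (Nat.succ_ne_zero _) _)
  have h₃ : MatchingGap.esize X + 1 ≤ X ^ 3 := by
    rw [MatchingGap.esize_nat]
    nlinarith [Nat.mul_le_mul h₂ h₂]
  refine (Nat.pow_le_pow_left h₃ c).trans ?_
  rw [← pow_mul, hX, ← pow_mul]
  refine Nat.pow_le_pow_right (by omega) ?_
  rw [mul_comm]
  exact Nat.mul_le_mul_left _ (by omega)
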